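/- **Setting (FE-IDUU).** There are $n$ preemptable jobs of unit volume and unit weight with release times $0\le r_1\le\dots\le r_n$, and a single processor with speeds $0=s_0<s_1<\dots<s_k$, $k\ge1$, and power consumptions $0=P_0<P_1<\dots<P_k$. No speed is superfluous: for $1\le a<i<b\le k$ and $\lambda\in(0,1)$ with $\frac1{s_i}=\frac{\lambda}{s_a}+\frac{1-\lambda}{s_b}$ one has $\frac{P_i}{s_i}<\lambda\frac{P_a}{s_a}+(1-\lambda)\frac{P_b}{s_b}$. A schedule $\sigma=(J,S)$ assigns to each time $t\ge0$ a job $J(t)$ (or none) and a speed index $S(t)\in\{0,\dots,k\}$. Let $X_j(\sigma)=\{t: J(t)=j,\ S(t)>0\}$. The schedule is feasible if, for every job $j$, $J(t)\ne j$ for $t<r_j$, $\int_{X_j(\sigma)}s_{S(t)}\,dt=1$, and $X_j(\sigma)$ is bounded. Let $x_j(\sigma)=|X_j(\sigma)|$ be the processing time, $1/x_j(\sigma)$ the (average) speed and $C_j(\sigma)=\sup X_j(\sigma)$ the completion time of $j$. A feasible schedule is optimal if it minimizes flow plus energy, $\sum_j(C_j(\sigma)-r_j)+\int_0^\infty P_{S(t)}\,dt$,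 among all feasible schedules. The relation "$j$ affects $j'$" in $\sigma$ is the transitive closure of "$C_j(\sigma)\le C_{j'}(\sigma)$ and $C_j(\sigma)>r_{j'}$"; the affection $\kappa_j(\sigma)$ is the number of jobs affected by $j$. Let $\Delta_i=\frac{P_{i+1}s_i-P_is_{i+1}}{s_{i+1}-s_i}$ for $1\le i<k$ and $\Delta_k=\infty$; the shrinking energy $\Delta_j(\sigma)$ is $\Delta_i$ if the speed of $j$ lies in $[s_i,s_{i+1})$, and $\Delta_k$ if it equals $s_k$. For speeds $u_1,\dots,u_n\in[s_1,s_k]$, let $\sigma(u)$ be the schedule that processes the jobs in the order $1,\dots,n$, each as early as possible, job $j$ at average speed $u_j$ using only the given speeds next to $u_j$ (only $u_j$ itself if it is a given speed). **The $(\kappa-\Delta)$-algorithm.** Start with $u_j=s_1$ for all $j$. While there is a job $j$ with $\kappa_j-\Delta_j>0$ in $\sigma(u)$, choose a job $j^*$ that maximizes $\kappa_j-\Delta_j$ (ties are broken arbitrarily) and increase $u_{j^*}$ until, for the first time, $\kappa_{j^*}-\Delta_{j^*}\le0$ or $\kappa_{j^*}-\Delta_{j^*}\ne\max_j(\kappa_j-\Delta_j)$.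 In the variant with weak inequalities, "$>0$" and "$\le0$" are replaced by "$\ge0$" and "$<0$". **Theorem.** For both variants the following holds. For any number $k$ of speeds, every run of the algorithm is well defined (an iteration can be carried out as long as the loop condition holds), ends after at most $n^2k$ iterations, and ends with speeds $u$ for which $\sigma(u)$ is an optimal schedule. Moreover, the algorithm runs in polynomial time: there is a single program for a random access machine with arithmetic operations $+,-,\times,/$ and comparisons of numbers which, given $n$, $k$, the $r_j$, $s_i$ and $P_i$, outputs the final speeds of a run of the algorithm; the number of its steps is at most polynomial in $n+k$, for all real inputs, and, for rational inputs, its cost with every operation charged by the binary length of the numbers involved is at most polynomial in the binary length of the input. -/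

import Mathlib

open MeasureTheory

noncomputable section

namespace SpeedScaling

/-- An instance with `n` unit-size, unit-weight jobs, indexed in order of release, and with the
discrete speeds `0 = s 0 < s 1 < ⋯ < s k`, whose power consumptions are `0 = P 0 < ⋯ < P k`. -/
structure Inst where
  n : ℕ
  k : ℕ
  r : Fin n → ℝ
  s : Fin (k + 1) → ℝ
  P : Fin (k + 1) → ℝ
  k_pos : 0 < k
  r_nonneg : ∀ j, 0 ≤ r j
  r_mono : Monotone r
  s_zero : s 0 = 0
  s_strictMono : StrictMono s
  P_zero : P 0 = 0
  P_strictMono : StrictMono P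
  /-- No speed is superfluous: if processing one unit of volume at `s i` takes as long as
  processing it partly at `s a` and partly at `s b`, then it needs less energy. -/
  not_superfluous : ∀ a i b : Fin (k + 1), 0 < a → a < i → i < b →
    ∀ l : ℝ, 0 < l → l < 1 → 1 / s i = l * (1 / s a) + (1 - l) * (1 / s b) →
      P i / s i < l * (P a / s a) + (1 - l) * (P b / s b)

/-- A schedule: the job processed (`none` for idling) and the index of the speed, at every time
`t ≥ 0`. Values at negative times are irrelevant. -/
structure Schedule (I : Inst) where
  J : ℝ → Option (Fin I.n)
  S : ℝ → Fin (I.k + 1)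

namespace Schedule

variable {I : Inst} (σ : Schedule I)

/-- The times at which job `j` is processed. -/
def X (j : Fin I.n) : Set ℝ := {t | 0 ≤ t ∧ σ.J t = some j ∧ 0 < σ.S t}

/-- Feasibility: every job is processed only after its release, is processed completely, and is
completed at some finite time. -/
structure Feasible : Prop where
  measurable : ∀ (o : Option (Fin I.n)) (i : Fin (I.k + 1)),
    MeasurableSet {t | 0 ≤ t ∧ σ.J t = o ∧ σ.S t = i}
  released : ∀ (j : Fin I.n) (t : ℝ), 0 ≤ t → σ.J t = some j → I.r j ≤ t
  processed : ∀ j : Fin I.n, ∫ t in σ.X j, I.s (σ.S t) = 1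
  completed : ∀ j : Fin I.n, BddAbove (σ.X j)

/-- Processing time of `j`. -/
def x (j : Fin I.n) : ℝ := (volume (σ.X j)).toReal

/-- Average speed of `j` (which has volume one). -/
def speed (j : Fin I.n) : ℝ := 1 / σ.x j

/-- Completion time of `j`. -/
def C (j : Fin I.n) : ℝ := sSup (σ.X j)

/-- Total flow time. -/
def flow : ℝ := ∑ j, (σ.C j - I.r j)

/-- Total energy consumption. -/
def energy : ENNReal := ∫⁻ t in Set.Ici (0 : ℝ), ENNReal.ofReal (I.P (σ.S t))

/-- Flow plus energy. -/
def objective : EReal := (σ.flow : EReal) + (σ.energy : EReal)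

/-- `σ` is an optimal schedule, among all (possibly preemptive) feasible schedules. -/
def Optimal : Prop :=
  σ.Feasible ∧ ∀ σ' : Schedule I, σ'.Feasible → σ.objective ≤ σ'.objective

/-- `j` affects `j'`: the transitive closure of `C j ≤ C j'` and `r j' < C j`. -/
def Affects : Fin I.n → Fin I.n → Prop :=
  Relation.TransGen fun j j' => σ.C j ≤ σ.C j' ∧ I.r j' < σ.C j

/-- The affection `κ_j(σ)`; all weights are one. -/
def kappa (j : Fin I.n) : ℕ := Set.ncard {j' | σ.Affects j j'}

end Schedule

namespace Inst

variable (I : Inst)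

/-- `Δ_i`, with `Δ_0 = -∞` and `Δ_k = ∞`. -/
def Delta (i : Fin (I.k + 1)) : EReal :=
  if i = 0 then ⊥
  else if h : i.val < I.k then
    (((I.P ⟨i + 1, by omega⟩ * I.s i - I.P i * I.s ⟨i + 1, by omega⟩) /
      (I.s ⟨i + 1, by omega⟩ - I.s i) : ℝ) : EReal)
  else ⊤

/-- The largest `i` with `s i ≤ u`. -/
def floorLevel (u : ℝ) : Fin (I.k + 1) :=
  (Finset.univ.filter fun i => I.s i ≤ u).sup id

/-- The smallest `i` with `u ≤ s i`. -/
def ceilLevel (u : ℝ) : Fin (I.k + 1) :=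
  (Finset.univ.filter fun i => u ≤ I.s i).inf id

/-- The time for which a job of average speed `u` runs at the slower one of the two given speeds
next to `u`; it is `0` if `u` itself is a given speed. -/
def slowTime (u : ℝ) : ℝ :=
  (I.s (I.ceilLevel u) - u) / (u * (I.s (I.ceilLevel u) - I.s (I.floorLevel u)))

/-- The time at which the first `m` jobs are completed, if they are processed in order of release
without unnecessary idling, job `j` at average speed `v j`. -/
def done (v : Fin I.n → ℝ) : ℕ → ℝ
  | 0 => 0
  | m + 1 => if h : m < I.n then max (I.r ⟨m, h⟩) (done v m) + 1 / v ⟨m, h⟩ else done v m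

/-- The time at which job `j` is started. -/
def start (v : Fin I.n → ℝ) (j : Fin I.n) : ℝ := max (I.r j) (I.done v j)

open Classical in
/-- The job processed at time `t` under the speeds `v`. -/
def fifoJob (v : Fin I.n → ℝ) (t : ℝ) : Option (Fin I.n) :=
  if h : ∃ j : Fin I.n, I.start v j ≤ t ∧ t < I.done v (j + 1) then some h.choose else none

/-- The schedule that processes the jobs in order of release, without unnecessary idling, and
job `j` at average speed `v j`, using only the given speeds next to `v j`. -/
def fifo (v : Fin I.n → ℝ) : Schedule I where
  J := I.fifoJob v
  S t := match I.fifoJob v t with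
    | none => 0
    | some j => if t < I.start v j + I.slowTime (v j) then I.floorLevel (v j)
        else I.ceilLevel (v j)

end Inst

/-- The shrinking energy `Δ_j(σ)`, that is `Δ_i` if `s i ≤ speed j < s (i+1)`, and `∞` at the
highest speed. -/
def Schedule.shrinkingEnergy {I : Inst} (σ : Schedule I) (j : Fin I.n) : EReal :=
  I.Delta (I.floorLevel (σ.speed j))

/-- `κ_j(σ) - Δ_j(σ)`. -/
def Schedule.gain {I : Inst} (σ : Schedule I) (j : Fin I.n) : EReal :=
  ((σ.kappa j : ℝ) : EReal) - σ.shrinkingEnergy j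

/-! ### The algorithm -/

/-- Whether jobs are sped up only while `κ - Δ > 0`, or while `κ - Δ ≥ 0`. -/
inductive Rule
  | positive
  | nonneg

/-- The gains at which the algorithm goes on. -/
def Rule.Active : Rule → EReal → Prop
  | .positive, g => 0 < g
  | .nonneg, g => 0 ≤ g

namespace Inst

variable (I : Inst) (ρ : Rule)

/-- All jobs at the lowest positive speed. -/
def lowest : Fin I.n → ℝ := fun _ => I.s ⟨1, Nat.succ_lt_succ I.k_pos⟩

/-- Job `j` may be sped up: its gain is active and maximum among all jobs. -/
def CanSpeedUp (v : Fin I.n → ℝ) (j : Fin I.n) : Prop :=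
  ρ.Active ((I.fifo v).gain j) ∧ ∀ j', (I.fifo v).gain j' ≤ (I.fifo v).gain j

/-- One iteration of the loop: a job `j` of maximum, active gain is sped up until, for the first
time, its gain fails to be active or to be maximum. Ties are broken arbitrarily. -/
def Iteration (v v' : Fin I.n → ℝ) : Prop :=
  ∃ (j : Fin I.n) (u : ℝ), v j < u ∧ v' = Function.update v j u ∧
    (∀ w, v j ≤ w → w < u → I.CanSpeedUp ρ (Function.update v j w) j) ∧
    ¬ I.CanSpeedUp ρ (Function.update v j u) j

/-- The loop ends: no job has an active gain. -/
def Halted (v : Fin I.n → ℝ) : Prop := ∀ j, ¬ ρ.Active ((I.fifo v).gain j)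

/-- `Run m v`: the algorithm can have reached the speeds `v` after `m` iterations. -/
inductive Run : ℕ → (Fin I.n → ℝ) → Prop
  | init : Run 0 I.lowest
  | step {m : ℕ} {v v' : Fin I.n → ℝ} : Run m v → I.Iteration ρ v v' → Run (m + 1) v'

end Inst

/-! ### The machine model

A random access machine with counters `idx x` and arrays of numbers `num a`, programmed in a
structured language. Counters serve as addresses; a counter can only be set to zero, copied, or
changed by one, so that no counter exceeds the largest initial one plus the number of steps. -/

structure Store where
  idx : ℕ → ℕ
  num : ℕ → ℕ → ℝ

/-- The entry of the array `a` at the address held by the counter `x`. -/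
def Store.get (m : Store) (a x : ℕ) : ℝ := m.num a (m.idx x)

def Store.setIdx (m : Store) (x i : ℕ) : Store := { m with idx := Function.update m.idx x i }

def Store.set (m : Store) (a x : ℕ) (z : ℝ) : Store :=
  { m with num := Function.update m.num a (Function.update (m.num a) (m.idx x) z) }

inductive Arith
  | add
  | sub
  | mul
  | div

/-- The operations; division by zero gives zero. -/
def Arith.eval : Arith → ℝ → ℝ → ℝ
  | .add, y, z => y + z
  | .sub, y, z => y - z
  | .mul, y, z => y * z
  | .div, y, z => y / z

inductive Test
  | idxLt (x y : ℕ)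
  | numLt (a x b y : ℕ)

def Test.Holds : Test → Store → Prop
  | .idxLt x y, m => m.idx x < m.idx y
  | .numLt a x b y, m => m.get a x < m.get b y

inductive Cmd
  | skip
  | zero (x : ℕ)
  | copy (x y : ℕ)
  | inc (x : ℕ)
  | dec (x : ℕ)
  | const (a x c : ℕ)
  | arith (o : Arith) (a x b y c z : ℕ)
  | seq (p q : Cmd)
  | cond (t : Test) (p q : Cmd)
  | loop (t : Test) (p : Cmd)

/-- The cost of a test, where handling a number `z` costs `ω z` on top of the unit cost. -/
def Test.cost (ω : ℝ → ℕ) : Test → Store → ℕ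
  | .idxLt _ _, _ => 1
  | .numLt a x b y, m => 1 + ω (m.get a x) + ω (m.get b y)

/-- `Exec ω p m m' t`: the program `p`, started on `m`, halts with the store `m'` after a total
cost of `t`. -/
inductive Exec (ω : ℝ → ℕ) : Cmd → Store → Store → ℕ → Prop
  | skip (m : Store) : Exec ω .skip m m 1
  | zero (m : Store) (x : ℕ) : Exec ω (.zero x) m (m.setIdx x 0) 1
  | copy (m : Store) (x y : ℕ) : Exec ω (.copy x y) m (m.setIdx x (m.idx y)) 1
  | inc (m : Store) (x : ℕ) : Exec ω (.inc x) m (m.setIdx x (m.idx x + 1)) 1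
  | dec (m : Store) (x : ℕ) : Exec ω (.dec x) m (m.setIdx x (m.idx x - 1)) 1
  | const (m : Store) (a x c : ℕ) : Exec ω (.const a x c) m (m.set a x c) (1 + ω c)
  | arith (m : Store) (o : Arith) (a x b y c z : ℕ) :
      Exec ω (.arith o a x b y c z) m (m.set a x (o.eval (m.get b y) (m.get c z)))
        (1 + ω (m.get b y) + ω (m.get c z) + ω (o.eval (m.get b y) (m.get c z)))
  | seq {p q : Cmd} {m m' m'' : Store} {t t' : ℕ} :
      Exec ω p m m' t → Exec ω q m' m'' t' → Exec ω (.seq p q) m m'' (t + t')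
  | cond_true {b : Test} {p q : Cmd} {m m' : Store} {t : ℕ} :
      b.Holds m → Exec ω p m m' t → Exec ω (.cond b p q) m m' (b.cost ω m + t)
  | cond_false {b : Test} {p q : Cmd} {m m' : Store} {t : ℕ} :
      ¬ b.Holds m → Exec ω q m m' t → Exec ω (.cond b p q) m m' (b.cost ω m + t)
  | loop_true {b : Test} {p : Cmd} {m m' m'' : Store} {t t' : ℕ} :
      b.Holds m → Exec ω p m m' t → Exec ω (.loop b p) m' m'' t' →
        Exec ω (.loop b p) m m'' (b.cost ω m + t + t')
  | loop_false {b : Test} {p : Cmd} {m : Store} :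
      ¬ b.Holds m → Exec ω (.loop b p) m m (b.cost ω m)

/-- Unit costs: the number of executed instructions and tests. -/
def unitCost : ℝ → ℕ := fun _ => 0

open Classical in
/-- The length of the binary representation of a rational number (as a reduced fraction).
It is used for rational inputs only, on which all numbers that occur are rational. -/
def bitSize (z : ℝ) : ℕ :=
  if h : ∃ q : ℚ, (q : ℝ) = z then 1 + Nat.size h.choose.num.natAbs + Nat.size h.choose.den else 0

namespace Inst

variable (I : Inst)

/-- The store that holds the instance: `n` and `k` in the first two counters, and the release
times, speeds and power consumptions in the first three arrays. -/
def input : Store where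
  idx x := if x = 0 then I.n else if x = 1 then I.k else 0
  num a i :=
    if a = 0 then (if h : i < I.n then I.r ⟨i, h⟩ else 0)
    else if a = 1 then (if h : i < I.k + 1 then I.s ⟨i, h⟩ else 0)
    else if a = 2 then (if h : i < I.k + 1 then I.P ⟨i, h⟩ else 0)
    else 0

/-- All numbers of the instance are rational. -/
def IsRational : Prop :=
  (∀ j, ∃ q : ℚ, (q : ℝ) = I.r j) ∧ (∀ i, ∃ q : ℚ, (q : ℝ) = I.s i) ∧
    ∀ i, ∃ q : ℚ, (q : ℝ) = I.P i

/-- The length of the binary encoding of a rational instance. -/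
def size : ℕ :=
  I.n + I.k + ∑ j, bitSize (I.r j) + ∑ i, bitSize (I.s i) + ∑ i, bitSize (I.P i)

end Inst

end SpeedScaling

end

/-!
Optimality is a weak duality. A multiplier `c j` prices a delay of the jobs from `j` on by one unit
of time. A unit of volume that is processed at level `i` for job `j` then costs `(P i + c j) / s i`.
Since no speed is superfluous, the levels next to the speed of `j` are the cheapest ones if `c j`
lies between the shrinking energies just below and at this speed. If the multipliers drop by one
wherever a job is released before the preceding one is completed, and end with one in every busy
period, then the delays telescope to the flow. Another feasible schedule is compared through the
times at which it has processed a volume of `m`, whatever the jobs that it assigns to this volume.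

Such multipliers exist at the end of a run because no job is sped up too much. Just before the last
increase of the speed of `m` ended, its gain `κ - Δ` was maximal and nonnegative. Hence the sum of
`m` and the shrinking energy just below its speed exceeds neither this sum for another job tied to
`m`, taken at the speed of that job, nor the end of the jobs that are weakly affected by `m`. The
multiplier of `j` is the least of these bounds over the jobs tied to `j`, minus the position of `j`.
It is at least one, as no gain is positive at the end of the run.

Gains change only when a speed reaches a level or a link between consecutive jobs is lost. As speeds
only increase, neither event is repeated. There are at most `n * k + n` events, `n` of which have
happened at the start, so that there are at most `n * k` iterations.

The program proceeds from event to event. The times at which it stops are integer combinations of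
the release times and the numbers `1 / s i`. They have a common denominator of linear length, which
keeps the numbers small.
-/

noncomputable section

namespace SpeedScaling

/-! ### Levels, shrinking energies and prices -/

section FilterSup

variable {α : Type*} [LinearOrder α] [Fintype α] {p : α → Prop} [DecidablePred p]

lemma le_sup_filter_iff [OrderBot α] (hbot : p ⊥) (hanti : ∀ ⦃a b⦄, a ≤ b → p b → p a) (i : α) :
    i ≤ (Finset.univ.filter p).sup id ↔ p i := by
  refine ⟨fun h => ?_, fun h =>
    Finset.le_sup (f := id) (Finset.mem_filter.2 ⟨Finset.mem_univ _, h⟩)⟩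
  obtain ⟨a, ha, hsup⟩ := Finset.exists_mem_eq_sup (Finset.univ.filter p)
    ⟨⊥, Finset.mem_filter.2 ⟨Finset.mem_univ _, hbot⟩⟩ id
  exact hanti (h.trans_eq hsup) (Finset.mem_filter.1 ha).2

lemma inf_filter_le_iff [OrderTop α] (htop : p ⊤) (hmono : ∀ ⦃a b⦄, a ≤ b → p a → p b) (i : α) :
    (Finset.univ.filter p).inf id ≤ i ↔ p i := by
  refine ⟨fun h => ?_, fun h =>
    Finset.inf_le (f := id) (Finset.mem_filter.2 ⟨Finset.mem_univ _, h⟩)⟩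
  obtain ⟨a, ha, hinf⟩ := Finset.exists_mem_eq_inf (Finset.univ.filter p)
    ⟨⊤, Finset.mem_filter.2 ⟨Finset.mem_univ _, htop⟩⟩ id
  exact hmono (hinf.symm.trans_le h) (Finset.mem_filter.1 ha).2

end FilterSup

namespace Inst

variable (I : Inst)

/-- The `i`-th speed, extended by `0` beyond the last level so that levels can be natural
numbers. -/
def speedAt (i : ℕ) : ℝ := if h : i < I.k + 1 then I.s ⟨i, h⟩ else 0

/-- The `i`-th power consumption, extended by `0` beyond the last level. -/
def powerAt (i : ℕ) : ℝ := if h : i < I.k + 1 then I.P ⟨i, h⟩ else 0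

/-- The `i`-th release time, extended by `0` beyond the last job. -/
def releaseAt (i : ℕ) : ℝ := if h : i < I.n then I.r ⟨i, h⟩ else 0

/-- The shrinking energy `Δ_i` as a real number. At the highest speed, where `Δ_k = ∞`, it is
replaced by a number that exceeds every affection. -/
def shrinkAt (i : ℕ) : ℝ :=
  if i < I.k then
    (I.powerAt (i + 1) * I.speedAt i - I.powerAt i * I.speedAt (i + 1)) /
      (I.speedAt (i + 1) - I.speedAt i)
  else I.n + 1

/-- The largest level whose speed is below `u`. -/
def predLevel (u : ℝ) : Fin (I.k + 1) :=
  (Finset.univ.filter fun i => I.s i < u).sup id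

/-- `Inst.floorLevel` as a natural number. -/
def floorIdx (u : ℝ) : ℕ := (I.floorLevel u).val

/-- `Inst.predLevel` as a natural number. -/
def predIdx (u : ℝ) : ℕ := (I.predLevel u).val

/-- The cost of processing one unit of volume at the level `i`, if time costs `c` per unit on top
of the energy. -/
def price (c : ℝ) (i : ℕ) : ℝ := (I.powerAt i + c) / I.speedAt i

variable {I}

lemma speedAt_val (i : Fin (I.k + 1)) : I.speedAt i = I.s i := dif_pos i.isLt

lemma powerAt_val (i : Fin (I.k + 1)) : I.powerAt i = I.P i := dif_pos i.isLt

lemma releaseAt_val (j : Fin I.n) : I.releaseAt j = I.r j := dif_pos j.isLt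

lemma speedAt_zero : I.speedAt 0 = 0 := (speedAt_val 0).trans I.s_zero

lemma speedAt_lt {i j : ℕ} (h : i < j) (hj : j ≤ I.k) : I.speedAt i < I.speedAt j := by
  rw [speedAt, speedAt, dif_pos (by omega), dif_pos (by omega)]
  exact I.s_strictMono h

lemma speedAt_le {i j : ℕ} (h : i ≤ j) (hj : j ≤ I.k) : I.speedAt i ≤ I.speedAt j :=
  h.eq_or_lt.elim (fun h => h ▸ le_rfl) fun h => (speedAt_lt h hj).le

lemma speedAt_pos {i : ℕ} (h : 0 < i) (hi : i ≤ I.k) : 0 < I.speedAt i :=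
  speedAt_zero.symm.trans_lt (speedAt_lt h hi)

lemma speedAt_one_pos : 0 < I.speedAt 1 := speedAt_pos one_pos I.k_pos

lemma P_nonneg (i : Fin (I.k + 1)) : 0 ≤ I.P i :=
  I.P_zero.symm.trans_le (I.P_strictMono.monotone (Fin.zero_le i))

lemma releaseAt_nonneg (i : ℕ) : 0 ≤ I.releaseAt i := by
  unfold releaseAt
  split_ifs
  · exact I.r_nonneg _
  · exact le_rfl

lemma releaseAt_mono {i j : ℕ} (h : i ≤ j) (hj : j < I.n) : I.releaseAt i ≤ I.releaseAt j := by
  rw [releaseAt, releaseAt, dif_pos (by omega), dif_pos hj]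
  exact I.r_mono h

lemma shrinkAt_of_lt {i : ℕ} (h : i < I.k) :
    I.shrinkAt i = (I.powerAt (i + 1) * I.speedAt i - I.powerAt i * I.speedAt (i + 1)) /
      (I.speedAt (i + 1) - I.speedAt i) := if_pos h

lemma shrinkAt_of_le {i : ℕ} (h : I.k ≤ i) : I.shrinkAt i = I.n + 1 := if_neg h.not_gt

lemma Delta_of_lt {i : Fin (I.k + 1)} (h0 : 0 < i) (h : i.val < I.k) :
    I.Delta i = ((I.shrinkAt i : ℝ) : EReal) := by
  have hsucc : i.val + 1 < I.k + 1 := by omega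
  rw [Delta, if_neg h0.ne', dif_pos h, shrinkAt_of_lt h, speedAt_val, powerAt_val, speedAt, powerAt,
    dif_pos hsucc, dif_pos hsucc]

lemma Delta_top {i : Fin (I.k + 1)} (h : i.val = I.k) : I.Delta i = ⊤ := by
  have hi : i ≠ 0 := fun hi => I.k_pos.ne (by simpa [hi] using h)
  rw [Delta, if_neg hi, dif_neg h.not_lt]

/-! As `1 / s i` is the convex combination of `1 / s a` and `1 / s b` in which `1 / s a` has the
weight `s a (s b - s i) / (s i (s b - s a))`, no speed is superfluous exactly if power is a strictly
convex function of speed. -/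

lemma power_lt_chord {a i b : Fin (I.k + 1)} (h0 : 0 < a) (hai : a < i) (hib : i < b) :
    I.P i * (I.s b - I.s a) < (I.s b - I.s i) * I.P a + (I.s i - I.s a) * I.P b := by
  have hsa : 0 < I.s a := I.s_zero.symm.trans_lt (I.s_strictMono h0)
  have hsai : I.s a < I.s i := I.s_strictMono hai
  have hsib : I.s i < I.s b := I.s_strictMono hib
  have not_superfluous := I.not_superfluous a i b h0 hai hib
  generalize I.s a = x at *
  generalize I.s i = y at *
  generalize I.s b = z at *
  have hy : 0 < y := hsa.trans hsai
  have hz : 0 < z := hy.trans hsib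
  have hzx : 0 < z - x := by linarith
  have := sub_pos.2 hsib
  set l := x * (z - y) / (y * (z - x)) with hl
  have hl_pos : 0 < l := by positivity
  have hl_lt : l < 1 := by
    rw [hl, div_lt_one (by positivity)]
    nlinarith
  have hl_compl : 1 - l = z * (y - x) / (y * (z - x)) := by
    rw [hl]
    field_simp
    ring
  have hlt : I.P i / y < l * (I.P a / x) + (1 - l) * (I.P b / z) := by
    refine not_superfluous l hl_pos hl_lt ?_
    rw [hl_compl, hl]
    field_simp
    ring
  calc I.P i * (z - x) = I.P i / y * (y * (z - x)) := by field_simp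
    _ < (l * (I.P a / x) + (1 - l) * (I.P b / z)) * (y * (z - x)) :=
      mul_lt_mul_of_pos_right hlt (by positivity)
    _ = (z - y) * I.P a + (y - x) * I.P b := by
      rw [hl_compl, hl]
      field_simp

lemma shrinkAt_le_succ {i : ℕ} (h0 : 0 < i) (h : i + 1 < I.k) :
    I.shrinkAt i ≤ I.shrinkAt (i + 1) := by
  have hs : 0 < I.speedAt i := speedAt_pos h0 (by omega)
  have hs' : I.speedAt i < I.speedAt (i + 1) := speedAt_lt (by omega) (by omega)
  have hs'' : I.speedAt (i + 1) < I.speedAt (i + 1 + 1) := speedAt_lt (by omega) (by omega)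
  have chord := power_lt_chord (I := I) (a := ⟨i, by omega⟩) (i := ⟨i + 1, by omega⟩)
    (b := ⟨i + 1 + 1, by omega⟩) (Fin.mk_lt_mk.2 h0) (Fin.mk_lt_mk.2 (by omega))
    (Fin.mk_lt_mk.2 (by omega))
  simp only [← speedAt_val, ← powerAt_val] at chord
  rw [shrinkAt_of_lt (by omega), shrinkAt_of_lt h, div_le_div_iff₀ (by linarith) (by linarith)]
  nlinarith

lemma shrinkAt_mono {i j : ℕ} (h0 : 0 < i) (h : i ≤ j) (hj : j < I.k) :
    I.shrinkAt i ≤ I.shrinkAt j := by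
  induction j, h using Nat.le_induction with
  | base => exact le_rfl
  | succ j hij ih => exact (ih (by omega)).trans (shrinkAt_le_succ (by omega) hj)

lemma le_floorLevel_iff {u : ℝ} (hu : 0 ≤ u) (i : Fin (I.k + 1)) :
    i ≤ I.floorLevel u ↔ I.s i ≤ u :=
  le_sup_filter_iff (p := fun i => I.s i ≤ u) (I.s_zero.trans_le hu)
    (fun _ _ h => (I.s_strictMono.monotone h).trans) i

lemma le_predLevel_iff {u : ℝ} (hu : 0 < u) (i : Fin (I.k + 1)) :
    i ≤ I.predLevel u ↔ I.s i < u :=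
  le_sup_filter_iff (p := fun i => I.s i < u) (I.s_zero.trans_lt hu)
    (fun _ _ h => (I.s_strictMono.monotone h).trans_lt) i

lemma ceilLevel_le_iff {u : ℝ} (hu : u ≤ I.speedAt I.k) (i : Fin (I.k + 1)) :
    I.ceilLevel u ≤ i ↔ u ≤ I.s i :=
  inf_filter_le_iff (p := fun i => u ≤ I.s i) (hu.trans_eq (speedAt_val (Fin.last I.k)))
    (fun _ _ h h' => h'.trans (I.s_strictMono.monotone h)) i

lemma s_floorLevel_le {u : ℝ} (hu : 0 ≤ u) : I.s (I.floorLevel u) ≤ u :=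
  (le_floorLevel_iff hu _).1 le_rfl

lemma le_s_ceilLevel {u : ℝ} (hu : u ≤ I.speedAt I.k) : u ≤ I.s (I.ceilLevel u) :=
  (ceilLevel_le_iff hu _).1 le_rfl

lemma floorIdx_le (u : ℝ) : I.floorIdx u ≤ I.k := Nat.lt_succ_iff.1 (I.floorLevel u).isLt

lemma predIdx_le (u : ℝ) : I.predIdx u ≤ I.k := Nat.lt_succ_iff.1 (I.predLevel u).isLt

lemma le_floorIdx_iff {u : ℝ} (hu : 0 ≤ u) {i : ℕ} (hi : i ≤ I.k) :
    i ≤ I.floorIdx u ↔ I.speedAt i ≤ u := by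
  rw [speedAt, dif_pos (Nat.lt_succ_iff.2 hi)]
  exact le_floorLevel_iff hu ⟨i, Nat.lt_succ_iff.2 hi⟩

lemma le_predIdx_iff {u : ℝ} (hu : 0 < u) {i : ℕ} (hi : i ≤ I.k) :
    i ≤ I.predIdx u ↔ I.speedAt i < u := by
  rw [speedAt, dif_pos (Nat.lt_succ_iff.2 hi)]
  exact le_predLevel_iff hu ⟨i, Nat.lt_succ_iff.2 hi⟩

lemma speedAt_floorIdx_le {u : ℝ} (hu : 0 ≤ u) : I.speedAt (I.floorIdx u) ≤ u :=
  (le_floorIdx_iff hu (floorIdx_le u)).1 le_rfl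

lemma speedAt_predIdx_lt {u : ℝ} (hu : 0 < u) : I.speedAt (I.predIdx u) < u :=
  (le_predIdx_iff hu (predIdx_le u)).1 le_rfl

lemma lt_speedAt_floorIdx_succ {u : ℝ} (hu : 0 ≤ u) (h : I.floorIdx u < I.k) :
    u < I.speedAt (I.floorIdx u + 1) :=
  not_le.1 fun hc => (Nat.lt_succ_self _).not_ge ((le_floorIdx_iff hu h).2 hc)

lemma floorIdx_eq {u : ℝ} {i : ℕ} (hi : i < I.k) (h : I.speedAt i ≤ u)
    (h' : u < I.speedAt (i + 1)) : I.floorIdx u = i := by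
  have hu : 0 ≤ u := speedAt_zero.symm.trans_le ((speedAt_le (Nat.zero_le i) hi.le).trans h)
  refine le_antisymm (Nat.lt_succ_iff.1 (not_le.1 fun hc => ?_)) ((le_floorIdx_iff hu hi.le).2 h)
  exact h'.not_ge ((le_floorIdx_iff hu hi).1 hc)

lemma floorIdx_mono {u w : ℝ} (hu : 0 ≤ u) (h : u ≤ w) : I.floorIdx u ≤ I.floorIdx w :=
  (le_floorIdx_iff (hu.trans h) (floorIdx_le u)).2 ((speedAt_floorIdx_le hu).trans h)

lemma predIdx_le_floorIdx {u : ℝ} (hu : 0 < u) : I.predIdx u ≤ I.floorIdx u :=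
  (le_floorIdx_iff hu.le (predIdx_le u)).2 (speedAt_predIdx_lt hu).le

lemma floorIdx_le_predIdx {u w : ℝ} (hu : 0 ≤ u) (h : u < w) : I.floorIdx u ≤ I.predIdx w :=
  (le_predIdx_iff (hu.trans_lt h) (floorIdx_le u)).2 ((speedAt_floorIdx_le hu).trans_lt h)

lemma predIdx_lt {u : ℝ} (hu : 0 < u) (h : u ≤ I.speedAt I.k) : I.predIdx u < I.k :=
  (predIdx_le u).lt_of_ne fun hc => (hc ▸ speedAt_predIdx_lt hu).not_ge h

lemma floorIdx_eq_top_iff {u : ℝ} (hu : 0 ≤ u) : I.floorIdx u = I.k ↔ I.speedAt I.k ≤ u := by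
  rw [← le_floorIdx_iff hu le_rfl, (floorIdx_le u).ge_iff_eq]

lemma floorIdx_pos {u : ℝ} (h : I.speedAt 1 ≤ u) : 0 < I.floorIdx u :=
  (le_floorIdx_iff (speedAt_one_pos.le.trans h) I.k_pos).2 h

lemma predIdx_pos {u : ℝ} (h : I.speedAt 1 < u) : 0 < I.predIdx u :=
  (le_predIdx_iff (speedAt_one_pos.trans h) I.k_pos).2 h

lemma eventually_floorIdx_eq_predIdx {u : ℝ} (hu : 0 < u) :
    ∀ᶠ w in nhdsWithin u (Set.Iio u), I.floorIdx w = I.predIdx u := by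
  filter_upwards [nhdsWithin_le_nhds (lt_mem_nhds (speedAt_predIdx_lt hu)),
    nhdsWithin_le_nhds (lt_mem_nhds hu), self_mem_nhdsWithin] with w hw hw0 hwu
  exact le_antisymm (floorIdx_le_predIdx hw0.le hwu)
    ((le_floorIdx_iff hw0.le (predIdx_le u)).2 hw.le)

lemma eventually_floorIdx_eq {u : ℝ} (hu : 0 ≤ u) :
    ∀ᶠ w in nhdsWithin u (Set.Ici u), I.floorIdx w = I.floorIdx u := by
  by_cases h : I.floorIdx u < I.k
  · filter_upwards [nhdsWithin_le_nhds (gt_mem_nhds (lt_speedAt_floorIdx_succ hu h)),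
      self_mem_nhdsWithin] with w hw hwu
    exact floorIdx_eq h ((speedAt_floorIdx_le hu).trans hwu) hw
  · filter_upwards [self_mem_nhdsWithin] with w hwu
    exact le_antisymm ((floorIdx_le w).trans (not_lt.1 h)) (floorIdx_mono hu hwu)

lemma price_succ_le {c : ℝ} {i : ℕ} (h0 : 0 < i) (h : i < I.k) (hc : I.shrinkAt i ≤ c) :
    I.price c (i + 1) ≤ I.price c i := by
  have hs := speedAt_pos h0 h.le
  have hs' : I.speedAt i < I.speedAt (i + 1) := speedAt_lt (by omega) h
  rw [shrinkAt_of_lt h, div_le_iff₀ (by linarith)] at hc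
  rw [price, price, div_le_div_iff₀ (hs.trans hs') hs]
  nlinarith

lemma price_le_succ {c : ℝ} {i : ℕ} (h0 : 0 < i) (h : i < I.k) (hc : c ≤ I.shrinkAt i) :
    I.price c i ≤ I.price c (i + 1) := by
  have hs := speedAt_pos h0 h.le
  have hs' : I.speedAt i < I.speedAt (i + 1) := speedAt_lt (by omega) h
  rw [shrinkAt_of_lt h, le_div_iff₀ (by linarith)] at hc
  rw [price, price, div_le_div_iff₀ hs (hs.trans hs')]
  nlinarith

lemma price_le_of_le_shrinkAt {c : ℝ} {a i : ℕ} (h0 : 0 < a) (hai : a ≤ i) (hi : i ≤ I.k)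
    (hc : a < I.k → c ≤ I.shrinkAt a) : I.price c a ≤ I.price c i := by
  induction i, hai using Nat.le_induction with
  | base => exact le_rfl
  | succ i hai ih =>
    exact (ih (by omega)).trans (price_le_succ (by omega) hi
      ((hc (by omega)).trans (shrinkAt_mono h0 hai hi)))

lemma price_le_of_shrinkAt_le {c : ℝ} {a i : ℕ} (h0 : 0 < i) (hia : i ≤ a) (ha : a ≤ I.k)
    (hc : ∀ m, 0 < m → m < a → I.shrinkAt m ≤ c) : I.price c a ≤ I.price c i := by
  induction a, hia using Nat.le_induction with
  | base => exact le_rfl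
  | succ a hia ih =>
    exact (price_succ_le (by omega) ha (hc a (by omega) (Nat.lt_succ_self a))).trans
      (ih (by omega) fun m hm hma => hc m hm (hma.trans (Nat.lt_succ_self a)))

lemma price_floorIdx_le {u c : ℝ} (hu1 : I.speedAt 1 ≤ u) (huk : u ≤ I.speedAt I.k)
    (hpred : I.speedAt 1 < u → I.shrinkAt (I.predIdx u) ≤ c)
    (hfloor : I.floorIdx u < I.k → c ≤ I.shrinkAt (I.floorIdx u)) {i : ℕ} (h0 : 0 < i)
    (hi : i ≤ I.k) : I.price c (I.floorIdx u) ≤ I.price c i := by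
  have hu : 0 < u := speedAt_one_pos.trans_le hu1
  rcases le_total (I.floorIdx u) i with h | h
  · exact price_le_of_le_shrinkAt (floorIdx_pos hu1) h hi hfloor
  · refine price_le_of_shrinkAt_le h0 h (floorIdx_le u) fun m hm hmu => ?_
    have hlt : I.speedAt m < u :=
      (speedAt_lt hmu (floorIdx_le u)).trans_le (speedAt_floorIdx_le hu.le)
    have hmk : m ≤ I.k := hmu.le.trans (floorIdx_le u)
    exact (shrinkAt_mono hm ((le_predIdx_iff hu hmk).2 hlt) (predIdx_lt hu huk)).trans
      (hpred ((speedAt_le hm hmk).trans_lt hlt))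

end Inst

/-! ### Completion times as functions of the speeds -/

/-- The first index after `j` at which `p` fails. It is used to describe the end of a maximal
sequence of jobs without a gap; if `p` never fails after `j`, then it is the junk value `0`. -/
def firstFail (p : ℕ → Prop) (j : ℕ) : ℕ := sInf {e | j < e ∧ ¬ p e}

section firstFail

variable {p : ℕ → Prop} {j N : ℕ}

lemma firstFail_mem (hN : j < N) (h : ¬ p N) : j < firstFail p j ∧ ¬ p (firstFail p j) :=
  Nat.sInf_mem (s := {e | j < e ∧ ¬ p e}) ⟨N, hN, h⟩

lemma firstFail_le (hN : j < N) (h : ¬ p N) : firstFail p j ≤ N :=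
  Nat.sInf_le (s := {e | j < e ∧ ¬ p e}) ⟨hN, h⟩

lemma of_lt_firstFail {i : ℕ} (hj : j < i) (hi : i < firstFail p j) : p i :=
  by_contra fun h => (firstFail_le hj h).not_gt hi

lemma firstFail_congr {j' : ℕ} (hj : j ≤ j') (h : ∀ i, j < i → i ≤ j' → p i) :
    firstFail p j = firstFail p j' := by
  have heq : {e | j < e ∧ ¬ p e} = {e | j' < e ∧ ¬ p e} := by
    ext e
    exact ⟨fun ⟨hje, he⟩ => ⟨not_le.1 fun hej => he (h e hje hej), he⟩,
      fun ⟨hje, he⟩ => ⟨hj.trans_lt hje, he⟩⟩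
  rw [firstFail, firstFail, heq]

end firstFail

/-- The gains at which the algorithm goes on, as real numbers. -/
def Rule.RealActive : Rule → ℝ → Prop
  | .positive, g => 0 < g
  | .nonneg, g => 0 ≤ g

lemma Rule.RealActive.nonneg {ρ : Rule} {g : ℝ} (h : ρ.RealActive g) : 0 ≤ g := by
  cases ρ
  · exact le_of_lt h
  · exact h

lemma Rule.RealActive.mono {ρ : Rule} {g g' : ℝ} (h : ρ.RealActive g) (hg : g ≤ g') :
    ρ.RealActive g' := by
  cases ρ
  · exact lt_of_lt_of_le h hg
  · exact le_trans h hg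

namespace Inst

variable {I : Inst} {v : Fin I.n → ℝ} {j : Fin I.n} {u : ℝ}

lemma done_succ (v : Fin I.n → ℝ) (j : Fin I.n) :
    I.done v (j + 1) = max (I.r j) (I.done v j) + 1 / v j := by
  simp [done, j.isLt]

lemma done_succ_of_lt (v : Fin I.n → ℝ) {m : ℕ} (hm : m < I.n) :
    I.done v (m + 1) = max (I.releaseAt m) (I.done v m) + 1 / v ⟨m, hm⟩ := by
  simp [done, releaseAt, hm]

lemma done_succ_of_ge (v : Fin I.n → ℝ) {m : ℕ} (hm : I.n ≤ m) :
    I.done v (m + 1) = I.done v m := by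
  simp [done, hm.not_gt]

lemma done_congr {v' : Fin I.n → ℝ} {m : ℕ} (h : ∀ i : Fin I.n, i.val < m → v i = v' i) :
    I.done v m = I.done v' m := by
  induction m with
  | zero => rfl
  | succ m ih =>
    have hdone := ih fun i hi => h i (hi.trans m.lt_succ_self)
    rcases lt_or_ge m I.n with hm | hm
    · rw [done_succ_of_lt v hm, done_succ_of_lt v' hm, hdone, h ⟨m, hm⟩ m.lt_succ_self]
    · rw [done_succ_of_ge v hm, done_succ_of_ge v' hm, hdone]

lemma done_update_of_le {m : ℕ} (hm : m ≤ j) :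
    I.done (Function.update v j u) m = I.done v m :=
  done_congr fun _ hi => Function.update_of_ne (Fin.ne_of_lt (hi.trans_le hm)) _ _

lemma done_anti {v v' : Fin I.n → ℝ} (h0 : ∀ i, 0 < v i) (h : ∀ i, v i ≤ v' i) (m : ℕ) :
    I.done v' m ≤ I.done v m := by
  induction m with
  | zero => exact le_rfl
  | succ m ih =>
    rcases lt_or_ge m I.n with hm | hm
    · rw [done_succ_of_lt v hm, done_succ_of_lt v' hm]
      exact add_le_add (max_le_max le_rfl ih) (one_div_le_one_div_of_le (h0 _) (h _))
    · rwa [done_succ_of_ge v hm, done_succ_of_ge v' hm]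

lemma done_update_le (h0 : ∀ i, 0 < v i) (hu : v j ≤ u) (m : ℕ) :
    I.done (Function.update v j u) m ≤ I.done v m :=
  done_anti h0 (le_update_iff.2 ⟨hu, fun _ _ => le_rfl⟩) m

lemma continuousAt_done_update (v : Fin I.n → ℝ) (j : Fin I.n) (hu : u ≠ 0) (m : ℕ) :
    ContinuousAt (fun w => I.done (Function.update v j w) m) u := by
  induction m with
  | zero => exact continuousAt_const
  | succ m ih =>
    rcases lt_or_ge m I.n with hm | hm
    · simp only [done_succ_of_lt _ hm]
      refine (continuousAt_const.max ih).add ?_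
      by_cases h : (⟨m, hm⟩ : Fin I.n) = j
      · subst h
        simp only [Function.update_self]
        exact continuousAt_const.div continuousAt_id hu
      · simp only [Function.update_of_ne h]
        exact continuousAt_const
    · simpa only [done_succ_of_ge _ hm] using ih

/-- Job `i` is released before the preceding jobs are completed. -/
def Linked (I : Inst) (v : Fin I.n → ℝ) (i : ℕ) : Prop := i < I.n ∧ I.releaseAt i < I.done v i

/-- Job `i` is released not later than the preceding jobs are completed. -/
def WeaklyLinked (I : Inst) (v : Fin I.n → ℝ) (i : ℕ) : Prop :=
  i < I.n ∧ I.releaseAt i ≤ I.done v i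

lemma Linked.weaklyLinked {i : ℕ} (h : I.Linked v i) : I.WeaklyLinked v i := ⟨h.1, h.2.le⟩

lemma not_linked_n : ¬ I.Linked v I.n := fun h => lt_irrefl _ h.1

lemma not_weaklyLinked_n : ¬ I.WeaklyLinked v I.n := fun h => lt_irrefl _ h.1

lemma done_update_of_not_linked (h0 : ∀ i, 0 < v i) (hu : v j ≤ u) {i m : ℕ} (hji : j < i)
    (hi : i < I.n) (hl : ¬ I.Linked v i) (hm : i < m) :
    I.done (Function.update v j u) m = I.done v m := by
  have update_eq {l : ℕ} (hl : l < I.n) (hjl : j < l) :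
      Function.update v j u ⟨l, hl⟩ = v ⟨l, hl⟩ :=
    Function.update_of_ne (Fin.ne_of_gt hjl) _ _
  induction m, hm using Nat.le_induction with
  | base =>
    have hdone : I.done v i ≤ I.releaseAt i := not_lt.1 fun hc => hl ⟨hi, hc⟩
    rw [done_succ_of_lt _ hi, done_succ_of_lt _ hi, max_eq_left hdone,
      max_eq_left ((done_update_le h0 hu i).trans hdone), update_eq hi hji]
  | succ m hm ih =>
    rcases lt_or_ge m I.n with hmn | hmn
    · rw [done_succ_of_lt _ hmn, done_succ_of_lt _ hmn, ih, update_eq hmn (hji.trans hm)]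
    · rw [done_succ_of_ge _ hmn, done_succ_of_ge _ hmn, ih]

lemma done_update_of_weaklyLinked (h0 : ∀ i, 0 < v i) (hu : v j ≤ u) {m : ℕ} (hm : j < m)
    (hmn : m ≤ I.n) (hl : ∀ i, j.val < i → i < m → I.WeaklyLinked (Function.update v j u) i) :
    I.done (Function.update v j u) m = I.done v m - (1 / v j - 1 / u) := by
  induction m, hm using Nat.le_induction with
  | base =>
    rw [Nat.succ_eq_add_one, done_succ, done_succ, done_update_of_le le_rfl,
      Function.update_self]
    ring
  | succ m hm ih =>
    have hweak := (hl m hm m.lt_succ_self).2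
    have hne : (⟨m, hmn⟩ : Fin I.n) ≠ j := Fin.ne_of_gt hm
    rw [done_succ_of_lt _ hmn, done_succ_of_lt _ hmn, max_eq_right hweak,
      max_eq_right (hweak.trans (done_update_le h0 hu m)), Function.update_of_ne hne,
      ih (Nat.le_of_lt hmn) fun i hi hi' => hl i hi (hi'.trans m.lt_succ_self)]
    ring

lemma Linked.of_update (h0 : ∀ i, 0 < v i) (hu : v j ≤ u) {i : ℕ}
    (h : I.Linked (Function.update v j u) i) : I.Linked v i :=
  ⟨h.1, h.2.trans_le (done_update_le h0 hu i)⟩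

lemma WeaklyLinked.of_update (h0 : ∀ i, 0 < v i) (hu : v j ≤ u) {i : ℕ}
    (h : I.WeaklyLinked (Function.update v j u) i) : I.WeaklyLinked v i :=
  ⟨h.1, h.2.trans (done_update_le h0 hu i)⟩

lemma linked_of_done_lt (h0 : ∀ i, 0 < v i) (hu : v j ≤ u) {e : ℕ} (he : e ≤ I.n)
    (h : I.done (Function.update v j u) e < I.done v e) :
    j < e ∧ ∀ i, j.val < i → i < e → I.Linked v i := by
  refine ⟨not_le.1 fun hej => h.ne (done_update_of_le hej), fun i hi hie => ?_⟩
  by_contra hl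
  exact h.ne (done_update_of_not_linked h0 hu hi (hie.trans_le he) hl hie)

lemma WeaklyLinked.linked_of_update (h0 : ∀ i, 0 < v i) (hu : v j < u) {m : ℕ} (hjm : j < m)
    (hl : ∀ i, j.val < i → i ≤ m → I.WeaklyLinked (Function.update v j u) i) : I.Linked v m := by
  obtain ⟨hmn, hweak⟩ := hl m hjm le_rfl
  refine ⟨hmn, hweak.trans_lt ?_⟩
  rw [done_update_of_weaklyLinked h0 hu.le hjm hmn.le fun i hi hi' => hl i hi hi'.le]
  exact sub_lt_self _ (sub_pos.2 (one_div_lt_one_div_of_lt (h0 j) hu))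

/-- The end of the jobs that are affected by `j`: these are the jobs from `j` up to, but not
including, this index. -/
def chainEnd (I : Inst) (v : Fin I.n → ℝ) (j : ℕ) : ℕ := firstFail (I.Linked v) j

/-- The end of the jobs that follow `j` without a gap, even if they do so only just in time. -/
def weakChainEnd (I : Inst) (v : Fin I.n → ℝ) (j : ℕ) : ℕ := firstFail (I.WeaklyLinked v) j

section chainEnd

variable {j : ℕ}

lemma chainEnd_le (hj : j < I.n) : I.chainEnd v j ≤ I.n := firstFail_le hj not_linked_n

lemma lt_chainEnd (hj : j < I.n) : j < I.chainEnd v j := (firstFail_mem hj not_linked_n).1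

lemma not_linked_chainEnd (hj : j < I.n) : ¬ I.Linked v (I.chainEnd v j) :=
  (firstFail_mem hj not_linked_n).2

lemma weakChainEnd_le (hj : j < I.n) : I.weakChainEnd v j ≤ I.n :=
  firstFail_le hj not_weaklyLinked_n

lemma lt_weakChainEnd (hj : j < I.n) : j < I.weakChainEnd v j :=
  (firstFail_mem hj not_weaklyLinked_n).1

lemma not_weaklyLinked_weakChainEnd (hj : j < I.n) : ¬ I.WeaklyLinked v (I.weakChainEnd v j) :=
  (firstFail_mem hj not_weaklyLinked_n).2

end chainEnd

/-- The gain `κ_j - Δ_j` as a real number: at the highest speed, it is merely negative. -/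
def realGain (I : Inst) (v : Fin I.n → ℝ) (j : Fin I.n) : ℝ :=
  (I.chainEnd v j : ℝ) - j - I.shrinkAt (I.floorIdx (v j))

/-- All speeds are between the lowest positive one and the highest one. -/
def InRange (I : Inst) (v : Fin I.n → ℝ) : Prop := ∀ j, I.speedAt 1 ≤ v j ∧ v j ≤ I.speedAt I.k

lemma InRange.pos (h : I.InRange v) (j : Fin I.n) : 0 < v j := speedAt_one_pos.trans_le (h j).1

lemma InRange.update (h : I.InRange v) (hu : v j ≤ u) (hu' : u ≤ I.speedAt I.k) :
    I.InRange (Function.update v j u) := by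
  intro i
  by_cases hi : i = j
  · subst hi
    simpa using ⟨(h i).1.trans hu, hu'⟩
  · simpa [hi] using h i

lemma lowest_apply : I.lowest j = I.speedAt 1 := (speedAt_val ⟨1, Nat.succ_lt_succ I.k_pos⟩).symm

lemma inRange_lowest : I.InRange I.lowest :=
  fun _ => ⟨lowest_apply.ge, lowest_apply.trans_le (speedAt_le I.k_pos le_rfl)⟩

/-- Job `j` may be sped up, in terms of the real gains. -/
def CanRaise (I : Inst) (ρ : Rule) (v : Fin I.n → ℝ) (j : Fin I.n) : Prop :=
  ρ.RealActive (I.realGain v j) ∧ ∀ j', I.realGain v j' ≤ I.realGain v j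

lemma floorIdx_lt_of_realGain_nonneg (h : 0 ≤ I.realGain v j) : I.floorIdx (v j) < I.k := by
  by_contra hc
  have hend : (I.chainEnd v j : ℝ) ≤ I.n := by exact_mod_cast chainEnd_le j.isLt
  have hj : (0 : ℝ) ≤ (j : ℕ) := by positivity
  rw [realGain, shrinkAt_of_le (not_lt.1 hc)] at h
  linarith

end Inst

/-! ### The first-in-first-out schedule -/

lemma setIntegral_Ico_of_eqOn {f : ℝ → ℝ} {a b c y z : ℝ} (hac : a ≤ c) (hcb : c ≤ b)
    (hy : Set.EqOn f (fun _ => y) (Set.Ico a c)) (hz : Set.EqOn f (fun _ => z) (Set.Ico c b)) :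
    ∫ t in Set.Ico a b, f t = y * (c - a) + z * (b - c) := by
  have hdisj : Disjoint (Set.Ico a c) (Set.Ico c b) :=
    Set.disjoint_left.2 fun t ht ht' => ht.2.not_ge ht'.1
  have hint_left : IntegrableOn f (Set.Ico a c) :=
    (integrableOn_const (by simp)).congr_fun hy.symm measurableSet_Ico
  have hint_right : IntegrableOn f (Set.Ico c b) :=
    (integrableOn_const (by simp)).congr_fun hz.symm measurableSet_Ico
  rw [← Set.Ico_union_Ico_eq_Ico hac hcb,
    setIntegral_union hdisj measurableSet_Ico hint_left hint_right,
    setIntegral_congr_fun measurableSet_Ico hy, setIntegral_congr_fun measurableSet_Ico hz,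
    setIntegral_const, setIntegral_const, Real.volume_real_Ico_of_le hac,
    Real.volume_real_Ico_of_le hcb, smul_eq_mul, smul_eq_mul, mul_comm y, mul_comm z]

namespace Inst

variable {I : Inst} {v : Fin I.n → ℝ}

lemma done_nonneg (h0 : ∀ i, 0 < v i) (m : ℕ) : 0 ≤ I.done v m := by
  induction m with
  | zero => exact le_rfl
  | succ m ih =>
    rcases lt_or_ge m I.n with hm | hm
    · rw [done_succ_of_lt v hm]
      exact add_nonneg (le_max_of_le_right ih) (one_div_pos.2 (h0 _)).le
    · rwa [done_succ_of_ge v hm]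

lemma done_le_succ (h0 : ∀ i, 0 < v i) (m : ℕ) : I.done v m ≤ I.done v (m + 1) := by
  rcases lt_or_ge m I.n with hm | hm
  · rw [done_succ_of_lt v hm]
    exact le_add_of_le_of_nonneg (le_max_right _ _) (one_div_pos.2 (h0 _)).le
  · exact (done_succ_of_ge v hm).ge

lemma done_mono (h0 : ∀ i, 0 < v i) : Monotone (I.done v) :=
  monotone_nat_of_le_succ (done_le_succ h0)

lemma start_nonneg (h0 : ∀ i, 0 < v i) (j : Fin I.n) : 0 ≤ I.start v j :=
  le_max_of_le_right (done_nonneg h0 _)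

lemma done_succ_eq_start (v : Fin I.n → ℝ) (j : Fin I.n) :
    I.done v (j + 1) = I.start v j + 1 / v j := done_succ v j

lemma start_lt_done (h0 : ∀ i, 0 < v i) (j : Fin I.n) : I.start v j < I.done v (j + 1) :=
  (lt_add_of_pos_right _ (one_div_pos.2 (h0 j))).trans_eq (done_succ_eq_start v j).symm

lemma done_succ_le_start (h0 : ∀ i, 0 < v i) {i j : Fin I.n} (h : i < j) :
    I.done v (i + 1) ≤ I.start v j :=
  (done_mono h0 (Nat.succ_le_of_lt h)).trans (le_max_right _ _)

lemma done_succ_strictMono (h0 : ∀ i, 0 < v i) :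
    StrictMono fun j : Fin I.n => I.done v (j + 1) :=
  fun _ j h => (done_succ_le_start h0 h).trans_lt (start_lt_done h0 j)

lemma fifoJob_eq_some_iff (h0 : ∀ i, 0 < v i) (t : ℝ) (j : Fin I.n) :
    I.fifoJob v t = some j ↔ t ∈ Set.Ico (I.start v j) (I.done v (j + 1)) := by
  have le_of_mem {i j : Fin I.n} (hi : t ∈ Set.Ico (I.start v i) (I.done v (i + 1)))
      (hj : t ∈ Set.Ico (I.start v j) (I.done v (j + 1))) : i ≤ j :=
    not_lt.1 fun hji => (hj.2.trans_le (done_succ_le_start h0 hji)).not_ge hi.1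
  constructor
  · intro h
    unfold fifoJob at h
    split_ifs at h with hex
    exact Option.some.inj h ▸ hex.choose_spec
  · intro h
    have hex : ∃ j : Fin I.n, I.start v j ≤ t ∧ t < I.done v (j + 1) := ⟨j, h⟩
    rw [fifoJob, dif_pos hex, Option.some.injEq]
    exact le_antisymm (le_of_mem hex.choose_spec h) (le_of_mem h hex.choose_spec)

lemma fifo_S_of_job {t : ℝ} {j : Fin I.n} (h : I.fifoJob v t = some j) :
    (I.fifo v).S t = if t < I.start v j + I.slowTime (v j) then I.floorLevel (v j)
      else I.ceilLevel (v j) := by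
  simp [fifo, h]

lemma fifo_S_of_none {t : ℝ} (h : I.fifoJob v t = none) : (I.fifo v).S t = 0 := by
  simp [fifo, h]

lemma floorLevel_pos {u : ℝ} (h : I.speedAt 1 ≤ u) : 0 < I.floorLevel u :=
  Fin.lt_def.2 (floorIdx_pos h)

lemma floorLevel_le_ceilLevel {u : ℝ} (h0 : 0 ≤ u) (hk : u ≤ I.speedAt I.k) :
    I.floorLevel u ≤ I.ceilLevel u :=
  I.s_strictMono.le_iff_le.1 ((s_floorLevel_le h0).trans (le_s_ceilLevel hk))

lemma ceilLevel_pos {u : ℝ} (h1 : I.speedAt 1 ≤ u) (hk : u ≤ I.speedAt I.k) :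
    0 < I.ceilLevel u :=
  (floorLevel_pos h1).trans_le (floorLevel_le_ceilLevel (speedAt_one_pos.le.trans h1) hk)

lemma fifo_X (hv : I.InRange v) (j : Fin I.n) :
    (I.fifo v).X j = Set.Ico (I.start v j) (I.done v (j + 1)) := by
  ext t
  refine ⟨fun ⟨_, h, _⟩ => (fifoJob_eq_some_iff hv.pos t j).1 h, fun h => ?_⟩
  have hj := (fifoJob_eq_some_iff hv.pos t j).2 h
  refine ⟨(start_nonneg hv.pos j).trans h.1, hj, ?_⟩
  rw [fifo_S_of_job hj]
  split_ifs
  · exact floorLevel_pos (hv j).1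
  · exact ceilLevel_pos (hv j).1 (hv j).2

lemma fifo_C (hv : I.InRange v) (j : Fin I.n) : (I.fifo v).C j = I.done v (j + 1) := by
  rw [Schedule.C, fifo_X hv, csSup_Ico (start_lt_done hv.pos j)]

lemma fifo_x (hv : I.InRange v) (j : Fin I.n) : (I.fifo v).x j = 1 / v j := by
  rw [Schedule.x, fifo_X hv, Real.volume_Ico, done_succ_eq_start, add_sub_cancel_left,
    ENNReal.toReal_ofReal (one_div_pos.2 (hv.pos j)).le]

lemma fifo_speed (hv : I.InRange v) (j : Fin I.n) : (I.fifo v).speed j = v j := by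
  rw [Schedule.speed, fifo_x hv, one_div_one_div]

lemma lt_chainEnd_of_release_lt (h0 : ∀ i, 0 < v i) {j b c : Fin I.n}
    (hb : b.val < I.chainEnd v j) (hbc : I.r c < I.done v (b + 1)) : c.val < I.chainEnd v j := by
  by_contra! hc
  refine not_linked_chainEnd j.isLt ⟨hc.trans_lt c.isLt, ?_⟩
  calc I.releaseAt (I.chainEnd v j) ≤ I.releaseAt c := releaseAt_mono hc c.isLt
    _ = I.r c := releaseAt_val c
    _ < I.done v (b + 1) := hbc
    _ ≤ I.done v (I.chainEnd v j) := done_mono h0 (Nat.succ_le_of_lt hb)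

lemma fifo_affects_iff (hv : I.InRange v) (j j' : Fin I.n) :
    (I.fifo v).Affects j j' ↔ j.val ≤ j'.val ∧ j'.val < I.chainEnd v j := by
  have step_iff (a b : Fin I.n) : (I.fifo v).C a ≤ (I.fifo v).C b ∧ I.r b < (I.fifo v).C a ↔
      a ≤ b ∧ I.r b < I.done v (a + 1) := by
    rw [fifo_C hv, fifo_C hv, (done_succ_strictMono hv.pos).le_iff_le]
  unfold Schedule.Affects
  simp only [step_iff]
  constructor
  · intro h
    induction h with
    | single h => exact ⟨h.1, lt_chainEnd_of_release_lt hv.pos (lt_chainEnd j.isLt) h.2⟩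
    | tail _ h ih => exact ⟨ih.1.trans h.1, lt_chainEnd_of_release_lt hv.pos ih.2 h.2⟩
  · rintro ⟨hjj', hj'⟩
    obtain ⟨b, hb⟩ := j'
    simp only at hjj' hj'
    induction b, hjj' using Nat.le_induction with
    | base => exact .single ⟨le_rfl, (le_max_left _ _).trans_lt (start_lt_done hv.pos j)⟩
    | succ b hjb ih =>
      have hlink : I.Linked v (b + 1) := of_lt_firstFail (Nat.lt_succ_of_le hjb) hj'
      refine (ih (by omega) (by omega)).tail ⟨Fin.mk_le_mk.2 b.le_succ, ?_⟩
      rw [← releaseAt_val]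
      exact hlink.2

lemma fifo_kappa (hv : I.InRange v) (j : Fin I.n) :
    (I.fifo v).kappa j = I.chainEnd v j - j := by
  have himage : Fin.val '' {j' | (I.fifo v).Affects j j'} =
      (Finset.Ico j.val (I.chainEnd v j) : Set ℕ) := by
    ext m
    simp only [fifo_affects_iff hv, Set.mem_image, Set.mem_ofPred_eq, Finset.coe_Ico, Set.mem_Ico]
    exact ⟨fun ⟨_, ha, ham⟩ => ham ▸ ha,
      fun hm => ⟨⟨m, hm.2.trans_le (chainEnd_le j.isLt)⟩, hm, rfl⟩⟩
  rw [Schedule.kappa, ← Set.ncard_image_of_injective _ Fin.val_injective, himage,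
    Set.ncard_coe_finset, Nat.card_Ico]

section slowTime

variable {u : ℝ}

lemma slowTime_nonneg (h1 : I.speedAt 1 ≤ u) (hk : u ≤ I.speedAt I.k) : 0 ≤ I.slowTime u := by
  have hu : 0 < u := speedAt_one_pos.trans_le h1
  have hfloor := s_floorLevel_le (I := I) hu.le
  have hceil := le_s_ceilLevel hk
  exact div_nonneg (sub_nonneg.2 hceil) (mul_nonneg hu.le (sub_nonneg.2 (hfloor.trans hceil)))

lemma slowTime_le (h1 : I.speedAt 1 ≤ u) (hk : u ≤ I.speedAt I.k) : I.slowTime u ≤ 1 / u := by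
  have hu : 0 < u := speedAt_one_pos.trans_le h1
  have hfloor := s_floorLevel_le (I := I) hu.le
  have hceil := le_s_ceilLevel hk
  rw [slowTime, mul_comm u, ← div_div]
  exact div_le_div_of_nonneg_right
    (div_le_one_of_le₀ (by linarith) (sub_nonneg.2 (hfloor.trans hceil))) hu.le

lemma slowTime_volume (h1 : I.speedAt 1 ≤ u) (hk : u ≤ I.speedAt I.k) :
    I.s (I.floorLevel u) * I.slowTime u + I.s (I.ceilLevel u) * (1 / u - I.slowTime u) = 1 := by
  have hu : 0 < u := speedAt_one_pos.trans_le h1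
  have hfloor := s_floorLevel_le (I := I) hu.le
  have hceil := le_s_ceilLevel hk
  unfold slowTime
  rcases (hfloor.trans hceil).eq_or_lt with heq | hlt
  · rw [heq, le_antisymm (heq ▸ hfloor) hceil]
    simp [hu.ne']
  · have : I.s (I.ceilLevel u) - I.s (I.floorLevel u) ≠ 0 := (sub_pos.2 hlt).ne'
    field_simp
    ring

end slowTime

lemma fifo_setIntegral (hv : I.InRange v) (j : Fin I.n) (f : Fin (I.k + 1) → ℝ) :
    ∫ t in (I.fifo v).X j, f ((I.fifo v).S t) =
      f (I.floorLevel (v j)) * I.slowTime (v j) +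
        f (I.ceilLevel (v j)) * (1 / v j - I.slowTime (v j)) := by
  have hnonneg := slowTime_nonneg (hv j).1 (hv j).2
  have hle := slowTime_le (hv j).1 (hv j).2
  have hdone := done_succ_eq_start v j
  have level_eq {t : ℝ} (ht : t ∈ Set.Ico (I.start v j) (I.done v (j + 1))) :=
    fifo_S_of_job ((fifoJob_eq_some_iff hv.pos t j).2 ht)
  rw [fifo_X hv, setIntegral_Ico_of_eqOn (c := I.start v j + I.slowTime (v j))
    (y := f (I.floorLevel (v j))) (z := f (I.ceilLevel (v j))) (by linarith) (by linarith)
    (fun t ht => ?_) (fun t ht => ?_), hdone]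
  · ring
  · rw [level_eq ⟨ht.1, by linarith [ht.2]⟩, if_pos ht.2]
  · rw [level_eq ⟨by linarith [ht.1], ht.2⟩, if_neg (not_lt.2 ht.1)]

lemma measurableSet_fifoJob_eq (h0 : ∀ i, 0 < v i) (o : Option (Fin I.n)) :
    MeasurableSet {t | I.fifoJob v t = o} := by
  have hsome (j : Fin I.n) : MeasurableSet {t | I.fifoJob v t = some j} := by
    simp only [fifoJob_eq_some_iff h0]
    exact measurableSet_Ico
  cases o with
  | none =>
    simp only [Option.eq_none_iff_forall_ne_some, Set.ofPred_forall]
    exact MeasurableSet.iInter fun j => (hsome j).compl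
  | some j => exact hsome j

lemma fifo_measurable (h0 : ∀ i, 0 < v i) (o : Option (Fin I.n)) (i : Fin (I.k + 1)) :
    MeasurableSet {t | 0 ≤ t ∧ (I.fifo v).J t = o ∧ (I.fifo v).S t = i} := by
  set level : ℝ → Fin (I.k + 1) := fun t => match o with
    | none => 0
    | some j => if t < I.start v j + I.slowTime (v j) then I.floorLevel (v j)
        else I.ceilLevel (v j) with hlevel
  have level_measurable : Measurable level := by
    cases o with
    | none => exact measurable_const
    | some j => exact Measurable.ite measurableSet_Iio measurable_const measurable_const
  have heq : {t | 0 ≤ t ∧ (I.fifo v).J t = o ∧ (I.fifo v).S t = i} =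
      Set.Ici 0 ∩ ({t | I.fifoJob v t = o} ∩ level ⁻¹' {i}) := by
    ext t
    refine and_congr_right fun _ => and_congr_right fun hJ => ?_
    have hS : (I.fifo v).S t = level t := by
      rw [hlevel, ← hJ]
      rfl
    rw [hS]
    rfl
  rw [heq]
  exact measurableSet_Ici.inter ((measurableSet_fifoJob_eq h0 o).inter
    (level_measurable (measurableSet_singleton i)))

lemma fifo_feasible (hv : I.InRange v) : (I.fifo v).Feasible where
  measurable := fifo_measurable hv.pos
  released j t _ h := (le_max_left _ _).trans ((fifoJob_eq_some_iff hv.pos t j).1 h).1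
  processed j := by
    rw [fifo_setIntegral hv j I.s]
    exact slowTime_volume (hv j).1 (hv j).2
  completed j := by
    rw [fifo_X hv]
    exact bddAbove_Ico

end Inst

namespace Schedule

variable {I : Inst} {σ : Schedule I}

lemma Feasible.measurableSet_S (hσ : σ.Feasible) (i : Fin (I.k + 1)) :
    MeasurableSet {t | 0 ≤ t ∧ σ.S t = i} := by
  have heq : {t | 0 ≤ t ∧ σ.S t = i} =
      ⋃ o : Option (Fin I.n), {t | 0 ≤ t ∧ σ.J t = o ∧ σ.S t = i} := by
    ext t
    simp
  rw [heq]
  exact MeasurableSet.iUnion fun o => hσ.measurable o i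

lemma Feasible.measurableSet_X (hσ : σ.Feasible) (j : Fin I.n) : MeasurableSet (σ.X j) := by
  have heq : σ.X j = ⋃ i : {i : Fin (I.k + 1) // 0 < i},
      {t | 0 ≤ t ∧ σ.J t = some j ∧ σ.S t = i} := by
    ext t
    simp only [X, Set.mem_ofPred_eq, Set.mem_iUnion]
    exact ⟨fun ⟨ht, hJ, hS⟩ => ⟨⟨_, hS⟩, ht, hJ, rfl⟩,
      fun ⟨i, ht, hJ, hS⟩ => ⟨ht, hJ, hS ▸ i.2⟩⟩
  rw [heq]
  exact MeasurableSet.iUnion fun i => hσ.measurable _ _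

lemma Feasible.measurable_comp (hσ : σ.Feasible) (f : Fin (I.k + 1) → ℝ) :
    Measurable ((Set.Ici (0 : ℝ)).indicator fun t => f (σ.S t)) := by
  have heq : (Set.Ici (0 : ℝ)).indicator (fun t => f (σ.S t)) =
      fun t => ∑ i, ({t | 0 ≤ t ∧ σ.S t = i}).indicator (fun _ => f i) t := by
    funext t
    by_cases ht : 0 ≤ t
    · simp [Set.indicator_apply, ht]
    · simp [ht]
  rw [heq]
  exact Finset.measurable_sum _ fun i _ => measurable_const.indicator (hσ.measurableSet_S i)

lemma X_subset_Ici (j : Fin I.n) : σ.X j ⊆ Set.Ici 0 := fun _ ht => ht.1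

lemma Feasible.integrableOn_comp (hσ : σ.Feasible) (f : Fin (I.k + 1) → ℝ) {A : Set ℝ}
    (hA : MeasurableSet A) (h0 : A ⊆ Set.Ici 0) (hfin : volume A ≠ ⊤) :
    IntegrableOn (fun t => f (σ.S t)) A := by
  have hind : IntegrableOn ((Set.Ici (0 : ℝ)).indicator fun t => f (σ.S t)) A :=
    Measure.integrableOn_of_bounded (M := ∑ i, |f i|) hfin
      (hσ.measurable_comp f).aestronglyMeasurable <| .of_forall fun t =>
        (norm_indicator_le_norm_self _ _).trans <|
          Finset.single_le_sum (f := fun i => |f i|) (fun i _ => abs_nonneg _) (Finset.mem_univ _)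
  exact hind.congr_fun (fun t ht => Set.indicator_of_mem (h0 ht) _) hA

end Schedule

namespace Inst

variable {I : Inst} {ρ : Rule} {v : Fin I.n → ℝ} {j : Fin I.n} {u : ℝ}

/-! ### Iterations in terms of real gains -/

lemma active_coe (ρ : Rule) (g : ℝ) : ρ.Active (g : EReal) ↔ ρ.RealActive g := by
  cases ρ
  · exact EReal.coe_pos
  · exact EReal.coe_nonneg

lemma not_active_bot (ρ : Rule) : ¬ ρ.Active ⊥ := by
  cases ρ
  · exact not_lt_bot
  · exact not_le.2 (EReal.bot_lt_coe 0)

lemma fifo_gain (hv : I.InRange v) (j : Fin I.n) (h : I.floorIdx (v j) < I.k) :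
    (I.fifo v).gain j = ((I.realGain v j : ℝ) : EReal) := by
  have hkappa : (((I.fifo v).kappa j : ℕ) : ℝ) = (I.chainEnd v j : ℝ) - j := by
    rw [fifo_kappa hv, Nat.cast_sub (lt_chainEnd j.isLt).le]
  rw [Schedule.gain, Schedule.shrinkingEnergy, fifo_speed hv,
    Delta_of_lt (floorLevel_pos (hv j).1) h, hkappa, realGain, ← EReal.coe_sub]
  rfl

lemma fifo_gain_top (hv : I.InRange v) (j : Fin I.n) (h : ¬ I.floorIdx (v j) < I.k) :
    (I.fifo v).gain j = ⊥ := by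
  rw [Schedule.gain, Schedule.shrinkingEnergy, fifo_speed hv,
    Delta_top (le_antisymm (floorIdx_le _) (not_lt.1 h))]
  exact EReal.sub_top _

lemma active_iff (hv : I.InRange v) (j : Fin I.n) :
    ρ.Active ((I.fifo v).gain j) ↔ ρ.RealActive (I.realGain v j) := by
  by_cases h : I.floorIdx (v j) < I.k
  · rw [fifo_gain hv j h, active_coe]
  · rw [fifo_gain_top hv j h]
    exact iff_of_false (not_active_bot ρ) fun hc => h (floorIdx_lt_of_realGain_nonneg hc.nonneg)

lemma halted_iff (hv : I.InRange v) : I.Halted ρ v ↔ ∀ j, ¬ ρ.RealActive (I.realGain v j) :=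
  forall_congr' fun j => not_congr (active_iff hv j)

lemma canSpeedUp_iff (hv : I.InRange v) (j : Fin I.n) : I.CanSpeedUp ρ v j ↔ I.CanRaise ρ v j := by
  unfold CanSpeedUp CanRaise
  rw [active_iff hv]
  refine and_congr_right fun hactive => forall_congr' fun j' => ?_
  rw [fifo_gain hv j (floorIdx_lt_of_realGain_nonneg hactive.nonneg)]
  by_cases h : I.floorIdx (v j') < I.k
  · rw [fifo_gain hv j' h, EReal.coe_le_coe_iff]
  · rw [fifo_gain_top hv j' h]
    exact iff_of_true bot_le (not_lt.1 fun hc =>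
      h (floorIdx_lt_of_realGain_nonneg (hactive.nonneg.trans hc.le)))

lemma CanRaise.congr {v' : Fin I.n → ℝ} (h : I.CanRaise ρ v j)
    (hgain : ∀ j', I.realGain v' j' = I.realGain v j') : I.CanRaise ρ v' j := by
  unfold CanRaise at h ⊢
  simpa only [hgain] using h

lemma not_canRaise_top (h : I.floorIdx (v j) = I.k) : ¬ I.CanRaise ρ v j := fun hc =>
  (floorIdx_lt_of_realGain_nonneg hc.1.nonneg).ne h

/-- Increasing the speed of `j` to `u` is an iteration, in terms of the real gains. -/
structure RaisesTo (I : Inst) (ρ : Rule) (v : Fin I.n → ℝ) (j : Fin I.n) (u : ℝ) : Prop where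
  lt : v j < u
  le_top : u ≤ I.speedAt I.k
  canRaise : ∀ w, v j ≤ w → w < u → I.CanRaise ρ (Function.update v j w) j
  not_canRaise : ¬ I.CanRaise ρ (Function.update v j u) j

lemma RaisesTo.inRange (h : I.RaisesTo ρ v j u) (hv : I.InRange v) :
    I.InRange (Function.update v j u) := hv.update h.lt.le h.le_top

lemma iteration_iff (hv : I.InRange v) (v' : Fin I.n → ℝ) :
    I.Iteration ρ v v' ↔ ∃ j u, I.RaisesTo ρ v j u ∧ v' = Function.update v j u := by
  constructor
  · rintro ⟨j, u, hlt, rfl, hcan, hnot⟩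
    have hu : u ≤ I.speedAt I.k := by
      by_contra! htop
      have hr := hv.update (j := j) (hv j).2 le_rfl
      refine not_canRaise_top ?_ ((canSpeedUp_iff hr j).1 (hcan _ (hv j).2 htop))
      rw [floorIdx_eq_top_iff (hr.pos j).le, Function.update_self]
    exact ⟨j, u, ⟨hlt, hu, fun w hw hwu =>
      (canSpeedUp_iff (hv.update hw (hwu.le.trans hu)) j).1 (hcan w hw hwu),
      fun hc => hnot ((canSpeedUp_iff (hv.update hlt.le hu) j).2 hc)⟩, rfl⟩
  · rintro ⟨j, u, h, rfl⟩
    exact ⟨j, u, h.lt, rfl, fun w hw hwu =>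
      (canSpeedUp_iff (hv.update hw (hwu.le.trans h.le_top)) j).2 (h.canRaise w hw hwu),
      fun hc => h.not_canRaise ((canSpeedUp_iff (h.inRange hv) j).1 hc)⟩

lemma realGain_update_congr (h0 : ∀ i, 0 < v i) (hu : v j ≤ u)
    (hfloor : I.floorIdx u = I.floorIdx (v j))
    (hl : ∀ i, I.Linked v i → I.Linked (Function.update v j u) i) (j' : Fin I.n) :
    I.realGain (Function.update v j u) j' = I.realGain v j' := by
  have hLinked : I.Linked (Function.update v j u) = I.Linked v :=
    funext fun i => propext ⟨fun h => h.of_update h0 hu, hl i⟩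
  have hfloor' : I.floorIdx (Function.update v j u j') = I.floorIdx (v j') := by
    by_cases h : j' = j
    · subst h
      simpa using hfloor
    · simp [h]
  rw [realGain, realGain, chainEnd, chainEnd, hLinked, hfloor']

lemma eventually_linked_update (h0 : 0 < v j) {i : ℕ} (h : I.Linked v i) :
    ∀ᶠ w in nhds (v j), I.Linked (Function.update v j w) i := by
  have hlt : I.releaseAt i < I.done (Function.update v j (v j)) i := by
    rw [Function.update_eq_self]
    exact h.2
  filter_upwards [(continuousAt_done_update v j h0.ne' i).eventually (lt_mem_nhds hlt)] with w hw
  exact ⟨h.1, hw⟩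

lemma eventually_realGain_eq (hv : I.InRange v) (j : Fin I.n) :
    ∀ᶠ w in nhdsWithin (v j) (Set.Ici (v j)), ∀ j', I.realGain (Function.update v j w) j' =
      I.realGain v j' := by
  have hlinked : ∀ᶠ w in nhds (v j), ∀ i ∈ Finset.range I.n, I.Linked v i →
      I.Linked (Function.update v j w) i :=
    (Filter.eventually_all_finset _).2 fun i _ =>
      Filter.eventually_imp_distrib_left.2 fun h => eventually_linked_update (hv.pos j) h
  filter_upwards [nhdsWithin_le_nhds hlinked, eventually_floorIdx_eq (I := I) (hv.pos j).le,
    self_mem_nhdsWithin] with w hw hfloor hwj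
  exact realGain_update_congr hv.pos hwj hfloor fun i hi => hw i (Finset.mem_range.2 hi.1) hi

lemma exists_raisesTo (hv : I.InRange v) (h : I.CanRaise ρ v j) : ∃ u, I.RaisesTo ρ v j u := by
  set A := {w | v j ≤ w ∧ ¬ I.CanRaise ρ (Function.update v j w) j}
  have htop : I.speedAt I.k ∈ A := by
    refine ⟨(hv j).2, not_canRaise_top ?_⟩
    rw [Function.update_self, floorIdx_eq_top_iff (speedAt_pos I.k_pos le_rfl).le]
  have hbdd : BddBelow A := ⟨v j, fun w hw => hw.1⟩
  have hle : sInf A ≤ I.speedAt I.k := csInf_le hbdd htop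
  have hge : v j ≤ sInf A := le_csInf ⟨_, htop⟩ fun w hw => hw.1
  -- Gains are constant on the right of every speed, so the infimum is attained.
  have hnot : ¬ I.CanRaise ρ (Function.update v j (sInf A)) j := by
    intro hc
    have hgain := eventually_realGain_eq (hv.update hge hle) j
    rw [Function.update_self] at hgain
    obtain ⟨b, hb, hsub⟩ := (mem_nhdsGE_iff_exists_Ico_subset).1 hgain
    obtain ⟨w, hw, hwb⟩ := exists_lt_of_csInf_lt ⟨_, htop⟩ (Set.mem_Ioi.1 hb)
    have hgain_w := hsub ⟨csInf_le hbdd hw, hwb⟩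
    simp only [Set.mem_ofPred_eq, Function.update_idem] at hgain_w
    exact hw.2 (hc.congr hgain_w)
  refine ⟨sInf A, lt_of_le_of_ne hge fun hc => hnot ?_, hle, fun w hw hwu => ?_, hnot⟩
  · rwa [← hc, Function.update_eq_self]
  · by_contra hc
    exact hwu.not_ge (csInf_le hbdd ⟨hw, hc⟩)

lemma exists_iteration (hv : I.InRange v) (h : ¬ I.Halted ρ v) : ∃ v', I.Iteration ρ v v' := by
  rw [halted_iff hv] at h
  push Not at h
  obtain ⟨j₀, hj₀⟩ := h
  obtain ⟨j, -, hmax⟩ := Finset.exists_max_image Finset.univ (I.realGain v) ⟨j₀, Finset.mem_univ _⟩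
  obtain ⟨u, hu⟩ := exists_raisesTo hv (ρ := ρ) (j := j)
    ⟨hj₀.mono (hmax j₀ (Finset.mem_univ _)), fun j' => hmax j' (Finset.mem_univ _)⟩
  exact ⟨_, (iteration_iff hv _).2 ⟨j, u, hu, rfl⟩⟩

lemma Run.inRange {m : ℕ} (h : I.Run ρ m v) : I.InRange v := by
  induction h with
  | init => exact inRange_lowest
  | step _ hit ih =>
    obtain ⟨j, u, hu, rfl⟩ := (iteration_iff ih _).1 hit
    exact hu.inRange ih

/-! ### The number of iterations -/

open Classical in
/-- The number of events that have happened: levels that were reached, and links that are lost.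
Every iteration ends with a further event. -/
def events (I : Inst) (v : Fin I.n → ℝ) : ℕ :=
  ∑ j, I.floorIdx (v j) + ((Finset.range I.n).filter fun i => ¬ I.Linked v i).card

lemma events_le (v : Fin I.n → ℝ) : I.events v ≤ I.n * I.k + I.n := by
  classical
  refine add_le_add ?_ ((Finset.card_filter_le _ _).trans (Finset.card_range _).le)
  calc ∑ j, I.floorIdx (v j) ≤ ∑ _j : Fin I.n, I.k := Finset.sum_le_sum fun j _ => floorIdx_le _
    _ = I.n * I.k := by simp

lemma le_events (hv : I.InRange v) : I.n ≤ I.events v := by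
  calc I.n = ∑ _j : Fin I.n, 1 := by simp
    _ ≤ ∑ j, I.floorIdx (v j) := Finset.sum_le_sum fun j _ => floorIdx_pos (hv j).1
    _ ≤ I.events v := Nat.le_add_right _ _

lemma events_lt (h0 : ∀ i, 0 < v i) (hu : v j ≤ u)
    (h : I.floorIdx (v j) < I.floorIdx u ∨
      ∃ i, I.Linked v i ∧ ¬ I.Linked (Function.update v j u) i) :
    I.events v < I.events (Function.update v j u) := by
  classical
  have hfloor : ∀ i ∈ Finset.univ, I.floorIdx (v i) ≤ I.floorIdx (Function.update v j u i) :=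
    fun i _ => floorIdx_mono (h0 i).le (le_update_self_iff.2 hu i)
  have hlost : ((Finset.range I.n).filter fun i => ¬ I.Linked v i) ⊆
      (Finset.range I.n).filter fun i => ¬ I.Linked (Function.update v j u) i :=
    Finset.monotone_filter_right _ fun _ _ hi hc => hi (hc.of_update h0 hu)
  rcases h with h | ⟨i, hi, hi'⟩
  · refine add_lt_add_of_lt_of_le (Finset.sum_lt_sum hfloor ⟨j, Finset.mem_univ _, ?_⟩)
      (Finset.card_le_card hlost)
    rwa [Function.update_self]
  · refine add_lt_add_of_le_of_lt (Finset.sum_le_sum hfloor) (Finset.card_lt_card ?_)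
    exact Finset.ssubset_iff_of_subset hlost |>.2 ⟨i,
      Finset.mem_filter.2 ⟨Finset.mem_range.2 hi.1, hi'⟩, fun hc => (Finset.mem_filter.1 hc).2 hi⟩

lemma RaisesTo.events_lt (hv : I.InRange v) (h : I.RaisesTo ρ v j u) :
    I.events v < I.events (Function.update v j u) := by
  refine Inst.events_lt hv.pos h.lt.le ?_
  by_contra! hc
  have hcan := h.canRaise _ le_rfl h.lt
  rw [Function.update_eq_self] at hcan
  exact h.not_canRaise (hcan.congr (realGain_update_congr hv.pos h.lt.le
    (le_antisymm hc.1 (floorIdx_mono (hv.pos j).le h.lt.le)) hc.2))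

lemma Run.add_le_events {m : ℕ} (h : I.Run ρ m v) : m + I.n ≤ I.events v := by
  induction h with
  | init => simpa using le_events inRange_lowest
  | step hr hit ih =>
    obtain ⟨j, u, hu, rfl⟩ := (iteration_iff hr.inRange _).1 hit
    have := hu.events_lt hr.inRange
    omega

lemma Run.le_mul {m : ℕ} (h : I.Run ρ m v) : m ≤ I.n * I.k :=
  Nat.le_of_add_le_add_right (h.add_le_events.trans (events_le v))

/-! ### The invariant of the algorithm -/

/-- The second job is weakly affected by the first, or the first is affected by the second. -/
def Tied (I : Inst) (v : Fin I.n → ℝ) (m m' : ℕ) : Prop :=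
  (m ≤ m' ∧ ∀ i, m < i → i ≤ m' → I.WeaklyLinked v i) ∨
    (m' < m ∧ ∀ i, m' < i → i ≤ m → I.Linked v i)

/-- No job was sped up too much, compared with the jobs tied to it and with its affection. The
shrinking energy of `m` is taken just below its speed, that is, before its last increase ended. -/
structure Balanced (I : Inst) (v : Fin I.n → ℝ) : Prop where
  inRange : I.InRange v
  le_of_tied : ∀ m m' : Fin I.n, I.speedAt 1 < v m → I.floorIdx (v m') < I.k → I.Tied v m m' →
    I.shrinkAt (I.predIdx (v m)) + m ≤ I.shrinkAt (I.floorIdx (v m')) + m'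
  le_weakChainEnd : ∀ m : Fin I.n, I.speedAt 1 < v m →
    I.shrinkAt (I.predIdx (v m)) + m ≤ I.weakChainEnd v m

lemma Tied.of_update (h0 : ∀ i, 0 < v i) (hu : v j ≤ u) {m m' : ℕ}
    (h : I.Tied (Function.update v j u) m m') : I.Tied v m m' :=
  h.imp (fun h => ⟨h.1, fun i hi hi' => (h.2 i hi hi').of_update h0 hu⟩)
    (fun h => ⟨h.1, fun i hi hi' => (h.2 i hi hi').of_update h0 hu⟩)

lemma Tied.chainEnd_eq (h0 : ∀ i, 0 < v i) (hu : v j < u) {m : ℕ}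
    (h : I.Tied (Function.update v j u) j m) : I.chainEnd v j = I.chainEnd v m := by
  rcases h with ⟨hjm, h⟩ | ⟨hmj, h⟩
  · exact firstFail_congr hjm fun i hji him => WeaklyLinked.linked_of_update h0 hu hji
      fun i' hi' hii' => h i' hi' (hii'.trans him)
  · exact (firstFail_congr hmj.le fun i hmi hij => (h i hmi hij).of_update h0 hu.le).symm

lemma balanced_lowest : I.Balanced I.lowest :=
  ⟨inRange_lowest, fun _ _ h => absurd lowest_apply h.ne',
    fun _ h => absurd lowest_apply h.ne'⟩

namespace RaisesTo

lemma eventually_canRaise (h0 : ∀ i, 0 < v i) (h : I.RaisesTo ρ v j u) :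
    ∀ᶠ w in nhdsWithin u (Set.Iio u), v j < w ∧ w < u ∧ I.floorIdx w = I.predIdx u ∧
      I.CanRaise ρ (Function.update v j w) j := by
  filter_upwards [nhdsWithin_le_nhds (lt_mem_nhds h.lt), self_mem_nhdsWithin,
    eventually_floorIdx_eq_predIdx (I := I) ((h0 j).trans h.lt)] with w hjw hwu hfloor
  exact ⟨hjw, hwu, hfloor, h.canRaise w hjw.le hwu⟩

lemma eventually_not_linked {e : ℕ} (h0 : 0 < u)
    (he : ¬ I.WeaklyLinked (Function.update v j u) e) :
    ∀ᶠ w in nhds u, ¬ I.Linked (Function.update v j w) e := by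
  by_cases hen : e < I.n
  · have hlt : I.done (Function.update v j u) e < I.releaseAt e := not_le.1 fun hc => he ⟨hen, hc⟩
    filter_upwards [(continuousAt_done_update v j h0.ne' e).eventually (gt_mem_nhds hlt)]
      with w hw hc
    exact hc.2.not_gt hw
  · exact .of_forall fun w hw => hen hw.1

lemma shrinkAt_predIdx_le (h0 : ∀ i, 0 < v i) (h : I.RaisesTo ρ v j u) {e : ℕ} (hje : j < e)
    (he : ¬ I.WeaklyLinked (Function.update v j u) e) : I.shrinkAt (I.predIdx u) + j ≤ e := by
  obtain ⟨w, ⟨-, -, hfloor, hcan⟩, hnot⟩ := ((h.eventually_canRaise h0).and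
    (nhdsWithin_le_nhds (eventually_not_linked ((h0 j).trans h.lt) he))).exists
  have hgain := hcan.1.nonneg
  rw [realGain, Function.update_self, hfloor] at hgain
  have hend : (I.chainEnd (Function.update v j w) j : ℝ) ≤ e := by
    exact_mod_cast firstFail_le hje hnot
  linarith

lemma shrinkAt_predIdx_le_of_tied (hv : I.InRange v) (h : I.RaisesTo ρ v j u) {m : Fin I.n}
    (hmj : m ≠ j) (ht : I.Tied (Function.update v j u) j m) :
    I.shrinkAt (I.predIdx u) + j ≤ I.shrinkAt (I.floorIdx (v m)) + m := by
  obtain ⟨w, hjw, hwu, hfloor, hcan⟩ := (h.eventually_canRaise hv.pos).exists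
  have hend : I.chainEnd (Function.update v j w) j = I.chainEnd (Function.update v j w) m := by
    refine Tied.chainEnd_eq (u := u) (hv.update hjw.le (hwu.le.trans h.le_top)).pos ?_ ?_
    · rwa [Function.update_self]
    · rwa [Function.update_idem]
  have hgain := hcan.2 m
  rw [realGain, realGain, hend, Function.update_self, Function.update_of_ne hmj, hfloor] at hgain
  linarith

end RaisesTo

namespace Balanced

lemma le_of_tied_update (hv : I.Balanced v) (h : I.RaisesTo ρ v j u) {m m' : Fin I.n}
    (hm : I.speedAt 1 < Function.update v j u m)
    (hm' : I.floorIdx (Function.update v j u m') < I.k)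
    (ht : I.Tied (Function.update v j u) m m') :
    I.shrinkAt (I.predIdx (Function.update v j u m)) + m ≤
      I.shrinkAt (I.floorIdx (Function.update v j u m')) + m' := by
  have h0 := hv.inRange.pos
  by_cases hmj : m = j
  · subst hmj
    rw [Function.update_self] at hm ⊢
    by_cases hm'm : m' = m
    · subst hm'm
      rw [Function.update_self] at hm' ⊢
      have := shrinkAt_mono (predIdx_pos hm) (predIdx_le_floorIdx (I := I) ((h0 _).trans h.lt)) hm'
      linarith
    · rw [Function.update_of_ne hm'm] at hm' ⊢
      exact h.shrinkAt_predIdx_le_of_tied hv.inRange hm'm ht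
  · rw [Function.update_of_ne hmj] at hm ⊢
    have hfloor : I.floorIdx (v m') ≤ I.floorIdx (Function.update v j u m') :=
      floorIdx_mono (h0 m').le (le_update_self_iff.2 h.lt.le m')
    calc I.shrinkAt (I.predIdx (v m)) + m ≤ I.shrinkAt (I.floorIdx (v m')) + m' :=
          hv.le_of_tied m m' hm (hfloor.trans_lt hm') (ht.of_update h0 h.lt.le)
      _ ≤ _ := by
        gcongr
        exact shrinkAt_mono (floorIdx_pos (hv.inRange m').1) hfloor hm'

lemma le_weakChainEnd_update (hv : I.Balanced v) (h : I.RaisesTo ρ v j u) {m : Fin I.n}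
    (hm : I.speedAt 1 < Function.update v j u m) :
    I.shrinkAt (I.predIdx (Function.update v j u m)) + m ≤
      I.weakChainEnd (Function.update v j u) m := by
  have h0 := hv.inRange.pos
  set e := I.weakChainEnd (Function.update v j u) m
  have hme : m.val < e := lt_weakChainEnd m.isLt
  have hne : ¬ I.WeaklyLinked (Function.update v j u) e := not_weaklyLinked_weakChainEnd m.isLt
  by_cases hmj : m = j
  · subst hmj
    rw [Function.update_self]
    exact h.shrinkAt_predIdx_le h0 hme hne
  rw [Function.update_of_ne hmj] at hm ⊢
  by_cases hle : I.weakChainEnd v m ≤ e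
  · exact (hv.le_weakChainEnd m hm).trans (by exact_mod_cast hle)
  -- Otherwise, speeding up `j` has made the chain of `m` break at `e`, and `m` is tied to `j`.
  have hweak : ∀ i, m.val < i → i ≤ e → I.WeaklyLinked v i := fun i hi hi' =>
    of_lt_firstFail hi (hi'.trans_lt (not_le.1 hle))
  obtain ⟨hen, hre⟩ := hweak e hme le_rfl
  obtain ⟨hje, hlinked⟩ := linked_of_done_lt h0 h.lt.le hen.le
    ((not_le.1 fun hc => hne ⟨hen, hc⟩).trans_le hre)
  have ht : I.Tied v m j := (lt_or_gt_of_ne (Fin.val_ne_of_ne hmj)).imp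
    (fun hlt => ⟨hlt.le, fun i hi hi' => hweak i hi (hi'.trans hje.le)⟩)
    (fun hlt => ⟨hlt, fun i hi hi' => hlinked i hi (hi'.trans_lt hme)⟩)
  have hfloor : I.floorIdx (v j) ≤ I.predIdx u := floorIdx_le_predIdx (h0 j).le h.lt
  have htop : I.predIdx u < I.k := predIdx_lt ((h0 j).trans h.lt) h.le_top
  calc I.shrinkAt (I.predIdx (v m)) + m ≤ I.shrinkAt (I.floorIdx (v j)) + j :=
        hv.le_of_tied m j hm (hfloor.trans_lt htop) ht
    _ ≤ I.shrinkAt (I.predIdx u) + j := by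
      gcongr
      exact shrinkAt_mono (floorIdx_pos (hv.inRange j).1) hfloor htop
    _ ≤ e := h.shrinkAt_predIdx_le h0 hje hne

lemma update (hv : I.Balanced v) (h : I.RaisesTo ρ v j u) : I.Balanced (Function.update v j u) :=
  ⟨h.inRange hv.inRange, fun _ _ => hv.le_of_tied_update h, fun _ => hv.le_weakChainEnd_update h⟩

end Balanced

lemma Run.balanced {m : ℕ} (h : I.Run ρ m v) : I.Balanced v := by
  induction h with
  | init => exact balanced_lowest
  | step _ hit ih =>
    obtain ⟨j, u, hu, rfl⟩ := (iteration_iff ih.inRange _).1 hit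
    exact ih.update hu

end Inst

namespace Inst

variable {I : Inst} {v : Fin I.n → ℝ}

/-! ### Multipliers -/

/-- Dual multipliers for the speeds `v`: `c j` is the price of delaying the jobs from `j` on by one
unit of time, if all jobs run in the order of release. Multipliers with these properties are
complementary to `v`, and hence certify that `v` is optimal. -/
structure Certifies (I : Inst) (v : Fin I.n → ℝ) (c : ℕ → ℝ) : Prop where
  one_le : ∀ j : Fin I.n, 1 ≤ c j
  le_shrinkAt : ∀ j : Fin I.n, c j ≤ I.shrinkAt (I.floorIdx (v j))
  shrinkAt_le : ∀ j : Fin I.n, I.speedAt 1 < v j → I.shrinkAt (I.predIdx (v j)) ≤ c j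
  le_of_weaklyLinked : ∀ j : Fin I.n, I.WeaklyLinked v (j + 1) → c j ≤ 1 + c (j + 1)
  ge_of_linked : ∀ j : Fin I.n, I.Linked v (j + 1) → 1 + c (j + 1) ≤ c j
  le_one : ∀ j : Fin I.n, ¬ I.WeaklyLinked v (j + 1) → c j ≤ 1

lemma Tied.refl (m : ℕ) : I.Tied v m m := Or.inl ⟨le_rfl, fun _ h h' => absurd h' (not_le.2 h)⟩

lemma Tied.succ {m m' : ℕ} (hl : I.Linked v (m + 1)) (h : I.Tied v m m') : I.Tied v (m + 1) m' := by
  rcases h with ⟨hle, hweak⟩ | ⟨hlt, hlinked⟩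
  · rcases hle.eq_or_lt with rfl | hlt
    · refine Or.inr ⟨Nat.lt_succ_self _, fun i hi hi' => ?_⟩
      obtain rfl : i = m + 1 := by omega
      exact hl
    · exact Or.inl ⟨hlt, fun i hi hi' => hweak i (by omega) hi'⟩
  · refine Or.inr ⟨by omega, fun i hi hi' => ?_⟩
    rcases hi'.eq_or_lt with rfl | hi'
    · exact hl
    · exact hlinked i hi (by omega)

lemma Tied.of_succ {m m' : ℕ} (hl : I.WeaklyLinked v (m + 1)) (h : I.Tied v (m + 1) m') :
    I.Tied v m m' := by
  rcases h with ⟨hle, hweak⟩ | ⟨hlt, hlinked⟩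
  · refine Or.inl ⟨by omega, fun i hi hi' => ?_⟩
    rcases (Nat.succ_le_of_lt hi).eq_or_lt with rfl | hi
    · exact hl
    · exact hweak i (by omega) hi'
  · rcases (Nat.le_of_lt_succ hlt).eq_or_lt with rfl | hlt
    · exact Tied.refl _
    · exact Or.inr ⟨hlt, fun i hi hi' => hlinked i hi (by omega)⟩

lemma Tied.lt_chainEnd {j m' : Fin I.n} (h : I.Tied v j m') : j.val < I.chainEnd v m' := by
  rcases h with ⟨hle, -⟩ | ⟨hlt, hlinked⟩
  · exact hle.trans_lt (Inst.lt_chainEnd m'.isLt)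
  · rw [show I.chainEnd v m' = I.chainEnd v j from firstFail_congr hlt.le hlinked]
    exact Inst.lt_chainEnd j.isLt

lemma weakChainEnd_succ {j : ℕ} (h : I.WeaklyLinked v (j + 1)) :
    I.weakChainEnd v (j + 1) = I.weakChainEnd v j :=
  (firstFail_congr (Nat.le_succ j) fun i hi hi' => by
    obtain rfl : i = j + 1 := by omega
    exact h).symm

open Classical in
/-- The largest multiplier of `j` that is allowed by its weak chain and by the shrinking energies of
the jobs tied to it; shifting by the positions makes the bounds of linked jobs comparable. -/
def multiplier (I : Inst) (v : Fin I.n → ℝ) (j : ℕ) : ℝ :=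
  (insert (I.weakChainEnd v j : ℝ) ((Finset.univ.filter fun m' : Fin I.n => I.Tied v j m').image
    fun m' => I.shrinkAt (I.floorIdx (v m')) + m')).min' (Finset.insert_nonempty _ _) - j

lemma le_multiplier_iff {j : ℕ} {a : ℝ} :
    a ≤ I.multiplier v j ↔ a + j ≤ I.weakChainEnd v j ∧
      ∀ m' : Fin I.n, I.Tied v j m' → a + j ≤ I.shrinkAt (I.floorIdx (v m')) + m' := by
  simp [multiplier, le_sub_iff_add_le, Finset.le_min'_iff]

lemma multiplier_add_le_weakChainEnd (v : Fin I.n → ℝ) (j : ℕ) :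
    I.multiplier v j + j ≤ I.weakChainEnd v j :=
  (le_multiplier_iff.1 le_rfl).1

lemma multiplier_add_le_of_tied {j : ℕ} {m' : Fin I.n} (h : I.Tied v j m') :
    I.multiplier v j + j ≤ I.shrinkAt (I.floorIdx (v m')) + m' :=
  (le_multiplier_iff.1 le_rfl).2 m' h

lemma one_le_multiplier (hgain : ∀ j, I.realGain v j ≤ 0) (j : Fin I.n) :
    1 ≤ I.multiplier v j := by
  refine le_multiplier_iff.2 ⟨?_, fun m' hm' => ?_⟩
  · rw [add_comm]
    exact_mod_cast lt_weakChainEnd (v := v) j.isLt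
  · have hend : (j : ℝ) + 1 ≤ I.chainEnd v m' := by exact_mod_cast hm'.lt_chainEnd
    have hm := hgain m'
    rw [realGain] at hm
    linarith

lemma Balanced.shrinkAt_le_multiplier (hv : I.Balanced v) {j : Fin I.n} (hj : I.speedAt 1 < v j) :
    I.shrinkAt (I.predIdx (v j)) ≤ I.multiplier v j := by
  refine le_multiplier_iff.2 ⟨hv.le_weakChainEnd j hj, fun m' hm' => ?_⟩
  by_cases hk : I.floorIdx (v m') < I.k
  · exact hv.le_of_tied j m' hj hk hm'
  · have hend : (I.weakChainEnd v j : ℝ) ≤ I.n := by exact_mod_cast weakChainEnd_le j.isLt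
    have hle := hv.le_weakChainEnd j hj
    have hpos : (0 : ℝ) ≤ (m' : ℕ) := by positivity
    rw [shrinkAt_of_le (not_lt.1 hk)]
    linarith only [hend, hle, hpos]

lemma multiplier_le_of_weaklyLinked {j : ℕ} (h : I.WeaklyLinked v (j + 1)) :
    I.multiplier v j ≤ 1 + I.multiplier v (j + 1) := by
  refine sub_le_iff_le_add'.1 (le_multiplier_iff.2 ⟨?_, fun m' hm' => ?_⟩)
  · have hle := multiplier_add_le_weakChainEnd v j
    rw [weakChainEnd_succ h]
    push_cast
    linarith
  · have hle := multiplier_add_le_of_tied (hm'.of_succ h)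
    push_cast
    linarith

lemma le_multiplier_of_linked {j : ℕ} (h : I.Linked v (j + 1)) :
    1 + I.multiplier v (j + 1) ≤ I.multiplier v j := by
  refine le_multiplier_iff.2 ⟨?_, fun m' hm' => ?_⟩
  · have hle := multiplier_add_le_weakChainEnd v (j + 1)
    rw [weakChainEnd_succ h.weaklyLinked] at hle
    push_cast at hle
    linarith
  · have hle := multiplier_add_le_of_tied (hm'.succ h)
    push_cast at hle
    linarith

lemma multiplier_le_one {j : ℕ} (h : ¬ I.WeaklyLinked v (j + 1)) : I.multiplier v j ≤ 1 := by
  have hend : (I.weakChainEnd v j : ℝ) ≤ j + 1 := by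
    exact_mod_cast firstFail_le (Nat.lt_succ_self j) h
  linarith [multiplier_add_le_weakChainEnd v j]

lemma Balanced.certifies_multiplier (hv : I.Balanced v) (hgain : ∀ j, I.realGain v j ≤ 0) :
    I.Certifies v (I.multiplier v) where
  one_le := one_le_multiplier hgain
  le_shrinkAt j := le_of_add_le_add_right (multiplier_add_le_of_tied (Tied.refl j))
  shrinkAt_le _ hj := hv.shrinkAt_le_multiplier hj
  le_of_weaklyLinked _ := multiplier_le_of_weaklyLinked
  ge_of_linked _ := le_multiplier_of_linked
  le_one _ := multiplier_le_one

namespace Certifies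

variable {c : ℕ → ℝ}

/-! ### Weak duality -/

lemma sub_one_mul_le (hc : I.Certifies v c) {m : ℕ} (hm : m + 1 < I.n) (f : ℝ) :
    (c m - 1) * (f - I.done v (m + 1)) ≤
      c (m + 1) * (max (I.releaseAt (m + 1)) f - max (I.releaseAt (m + 1)) (I.done v (m + 1))) := by
  have hone : 1 ≤ c m := hc.one_le ⟨m, by omega⟩
  have hsucc : 0 ≤ c (m + 1) := zero_le_one.trans (hc.one_le ⟨m + 1, hm⟩)
  by_cases hweak : I.WeaklyLinked v (m + 1)
  · have hle : c m - 1 ≤ c (m + 1) :=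
      sub_le_iff_le_add'.2 (hc.le_of_weaklyLinked ⟨m, by omega⟩ hweak)
    rw [max_eq_right hweak.2]
    by_cases hlinked : I.Linked v (m + 1)
    · have heq : c m - 1 = c (m + 1) :=
        hle.antisymm (le_sub_iff_add_le'.2 (hc.ge_of_linked ⟨m, by omega⟩ hlinked))
      rw [heq]
      gcongr
      exact le_max_right _ _
    · have htight : I.releaseAt (m + 1) = I.done v (m + 1) :=
        le_antisymm hweak.2 (not_lt.1 fun h => hlinked ⟨hweak.1, h⟩)
      rw [← htight]
      calc (c m - 1) * (f - I.releaseAt (m + 1))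
          ≤ (c m - 1) * (max (I.releaseAt (m + 1)) f - I.releaseAt (m + 1)) := by
            gcongr
            exact le_max_right _ _
        _ ≤ c (m + 1) * (max (I.releaseAt (m + 1)) f - I.releaseAt (m + 1)) := by
            gcongr
            exact sub_nonneg.2 (le_max_left _ _)
  · have heq : c m = 1 := (hc.le_one ⟨m, by omega⟩ hweak).antisymm hone
    have hlate : I.done v (m + 1) ≤ I.releaseAt (m + 1) := (not_le.1 fun h => hweak ⟨hm, h⟩).le
    rw [heq, sub_self, zero_mul, max_eq_left hlate]
    exact mul_nonneg hsucc (sub_nonneg.2 (le_max_left _ _))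

lemma sum_range_le (hc : I.Certifies v c) {F x y : ℕ → ℝ} (hF0 : 0 ≤ F 0)
    (hx : ∀ m < I.n, max (I.releaseAt m) (I.done v m) + x m = I.done v (m + 1))
    (hF : ∀ m < I.n, max (I.releaseAt m) (F m) + y m ≤ F (m + 1)) {m : ℕ} (hm : m < I.n) :
    (1 - c m) * (F (m + 1) - I.done v (m + 1)) ≤
      ∑ i ∈ Finset.range (m + 1), ((F (i + 1) - c i * y i) - (I.done v (i + 1) - c i * x i)) := by
  have hpos : 0 ≤ c m := zero_le_one.trans (hc.one_le ⟨m, hm⟩)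
  have hterm : (1 - c m) * (F (m + 1) - I.done v (m + 1)) +
      c m * (max (I.releaseAt m) (F m) - max (I.releaseAt m) (I.done v m)) ≤
      (F (m + 1) - c m * y m) - (I.done v (m + 1) - c m * x m) := by
    rw [← hx m hm]
    linarith [mul_le_mul_of_nonneg_left (hF m hm) hpos]
  rw [Finset.sum_range_succ]
  cases m with
  | zero =>
    have hmax : 0 ≤ max (I.releaseAt 0) (F 0) - max (I.releaseAt 0) (I.done v 0) :=
      sub_nonneg.2 (max_le_max_left _ hF0)
    simp only [Finset.range_zero, Finset.sum_empty, zero_add] at hterm ⊢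
    linarith [mul_nonneg hpos hmax]
  | succ m =>
    linarith [hc.sum_range_le hF0 hx hF (Nat.lt_of_succ_lt hm), hc.sub_one_mul_le hm (F (m + 1))]

/-- Weak duality for completion times `F` and processing times `y` of the jobs in order. -/
lemma sum_le (hc : I.Certifies v c) {F y : ℕ → ℝ} (hF0 : 0 ≤ F 0)
    (hF : ∀ m < I.n, max (I.releaseAt m) (F m) + y m ≤ F (m + 1)) :
    ∑ j : Fin I.n, (I.done v (j + 1) - c j * (1 / v j)) ≤
      ∑ j : Fin I.n, (F (j + 1) - c j * y j) := by
  set x : ℕ → ℝ := fun m => I.done v (m + 1) - max (I.releaseAt m) (I.done v m) with hx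
  have hxj (j : Fin I.n) : x j = 1 / v j := by
    simp only [hx, done_succ_of_lt v j.isLt, add_sub_cancel_left]
  simp only [← hxj]
  rw [← Finset.sum_range (fun m => I.done v (m + 1) - c m * x m),
    ← Finset.sum_range (fun m => F (m + 1) - c m * y m), ← sub_nonneg, ← Finset.sum_sub_distrib]
  rcases Nat.eq_zero_or_pos I.n with hn | hn
  · simp [hn]
  · obtain ⟨m, hm⟩ : ∃ m, I.n = m + 1 := ⟨I.n - 1, by omega⟩
    have hlast : c m = 1 := (hc.le_one ⟨m, by omega⟩ fun h => h.1.ne hm.symm).antisymm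
      (hc.one_le ⟨m, by omega⟩)
    have hsum := hc.sum_range_le hF0 (x := x) (fun _ _ => add_sub_cancel _ _) hF (m := m) (by omega)
    rwa [hlast, sub_self, zero_mul, ← hm] at hsum

/-! ### The price of volume -/

lemma price_le (hc : I.Certifies v c) (hv : I.InRange v) (j : Fin I.n) {i : ℕ} (h0 : 0 < i)
    (hi : i ≤ I.k) : I.price (c j) (I.floorIdx (v j)) ≤ I.price (c j) i :=
  price_floorIdx_le (hv j).1 (hv j).2 (hc.shrinkAt_le j) (fun _ => hc.le_shrinkAt j) h0 hi

/-- If the speed is not given, the multiplier is the shrinking energy, at which the two levels next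
to the speed have the same price. -/
lemma price_ceilLevel (hc : I.Certifies v c) (hv : I.InRange v) (j : Fin I.n) :
    I.price (c j) (I.ceilLevel (v j)) = I.price (c j) (I.floorIdx (v j)) := by
  have hfl : 0 < I.floorIdx (v j) := floorIdx_pos (hv j).1
  rcases (speedAt_floorIdx_le (hv.pos j).le).eq_or_lt with hgiven | hlt
  · have hceil : I.ceilLevel (v j) = I.floorLevel (v j) :=
      ((ceilLevel_le_iff (hv j).2 _).2 (by rw [← speedAt_val]; exact hgiven.ge)).antisymm
        (floorLevel_le_ceilLevel (hv.pos j).le (hv j).2)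
    rw [hceil, floorIdx]
  · have hk : I.floorIdx (v j) < I.k := (floorIdx_le _).lt_of_ne fun h =>
      (h ▸ hlt).not_ge (hv j).2
    have hpred : I.predIdx (v j) = I.floorIdx (v j) :=
      (predIdx_le_floorIdx (hv.pos j)).antisymm ((le_predIdx_iff (hv.pos j) (floorIdx_le _)).2 hlt)
    have hcj : c j = I.shrinkAt (I.floorIdx (v j)) := (hc.le_shrinkAt j).antisymm
      (hpred ▸ hc.shrinkAt_le j ((speedAt_le hfl (floorIdx_le _)).trans_lt hlt))
    have hceil : (I.ceilLevel (v j)).val = I.floorIdx (v j) + 1 := by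
      refine le_antisymm ?_ (Nat.succ_le_of_lt (not_le.1 fun h => ?_))
      · refine Fin.le_def.1 ((ceilLevel_le_iff (i := ⟨_, Nat.succ_lt_succ hk⟩) (hv j).2).2 ?_)
        rw [← speedAt_val]
        exact (lt_speedAt_floorIdx_succ (hv.pos j).le hk).le
      · refine hlt.not_ge ((le_s_ceilLevel (hv j).2).trans ?_)
        rw [← speedAt_val]
        exact speedAt_le h (floorIdx_le _)
    rw [hceil]
    exact (price_succ_le hfl hk hcj.ge).antisymm (price_le_succ hfl hk hcj.le)

lemma energy_eq (hc : I.Certifies v c) (hv : I.InRange v) (j : Fin I.n) :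
    I.P (I.floorLevel (v j)) * I.slowTime (v j) +
        I.P (I.ceilLevel (v j)) * (1 / v j - I.slowTime (v j)) =
      I.price (c j) (I.floorIdx (v j)) - c j * (1 / v j) := by
  have hpower (i : Fin (I.k + 1)) (hi : 0 < i) :
      I.P i = I.price (c j) i * I.s i - c j := by
    rw [price, speedAt_val, powerAt_val, div_mul_cancel₀, add_sub_cancel_right]
    rw [← speedAt_val]
    exact (speedAt_pos (Fin.lt_def.1 hi) (Nat.lt_succ_iff.1 i.isLt)).ne'
  rw [hpower _ (floorLevel_pos (hv j).1), hpower _ (ceilLevel_pos (hv j).1 (hv j).2),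
    hc.price_ceilLevel hv, ← floorIdx]
  linear_combination I.price (c j) (I.floorIdx (v j)) * slowTime_volume (hv j).1 (hv j).2

end Certifies

end Inst

namespace Schedule

variable {I : Inst} {σ : Schedule I}

/-! ### A lower bound for all feasible schedules -/

/-- The times at which some job is processed. -/
def busy (σ : Schedule I) : Set ℝ := ⋃ j, σ.X j

/-- The length of the time at which some job is processed, as a measure. -/
def busyTime (σ : Schedule I) : Measure ℝ := volume.restrict σ.busy

/-- The volume that is processed up to time `t`. -/
def volumeBy (σ : Schedule I) (t : ℝ) : ℝ := ∫ τ in Set.Iic t, I.s (σ.S τ) ∂σ.busyTime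

/-- The first time by which the volume `m` is processed. In the schedule that assigns the processed
volume to the jobs in order, this is when the first `m` jobs are completed. -/
def reachTime (σ : Schedule I) (m : ℕ) : ℝ := sInf {t | 0 ≤ t ∧ m ≤ σ.volumeBy t}

/-- The processing time of the `m`-th unit of volume. -/
def workTime (σ : Schedule I) (m : ℕ) : ℝ :=
  σ.busyTime.real (Set.Ioc (σ.reachTime m) (σ.reachTime (m + 1)))

instance : NullSingletonClass σ.busyTime :=
  inferInstanceAs (NullSingletonClass (volume.restrict _))

lemma busy_subset : σ.busy ⊆ Set.Ici 0 := Set.iUnion_subset fun j => X_subset_Ici j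

lemma disjoint_X : Pairwise fun i j : Fin I.n => Disjoint (σ.X i) (σ.X j) := fun _ _ hij =>
  Set.disjoint_left.2 fun _ hi hj => hij (Option.some.inj (hi.2.1.symm.trans hj.2.1))

lemma C_nonneg (j : Fin I.n) : 0 ≤ σ.C j := Real.sSup_nonneg fun _ ht => ht.1

lemma s_nonneg (t : ℝ) : 0 ≤ I.s (σ.S t) := by
  rw [← I.s_zero]
  exact I.s_strictMono.monotone (Fin.zero_le _)

lemma S_pos_of_mem_busy {t : ℝ} (h : t ∈ σ.busy) : 0 < σ.S t := by
  obtain ⟨j, hj⟩ := Set.mem_iUnion.1 h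
  exact hj.2.2

lemma reachTime_nonneg (m : ℕ) : 0 ≤ σ.reachTime m := Real.sInf_nonneg fun _ ht => ht.1

lemma reachTime_le {m : ℕ} {t : ℝ} (h0 : 0 ≤ t) (h : m ≤ σ.volumeBy t) : σ.reachTime m ≤ t :=
  csInf_le ⟨0, fun _ ht => ht.1⟩ ⟨h0, h⟩

lemma volumeBy_zero : σ.volumeBy 0 = 0 := by
  refine setIntegral_measure_zero _ ?_
  rw [busyTime, Measure.restrict_apply measurableSet_Iic]
  exact measure_mono_null (t := {0}) (fun t ht => le_antisymm ht.1 (busy_subset ht.2)) (by simp)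

namespace Feasible

lemma measurableSet_busy (hσ : σ.Feasible) : MeasurableSet σ.busy :=
  MeasurableSet.iUnion hσ.measurableSet_X

lemma ae_S_pos (hσ : σ.Feasible) : ∀ᵐ t ∂σ.busyTime, 0 < σ.S t :=
  ae_restrict_of_forall_mem hσ.measurableSet_busy fun _ => S_pos_of_mem_busy

lemma exists_bound (hσ : σ.Feasible) : ∃ T, 0 ≤ T ∧ σ.busy ⊆ Set.Icc 0 T := by
  obtain ⟨T, hT⟩ : BddAbove σ.busy := by
    rw [busy, ← Set.biUnion_univ]
    exact Set.finite_univ.bddAbove_biUnion.2 fun j _ => hσ.completed j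
  exact ⟨max 0 T, le_max_left _ _, fun t ht => ⟨busy_subset ht, (hT ht).trans (le_max_right _ _)⟩⟩

lemma volume_busy_ne_top (hσ : σ.Feasible) : volume σ.busy ≠ ⊤ := by
  obtain ⟨T, -, hT⟩ := hσ.exists_bound
  exact measure_ne_top_of_subset hT (by simp)

lemma isFiniteMeasure_busyTime (hσ : σ.Feasible) : IsFiniteMeasure σ.busyTime :=
  isFiniteMeasure_restrict.2 hσ.volume_busy_ne_top

lemma integrable_comp (hσ : σ.Feasible) (f : Fin (I.k + 1) → ℝ) :
    Integrable (fun t => f (σ.S t)) σ.busyTime :=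
  hσ.integrableOn_comp f hσ.measurableSet_busy busy_subset hσ.volume_busy_ne_top

lemma setIntegral_busyTime (hσ : σ.Feasible) (f : Fin (I.k + 1) → ℝ) {A : Set ℝ}
    (hA : MeasurableSet A) :
    ∫ t in A, f (σ.S t) ∂σ.busyTime = ∑ j, ∫ t in σ.X j ∩ A, f (σ.S t) := by
  rw [busyTime, Measure.restrict_restrict hA, Set.inter_comm, busy, Set.iUnion_inter]
  refine integral_iUnion_fintype (fun j => (hσ.measurableSet_X j).inter hA) (fun i j hij => ?_)
    fun j => IntegrableOn.mono_set (hσ.integrable_comp f) ?_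
  · exact (disjoint_X hij).mono Set.inter_subset_left Set.inter_subset_left
  · exact Set.inter_subset_left.trans (Set.subset_iUnion σ.X j)

lemma volumeBy_sub (hσ : σ.Feasible) (a b : ℝ) :
    σ.volumeBy b - σ.volumeBy a = ∫ t in a..b, I.s (σ.S t) ∂σ.busyTime :=
  intervalIntegral.integral_Iic_sub_Iic (hσ.integrable_comp I.s).integrableOn
    (hσ.integrable_comp I.s).integrableOn

lemma monotone_volumeBy (hσ : σ.Feasible) : Monotone σ.volumeBy := fun _ _ hab =>
  setIntegral_mono_set (hσ.integrable_comp I.s).integrableOn (.of_forall s_nonneg)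
    (Set.Iic_subset_Iic.2 hab).eventuallyLE

lemma continuous_volumeBy (hσ : σ.Feasible) : Continuous σ.volumeBy := by
  have heq : σ.volumeBy = fun t => ∫ τ in (0 : ℝ)..t, I.s (σ.S τ) ∂σ.busyTime := by
    ext t
    rw [← hσ.volumeBy_sub, volumeBy_zero, sub_zero]
  rw [heq]
  exact intervalIntegral.continuous_primitive
    (fun a b => (hσ.integrable_comp I.s).intervalIntegrable) 0

lemma card_le_volumeBy (hσ : σ.Feasible) (A : Finset (Fin I.n)) {t : ℝ} (h : ∀ j ∈ A, σ.C j ≤ t) :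
    A.card ≤ σ.volumeBy t := by
  rw [volumeBy, hσ.setIntegral_busyTime I.s measurableSet_Iic]
  calc (A.card : ℝ) = ∑ _j ∈ A, (1 : ℝ) := by simp
    _ = ∑ j ∈ A, ∫ τ in σ.X j ∩ Set.Iic t, I.s (σ.S τ) := by
      refine Finset.sum_congr rfl fun j hj => ?_
      rw [← hσ.processed j, Set.inter_eq_left.2]
      exact fun τ hτ => (le_csSup (hσ.completed j) hτ).trans (h j hj)
    _ ≤ _ := Finset.sum_le_sum_of_subset_of_nonneg (Finset.subset_univ _)
      fun j _ _ => integral_nonneg fun τ => s_nonneg τ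

lemma setIntegral_X_inter_Iic_le (hσ : σ.Feasible) (j m : Fin I.n) :
    ∫ τ in σ.X j ∩ Set.Iic (I.r m), I.s (σ.S τ) ≤ if j < m then 1 else 0 := by
  split_ifs with hj
  · rw [← hσ.processed j]
    exact setIntegral_mono_set (IntegrableOn.mono_set (hσ.integrable_comp I.s)
      (Set.subset_iUnion σ.X j))
      (.of_forall s_nonneg) Set.inter_subset_left.eventuallyLE
  · refine (setIntegral_measure_zero _ (measure_mono_null (t := {I.r m}) ?_ (by simp))).le
    exact fun τ hτ => le_antisymm hτ.2
      ((I.r_mono (not_lt.1 hj)).trans (hσ.released j τ hτ.1.1 hτ.1.2.1))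

lemma volumeBy_release_le (hσ : σ.Feasible) (m : Fin I.n) : σ.volumeBy (I.r m) ≤ m := by
  rw [volumeBy, hσ.setIntegral_busyTime I.s measurableSet_Iic]
  calc ∑ j, ∫ τ in σ.X j ∩ Set.Iic (I.r m), I.s (σ.S τ)
      ≤ ∑ j, if j < m then 1 else 0 :=
        Finset.sum_le_sum fun j _ => hσ.setIntegral_X_inter_Iic_le j m
    _ = m := by simp [Finset.sum_boole, Finset.filter_gt_eq_Iio]

lemma exists_le_volumeBy (hσ : σ.Feasible) {m : ℕ} (hm : m ≤ I.n) :
    {t | 0 ≤ t ∧ m ≤ σ.volumeBy t}.Nonempty := by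
  obtain ⟨T, hT0, hT⟩ := hσ.exists_bound
  have hcard := hσ.card_le_volumeBy Finset.univ (t := T) fun j _ =>
    Real.sSup_le (fun t ht => (hT (Set.mem_iUnion.2 ⟨j, ht⟩)).2) hT0
  rw [Finset.card_univ, Fintype.card_fin] at hcard
  exact ⟨T, hT0, (Nat.cast_le.2 hm).trans hcard⟩

lemma le_volumeBy_reachTime (hσ : σ.Feasible) {m : ℕ} (hm : m ≤ I.n) :
    m ≤ σ.volumeBy (σ.reachTime m) :=
  ((isClosed_Ici.inter (isClosed_Ici.preimage hσ.continuous_volumeBy)).csInf_mem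
    (hσ.exists_le_volumeBy hm) ⟨0, fun _ ht => ht.1⟩).2

lemma volumeBy_reachTime (hσ : σ.Feasible) {m : ℕ} (hm : m ≤ I.n) :
    σ.volumeBy (σ.reachTime m) = m := by
  have hge := hσ.le_volumeBy_reachTime hm
  obtain ⟨t, ht, hvol⟩ := intermediate_value_Icc (reachTime_nonneg m)
    hσ.continuous_volumeBy.continuousOn
    (show (m : ℝ) ∈ Set.Icc (σ.volumeBy 0) _ from ⟨by simp [volumeBy_zero], hge⟩)
  rwa [le_antisymm ht.2 (reachTime_le ht.1 hvol.ge)] at hvol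

lemma reachTime_le_succ (hσ : σ.Feasible) {m : ℕ} (hm : m < I.n) :
    σ.reachTime m ≤ σ.reachTime (m + 1) := by
  refine reachTime_le (reachTime_nonneg _) ?_
  rw [hσ.volumeBy_reachTime hm]
  exact_mod_cast m.le_succ

lemma speedAt_one_mul_busyTime_le (hσ : σ.Feasible) {a b : ℝ} (hab : a ≤ b) :
    I.speedAt 1 * σ.busyTime.real (Set.Ioc a b) ≤ σ.volumeBy b - σ.volumeBy a := by
  have := hσ.isFiniteMeasure_busyTime
  rw [hσ.volumeBy_sub, intervalIntegral.integral_of_le hab, mul_comm, ← smul_eq_mul,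
    ← setIntegral_const]
  refine setIntegral_mono_ae (integrable_const _).integrableOn
    (hσ.integrable_comp I.s).integrableOn (hσ.ae_S_pos.mono fun t ht => ?_)
  change I.speedAt 1 ≤ I.s (σ.S t)
  rw [← Inst.speedAt_val]
  exact Inst.speedAt_le (Fin.lt_def.1 ht) (Nat.lt_succ_iff.1 (σ.S t).isLt)

lemma busyTime_Ioc_le (hσ : σ.Feasible) {a b c : ℝ} (hab : a ≤ b) (hbc : b ≤ c)
    (hvol : σ.volumeBy b ≤ σ.volumeBy a) : σ.busyTime.real (Set.Ioc a c) ≤ c - b := by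
  have := hσ.isFiniteMeasure_busyTime
  have hidle : σ.busyTime.real (Set.Ioc a b) ≤ 0 := nonpos_of_mul_nonpos_right
    ((hσ.speedAt_one_mul_busyTime_le hab).trans (sub_nonpos.2 hvol)) Inst.speedAt_one_pos
  calc σ.busyTime.real (Set.Ioc a c)
      ≤ σ.busyTime.real (Set.Ioc a b) + σ.busyTime.real (Set.Ioc b c) := by
        rw [← Set.Ioc_union_Ioc_eq_Ioc hab hbc]
        exact measureReal_union_le _ _
    _ ≤ 0 + volume.real (Set.Ioc b c) := by
        gcongr
        exact ENNReal.toReal_mono (by simp) (Measure.restrict_apply_le _ _)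
    _ = c - b := by rw [zero_add, Real.volume_real_Ioc_of_le hbc]

lemma max_release_add_workTime_le (hσ : σ.Feasible) {m : ℕ} (hm : m < I.n) :
    max (I.releaseAt m) (σ.reachTime m) + σ.workTime m ≤ σ.reachTime (m + 1) := by
  have hreach := hσ.volumeBy_reachTime hm.le
  have hvol : σ.volumeBy (max (I.releaseAt m) (σ.reachTime m)) ≤ m := by
    rw [hσ.monotone_volumeBy.map_max, max_le_iff]
    refine ⟨?_, hreach.le⟩
    have hrel := hσ.volumeBy_release_le ⟨m, hm⟩
    rwa [← Inst.releaseAt_val] at hrel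
  have hle : max (I.releaseAt m) (σ.reachTime m) ≤ σ.reachTime (m + 1) := by
    refine (hσ.monotone_volumeBy.reflect_lt ?_).le
    rw [hσ.volumeBy_reachTime hm]
    exact hvol.trans_lt (by exact_mod_cast m.lt_succ_self)
  exact le_sub_iff_add_le'.1
    (hσ.busyTime_Ioc_le (le_max_right _ _) hle (hvol.trans hreach.ge))

/-- The `m`-th completion is not before the volume `m + 1` is processed. -/
lemma sum_reachTime_le (hσ : σ.Feasible) : ∑ j : Fin I.n, σ.reachTime (j + 1) ≤ ∑ j, σ.C j := by
  rw [← Equiv.sum_comp (Tuple.sort σ.C) σ.C]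
  refine Finset.sum_le_sum fun m _ => reachTime_le (C_nonneg _) ?_
  have hcard := hσ.card_le_volumeBy ((Finset.Iic m).map (Tuple.sort σ.C).toEmbedding)
    (t := σ.C (Tuple.sort σ.C m)) fun j hj => by
      obtain ⟨i, hi, rfl⟩ := Finset.mem_map.1 hj
      exact Tuple.monotone_sort σ.C (Finset.mem_Iic.1 hi)
  rwa [Finset.card_map, Fin.card_Iic] at hcard

lemma sub_le_intervalIntegral_P (hσ : σ.Feasible) {m : ℕ} (hm : m < I.n) {a c : ℝ}
    (hac : ∀ i : Fin (I.k + 1), 0 < i → a * I.s i ≤ I.P i + c) :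
    a - c * σ.workTime m ≤
      ∫ t in σ.reachTime m..σ.reachTime (m + 1), I.P (σ.S t) ∂σ.busyTime := by
  have := hσ.isFiniteMeasure_busyTime
  have hle := hσ.reachTime_le_succ hm
  have hint (f : Fin (I.k + 1) → ℝ) {x y : ℝ} :
      IntervalIntegrable (fun t => f (σ.S t)) σ.busyTime x y :=
    (hσ.integrable_comp f).intervalIntegrable
  calc a - c * σ.workTime m
      = ∫ t in σ.reachTime m..σ.reachTime (m + 1), (a * I.s (σ.S t) - c) ∂σ.busyTime := by
        rw [intervalIntegral.integral_sub ((hint I.s).const_mul a) intervalIntegrable_const,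
          intervalIntegral.integral_const_mul, ← hσ.volumeBy_sub, hσ.volumeBy_reachTime hm,
          hσ.volumeBy_reachTime hm.le, intervalIntegral.integral_of_le hle, setIntegral_const,
          smul_eq_mul, workTime]
        push_cast
        ring
    _ ≤ _ := by
        refine intervalIntegral.integral_mono_ae hle
          (((hint I.s).const_mul a).sub intervalIntegrable_const) (hint I.P) ?_
        filter_upwards [hσ.ae_S_pos] with t ht
        exact sub_le_iff_le_add.2 (hac _ ht)

lemma ofReal_integral_P (hσ : σ.Feasible) {A : Set ℝ} (hA : MeasurableSet A) :
    ENNReal.ofReal (∫ t in A, I.P (σ.S t) ∂σ.busyTime) =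
      ∫⁻ t in A ∩ σ.busy, ENNReal.ofReal (I.P (σ.S t)) := by
  rw [ofReal_integral_eq_lintegral_ofReal (hσ.integrable_comp I.P).integrableOn
    (.of_forall fun t => Inst.P_nonneg _), busyTime, Measure.restrict_restrict hA]

lemma sum_le_energy (hσ : σ.Feasible) {a c : Fin I.n → ℝ}
    (hac : ∀ j, ∀ i : Fin (I.k + 1), 0 < i → a j * I.s i ≤ I.P i + c j) :
    ENNReal.ofReal (∑ j : Fin I.n, (a j - c j * σ.workTime j)) ≤ σ.energy := by
  have hsum : ∑ j : Fin I.n, (a j - c j * σ.workTime j) ≤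
      ∫ t in σ.reachTime 0..σ.reachTime I.n, I.P (σ.S t) ∂σ.busyTime := by
    rw [← intervalIntegral.sum_integral_adjacent_intervals fun m _ =>
      (hσ.integrable_comp I.P).intervalIntegrable, Finset.sum_range]
    exact Finset.sum_le_sum fun j _ => hσ.sub_le_intervalIntegral_P j.isLt (hac j)
  have hle : σ.reachTime 0 ≤ σ.reachTime I.n :=
    reachTime_le (reachTime_nonneg _) (by simp [hσ.volumeBy_reachTime le_rfl])
  calc ENNReal.ofReal (∑ j : Fin I.n, (a j - c j * σ.workTime j))
      ≤ ∫⁻ t in Set.Ioc (σ.reachTime 0) (σ.reachTime I.n) ∩ σ.busy,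
          ENNReal.ofReal (I.P (σ.S t)) := by
        rw [← hσ.ofReal_integral_P measurableSet_Ioc, ← intervalIntegral.integral_of_le hle]
        exact ENNReal.ofReal_le_ofReal hsum
    _ ≤ σ.energy := lintegral_mono_set (Set.inter_subset_right.trans busy_subset)

end Feasible

end Schedule

namespace Inst

variable {I : Inst} {ρ : Rule} {v : Fin I.n → ℝ}

/-- The energy of the processing of job `j` in the schedule `I.fifo v`. -/
def fifoEnergy (I : Inst) (v : Fin I.n → ℝ) (j : Fin I.n) : ℝ :=
  I.P (I.floorLevel (v j)) * I.slowTime (v j) +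
    I.P (I.ceilLevel (v j)) * (1 / v j - I.slowTime (v j))

lemma fifoEnergy_nonneg (hv : I.InRange v) (j : Fin I.n) : 0 ≤ I.fifoEnergy v j :=
  add_nonneg (mul_nonneg (P_nonneg _) (slowTime_nonneg (hv j).1 (hv j).2))
    (mul_nonneg (P_nonneg _) (sub_nonneg.2 (slowTime_le (hv j).1 (hv j).2)))

lemma energy_fifo (hv : I.InRange v) :
    (I.fifo v).energy = ENNReal.ofReal (∑ j, I.fifoEnergy v j) := by
  have hσ := fifo_feasible hv
  have hidle : ∫⁻ t in Set.Ici 0 \ (I.fifo v).busy, ENNReal.ofReal (I.P ((I.fifo v).S t)) = 0 := by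
    refine setLIntegral_eq_zero (measurableSet_Ici.diff hσ.measurableSet_busy) fun t ht => ?_
    have hnone : I.fifoJob v t = none := Option.eq_none_iff_forall_ne_some.2 fun j hj =>
      ht.2 (Set.mem_iUnion.2 ⟨j, by
        rw [fifo_X hv]
        exact (fifoJob_eq_some_iff hv.pos t j).1 hj⟩)
    simp only [fifo_S_of_none hnone, I.P_zero, ENNReal.ofReal_zero, Pi.zero_apply]
  calc (I.fifo v).energy
      = ∫⁻ t in Set.univ ∩ (I.fifo v).busy, ENNReal.ofReal (I.P ((I.fifo v).S t)) := by
        rw [Schedule.energy, ← lintegral_inter_add_sdiff _ (Set.Ici 0) hσ.measurableSet_busy,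
          hidle, add_zero, Set.inter_eq_right.2 Schedule.busy_subset, Set.univ_inter]
    _ = ENNReal.ofReal (∑ j, I.fifoEnergy v j) := by
        rw [← hσ.ofReal_integral_P MeasurableSet.univ, hσ.setIntegral_busyTime I.P .univ]
        simp only [Set.inter_univ, fifo_setIntegral hv, fifoEnergy]

namespace Certifies

variable {c : ℕ → ℝ}

lemma flow_add_le (hc : I.Certifies v c) (hv : I.InRange v) {σ : Schedule I} (hσ : σ.Feasible) :
    (I.fifo v).flow + ∑ j, I.fifoEnergy v j ≤
      σ.flow + ∑ j : Fin I.n, (I.price (c j) (I.floorIdx (v j)) - c j * σ.workTime j) := by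
  have hdual := hc.sum_le (σ.reachTime_nonneg 0) fun _ => hσ.max_release_add_workTime_le
  simp only [fifoEnergy, hc.energy_eq hv, Schedule.flow, fifo_C hv, Finset.sum_sub_distrib]
    at hdual ⊢
  linarith [hσ.sum_reachTime_le]

lemma optimal (hc : I.Certifies v c) (hv : I.InRange v) : (I.fifo v).Optimal := by
  refine ⟨fifo_feasible hv, fun σ hσ => ?_⟩
  set lower : ℝ := ∑ j : Fin I.n, (I.price (c j) (I.floorIdx (v j)) - c j * σ.workTime j)
  have hlower : ENNReal.ofReal lower ≤ σ.energy := hσ.sum_le_energy fun j i hi => by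
    have hprice := hc.price_le hv j (Fin.lt_def.1 hi) (Nat.lt_succ_iff.1 i.isLt)
    have hpos : 0 < I.speedAt i := speedAt_pos (Fin.lt_def.1 hi) (Nat.lt_succ_iff.1 i.isLt)
    rwa [price.eq_1 I _ i, le_div_iff₀ hpos, speedAt_val, powerAt_val] at hprice
  unfold Schedule.objective
  calc ((I.fifo v).flow : EReal) + (I.fifo v).energy
      = (((I.fifo v).flow + ∑ j, I.fifoEnergy v j : ℝ) : EReal) := by
        rw [energy_fifo hv, EReal.coe_ennreal_ofReal,
          max_eq_left (Finset.sum_nonneg fun j _ => fifoEnergy_nonneg hv j), EReal.coe_add]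
    _ ≤ ((σ.flow + lower : ℝ) : EReal) := EReal.coe_le_coe_iff.2 (hc.flow_add_le hv hσ)
    _ = (σ.flow : EReal) + (lower : EReal) := EReal.coe_add _ _
    _ ≤ (σ.flow : EReal) + (σ.energy : EReal) := by
        refine add_le_add le_rfl (le_trans ?_ (EReal.coe_ennreal_le_coe_ennreal_iff.2 hlower))
        rw [EReal.coe_ennreal_ofReal]
        exact EReal.coe_le_coe_iff.2 (le_max_left _ _)

end Certifies

lemma Run.optimal {m : ℕ} (h : I.Run ρ m v) (hhalt : I.Halted ρ v) : (I.fifo v).Optimal := by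
  have hv := h.balanced
  refine (hv.certifies_multiplier fun j => ?_).optimal hv.inRange
  have hactive := (halted_iff hv.inRange).1 hhalt j
  cases ρ
  · exact not_lt.1 hactive
  · exact (not_le.1 hactive).le

end Inst

namespace Inst

variable {I : Inst} {ρ : Rule} {v : Fin I.n → ℝ} {j : Fin I.n}

/-! ### Carrying out an iteration event by event -/

/-- `c` is the processing time of job `j` at the first event that is met when `j` is sped up, if
only the links below `e` are watched: a given speed is reached, or one of these links is lost. -/
structure IsEventBelow (I : Inst) (v : Fin I.n → ℝ) (j : Fin I.n) (e : ℕ) (c : ℝ) : Prop where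
  level_le : 1 / I.speedAt (I.floorIdx (v j) + 1) ≤ c
  link_le : ∀ i, j.val < i → i < e → 1 / v j - (I.done v i - I.releaseAt i) ≤ c
  eq : c = 1 / I.speedAt (I.floorIdx (v j) + 1) ∨
    ∃ i, j.val < i ∧ i < e ∧ c = 1 / v j - (I.done v i - I.releaseAt i)

/-- `c` is the processing time of job `j` at the first event that is met when `j` is sped up. -/
abbrev IsNextEvent (I : Inst) (v : Fin I.n → ℝ) (j : Fin I.n) (c : ℝ) : Prop :=
  I.IsEventBelow v j (I.chainEnd v j) c

namespace IsEventBelow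

variable {e : ℕ} {c : ℝ}

lemma init (v : Fin I.n → ℝ) (j : Fin I.n) :
    I.IsEventBelow v j (j + 1) (1 / I.speedAt (I.floorIdx (v j) + 1)) :=
  ⟨le_rfl, fun _ _ _ => by omega, .inl rfl⟩

lemma succ (h : I.IsEventBelow v j e c) (he : j.val < e) :
    I.IsEventBelow v j (e + 1) (max c (1 / v j - (I.done v e - I.releaseAt e))) := by
  refine ⟨h.level_le.trans (le_max_left _ _), fun i hi hie => ?_, ?_⟩
  · rcases (Nat.lt_succ_iff.1 hie).lt_or_eq with hlt | rfl
    · exact (h.link_le i hi hlt).trans (le_max_left _ _)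
    · exact le_max_right _ _
  · rcases max_choice c (1 / v j - (I.done v e - I.releaseAt e)) with hmax | hmax <;> rw [hmax]
    · exact h.eq.imp_right fun ⟨i, hi, hie, hc⟩ => ⟨i, hi, hie.trans e.lt_succ_self, hc⟩
    · exact .inr ⟨e, he, e.lt_succ_self, rfl⟩

end IsEventBelow

namespace IsNextEvent

variable {c w : ℝ}

lemma pos (hc : I.IsNextEvent v j c) (hk : I.floorIdx (v j) < I.k) : 0 < c :=
  (one_div_pos.2 (speedAt_pos (Nat.succ_pos _) hk)).trans_le hc.level_le

lemma lt (hc : I.IsNextEvent v j c) (hv : I.InRange v) (hk : I.floorIdx (v j) < I.k) :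
    c < 1 / v j := by
  rcases hc.eq with rfl | ⟨i, hi, hi', rfl⟩
  · exact one_div_lt_one_div_of_lt (hv.pos j) (lt_speedAt_floorIdx_succ (hv.pos j).le hk)
  · exact sub_lt_self _ (sub_pos.2 (of_lt_firstFail (p := I.Linked v) hi hi').2)

lemma lt_inv (hc : I.IsNextEvent v j c) (hv : I.InRange v) (hk : I.floorIdx (v j) < I.k) :
    v j < 1 / c :=
  (lt_one_div (hv.pos j) (hc.pos hk)).2 (hc.lt hv hk)

lemma inv_le (hc : I.IsNextEvent v j c) (hk : I.floorIdx (v j) < I.k) :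
    1 / c ≤ I.speedAt (I.floorIdx (v j) + 1) :=
  (one_div_le (hc.pos hk) (speedAt_pos (Nat.succ_pos _) hk)).2 hc.level_le

/-- Up to the first event, the chain of `j` moves as a block. -/
lemma done_update (hc : I.IsNextEvent v j c) (hv : I.InRange v) (hk : I.floorIdx (v j) < I.k)
    (hw : v j ≤ w) (hwc : w ≤ 1 / c) {i : ℕ} (hi : j.val < i) (hi' : i < I.chainEnd v j) :
    I.done (Function.update v j w) i = I.done v i - (1 / v j - 1 / w) := by
  have hcw : c ≤ 1 / w := (le_one_div (hc.pos hk) ((hv.pos j).trans_le hw)).2 hwc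
  induction i using Nat.strong_induction_on with
  | _ i ih =>
    refine done_update_of_weaklyLinked hv.pos hw hi (of_lt_firstFail hi hi' : I.Linked v i).1.le
      fun i' hji' hii' => ?_
    have hlt : i' < I.chainEnd v j := by omega
    refine ⟨(of_lt_firstFail hji' hlt : I.Linked v i').1, ?_⟩
    rw [ih i' hii' hji' hlt]
    linarith [hc.link_le i' hji' hlt]

lemma linked_update (hc : I.IsNextEvent v j c) (hv : I.InRange v) (hk : I.floorIdx (v j) < I.k)
    (hw : v j ≤ w) (hwc : w < 1 / c) {i : ℕ} (hi : I.Linked v i) :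
    I.Linked (Function.update v j w) i := by
  refine ⟨hi.1, ?_⟩
  rcases le_or_gt i j with hij | hij
  · rw [done_update_of_le hij]
    exact hi.2
  rcases lt_trichotomy i (I.chainEnd v j) with hend | rfl | hend
  · rw [hc.done_update hv hk hw hwc.le hij hend]
    have hcw : c < 1 / w := (lt_one_div (hc.pos hk) ((hv.pos j).trans_le hw)).2 hwc
    linarith [hc.link_le i hij hend]
  · exact absurd hi (not_linked_chainEnd j.isLt)
  · rw [done_update_of_not_linked hv.pos hw (lt_chainEnd j.isLt) (hend.trans hi.1)
      (not_linked_chainEnd j.isLt) hend]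
    exact hi.2

lemma canRaise (hc : I.IsNextEvent v j c) (hv : I.InRange v) (h : I.CanRaise ρ v j)
    (hw : v j ≤ w) (hwc : w < 1 / c) : I.CanRaise ρ (Function.update v j w) j := by
  have hk := floorIdx_lt_of_realGain_nonneg h.1.nonneg
  have hfloor : I.floorIdx w = I.floorIdx (v j) :=
    floorIdx_eq hk ((speedAt_floorIdx_le (hv.pos j).le).trans hw) (hwc.trans_le (hc.inv_le hk))
  exact h.congr (realGain_update_congr hv.pos hw hfloor fun i hi =>
    hc.linked_update hv hk hw hwc hi)

lemma events_lt (hc : I.IsNextEvent v j c) (hv : I.InRange v) (hk : I.floorIdx (v j) < I.k) :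
    I.events v < I.events (Function.update v j (1 / c)) := by
  have hlt := hc.lt_inv hv hk
  refine Inst.events_lt hv.pos hlt.le ?_
  rcases hc.eq with h | ⟨i, hi, hi', h⟩
  · left
    rw [h, one_div_one_div]
    exact (le_floorIdx_iff (speedAt_pos (Nat.succ_pos _) hk).le hk).2 le_rfl
  · refine Or.inr ⟨i, of_lt_firstFail hi hi', fun hlinked => hlinked.2.ne' ?_⟩
    rw [hc.done_update hv hk hlt.le le_rfl hi hi', one_div_one_div, h]
    ring

end IsNextEvent

/-- The speeds `v` may occur while an iteration with job `j` is being carried out. -/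
def Midway (I : Inst) (ρ : Rule) (v : Fin I.n → ℝ) (j : Fin I.n) : Prop :=
  I.InRange v ∧ ∃ m v₀, I.Run ρ m v₀ ∧ v₀ j ≤ v j ∧ v = Function.update v₀ j (v j) ∧
    ∀ w, v₀ j ≤ w → w < v j → I.CanRaise ρ (Function.update v₀ j w) j

lemma Run.midway {m : ℕ} (h : I.Run ρ m v) (j : Fin I.n) : I.Midway ρ v j :=
  ⟨h.inRange, m, v, h, le_rfl, (Function.update_eq_self _ _).symm,
    fun _ hle hlt => absurd hlt (not_lt.2 hle)⟩

namespace Midway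

lemma run (h : I.Midway ρ v j) (hn : ¬ I.CanRaise ρ v j) : ∃ m, I.Run ρ m v := by
  obtain ⟨hr, m, v₀, hm, hle, hv, hw⟩ := h
  rcases hle.eq_or_lt with he | hlt
  · rw [← he, Function.update_eq_self] at hv
    exact ⟨m, hv ▸ hm⟩
  · refine ⟨m + 1, hm.step ((iteration_iff hm.inRange _).2 ⟨j, v j, ⟨hlt, (hr j).2, hw, ?_⟩, hv⟩)⟩
    rwa [← hv]

/-- Ties are broken in favour of the job of the current iteration, so that the selection of another
job shows that the iteration is over. -/
lemma select {j' : Fin I.n} (h : I.Midway ρ v j)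
    (hj : j' = j ∨ I.realGain v j < I.realGain v j') : I.Midway ρ v j' := by
  rcases hj with rfl | hj
  · exact h
  · obtain ⟨m, hm⟩ := h.run fun hcan => (hcan.2 j').not_gt hj
    exact hm.midway j'

lemma raise (h : I.Midway ρ v j) (hcan : I.CanRaise ρ v j) {c : ℝ} (hc : I.IsNextEvent v j c) :
    I.Midway ρ (Function.update v j (1 / c)) j := by
  have hv := h.1
  have hk := floorIdx_lt_of_realGain_nonneg hcan.1.nonneg
  have hlt := hc.lt_inv hv hk
  obtain ⟨m, v₀, hm, hle, hv₀, hw⟩ := h.2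
  refine ⟨hv.update hlt.le ((hc.inv_le hk).trans (speedAt_le hk le_rfl)), m, v₀, hm, ?_, ?_, ?_⟩
  · rw [Function.update_self]
    exact hle.trans hlt.le
  · rw [Function.update_self]
    conv_lhs => rw [hv₀]
    rw [Function.update_idem]
  · rw [Function.update_self]
    intro w hle' hlt'
    rcases lt_or_ge w (v j) with hwv | hwv
    · exact hw w hle' hwv
    · have hraised := hc.canRaise hv hcan hwv hlt'
      rwa [hv₀, Function.update_idem] at hraised

end Midway

end Inst

/-! ### Program logic -/

/-- All numbers in the store belong to `G`. -/
def Store.ValuesIn (G : Set ℝ) (m : Store) : Prop := ∀ a i, m.num a i ∈ G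

/-- Started on `m`, the program `p` halts after at most `t` steps with a store that satisfies `Q`,
and it writes only numbers that belong to `G`. Charging numbers affects neither the final store
nor the number of steps, and a step handles at most three numbers; hence the factor `1 + 3 * B`
when every number of `G` is charged at most `B`. -/
def Triple (G : Set ℝ) (p : Cmd) (m : Store) (t : ℕ) (Q : Store → Prop) : Prop :=
  ∃ m', Q m' ∧ m'.ValuesIn G ∧
    ∀ (ω : ℝ → ℕ) (B : ℕ), (∀ z ∈ G, ω z ≤ B) → ∃ t' ≤ (1 + 3 * B) * t, Exec ω p m m' t'

/-- Runs `p` while the counter `x` is counted up to the counter `y`. -/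
def Cmd.forLoop (x y : ℕ) (p : Cmd) : Cmd := .loop (.idxLt x y) (.seq p (.inc x))

/-- The counters that a program may change. -/
def Cmd.idxWrites : Cmd → List ℕ
  | .zero x | .copy x _ | .inc x | .dec x => [x]
  | .seq p q | .cond _ p q => p.idxWrites ++ q.idxWrites
  | .loop _ p => p.idxWrites
  | _ => []

/-- The arrays that a program may change. -/
def Cmd.numWrites : Cmd → List ℕ
  | .const a _ _ | .arith _ a _ _ _ _ _ => [a]
  | .seq p q | .cond _ p q => p.numWrites ++ q.numWrites
  | .loop _ p => p.numWrites
  | _ => []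

/-- The stores differ at most in the counters and arrays that `p` may change. -/
def Cmd.Frame (p : Cmd) (m m' : Store) : Prop :=
  (∀ x, x ∉ p.idxWrites → m'.idx x = m.idx x) ∧ ∀ a, a ∉ p.numWrites → m'.num a = m.num a

section Logic

variable {G : Set ℝ} {p q : Cmd} {m m' m'' : Store} {t t' : ℕ} {Q R : Store → Prop}

lemma Store.setIdx_idx_self (m : Store) (x i : ℕ) : (m.setIdx x i).idx x = i := by
  simp [Store.setIdx]

lemma Store.ValuesIn.setIdx (hm : m.ValuesIn G) (x i : ℕ) : (m.setIdx x i).ValuesIn G := hm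

lemma Store.ValuesIn.set (hm : m.ValuesIn G) (a x : ℕ) {z : ℝ} (hz : z ∈ G) :
    (m.set a x z).ValuesIn G := by
  intro b i
  simp only [Store.set, Function.update_apply]
  split_ifs with hab
  · rw [Function.update_apply]
    split_ifs
    exacts [hz, hm a i]
  · exact hm b i

lemma Test.cost_le (hm : m.ValuesIn G) {ω : ℝ → ℕ} {B : ℕ} (hB : ∀ z ∈ G, ω z ≤ B) (b : Test) :
    b.cost ω m ≤ 1 + 3 * B := by
  cases b with
  | idxLt x y => exact Nat.le_add_right _ _
  | numLt a x b y =>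
    have ha := hB _ (hm a (m.idx x))
    have hb := hB _ (hm b (m.idx y))
    simp only [Test.cost, Store.get]
    omega

namespace Cmd.Frame

lemma refl (p : Cmd) (m : Store) : p.Frame m m := ⟨fun _ _ => rfl, fun _ _ => rfl⟩

lemma trans (h : p.Frame m m') (h' : p.Frame m' m'') : p.Frame m m'' :=
  ⟨fun x hx => (h'.1 x hx).trans (h.1 x hx), fun a ha => (h'.2 a ha).trans (h.2 a ha)⟩

lemma mono (h : p.Frame m m') (hidx : p.idxWrites ⊆ q.idxWrites)
    (hnum : p.numWrites ⊆ q.numWrites) : q.Frame m m' :=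
  ⟨fun x hx => h.1 x fun hp => hx (hidx hp), fun a ha => h.2 a fun hp => ha (hnum hp)⟩

end Cmd.Frame

lemma Exec.frame {ω : ℝ → ℕ} (h : Exec ω p m m' t) : p.Frame m m' := by
  induction h with
  | skip m => exact .refl _ _
  | zero m x | copy m x | inc m x | dec m x =>
    refine ⟨fun y hy => ?_, fun _ _ => rfl⟩
    exact Function.update_of_ne (fun h => hy (List.mem_singleton.2 h)) _ _
  | const m a | arith m o a =>
    refine ⟨fun _ _ => rfl, fun b hb => ?_⟩
    exact Function.update_of_ne (fun h => hb (List.mem_singleton.2 h)) _ _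
  | seq _ _ ihp ihq =>
    exact (ihp.mono (List.subset_append_left _ _) (List.subset_append_left _ _)).trans
      (ihq.mono (List.subset_append_right _ _) (List.subset_append_right _ _))
  | cond_true _ _ ih => exact ih.mono (List.subset_append_left _ _) (List.subset_append_left _ _)
  | cond_false _ _ ih =>
    exact ih.mono (List.subset_append_right _ _) (List.subset_append_right _ _)
  | loop_true _ _ _ ihp ihloop =>
    exact (ihp.mono (List.Subset.refl _) (List.Subset.refl _)).trans ihloop
  | loop_false _ => exact .refl _ _

namespace Triple

lemma mono (h : Triple G p m t Q) (ht : t ≤ t') (hQ : ∀ m', m'.ValuesIn G → Q m' → R m') :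
    Triple G p m t' R := by
  obtain ⟨m', hm'Q, hm', hexec⟩ := h
  refine ⟨m', hQ m' hm' hm'Q, hm', fun ω B hB => ?_⟩
  obtain ⟨s, hs, he⟩ := hexec ω B hB
  exact ⟨s, hs.trans (Nat.mul_le_mul_left _ ht), he⟩

lemma of_le (h : Triple G p m t Q) (ht : t ≤ t') : Triple G p m t' Q := h.mono ht fun _ _ h => h

lemma frame (h : Triple G p m t Q) : Triple G p m t fun m' => Q m' ∧ p.Frame m m' := by
  obtain ⟨m', hQ, hm', hexec⟩ := h
  obtain ⟨_, -, he⟩ := hexec unitCost 0 fun _ _ => le_rfl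
  exact ⟨m', ⟨hQ, he.frame⟩, hm', hexec⟩

lemma skip (hm : m.ValuesIn G) (h : Q m) : Triple G .skip m 1 Q :=
  ⟨m, h, hm, fun _ _ _ => ⟨1, by omega, .skip m⟩⟩

lemma zero (hm : m.ValuesIn G) {x : ℕ} (h : Q (m.setIdx x 0)) : Triple G (.zero x) m 1 Q :=
  ⟨_, h, hm.setIdx _ _, fun _ _ _ => ⟨1, by omega, .zero m x⟩⟩

lemma copy (hm : m.ValuesIn G) {x y : ℕ} (h : Q (m.setIdx x (m.idx y))) :
    Triple G (.copy x y) m 1 Q :=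
  ⟨_, h, hm.setIdx _ _, fun _ _ _ => ⟨1, by omega, .copy m x y⟩⟩

lemma inc (hm : m.ValuesIn G) {x : ℕ} (h : Q (m.setIdx x (m.idx x + 1))) :
    Triple G (.inc x) m 1 Q :=
  ⟨_, h, hm.setIdx _ _, fun _ _ _ => ⟨1, by omega, .inc m x⟩⟩

lemma dec (hm : m.ValuesIn G) {x : ℕ} (h : Q (m.setIdx x (m.idx x - 1))) :
    Triple G (.dec x) m 1 Q :=
  ⟨_, h, hm.setIdx _ _, fun _ _ _ => ⟨1, by omega, .dec m x⟩⟩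

lemma const (hm : m.ValuesIn G) {a x c : ℕ} (hc : (c : ℝ) ∈ G) (h : Q (m.set a x c)) :
    Triple G (.const a x c) m 1 Q := by
  refine ⟨_, h, hm.set _ _ hc, fun ω B hB => ⟨_, ?_, .const m a x c⟩⟩
  have := hB _ hc
  omega

/-- The value `z` of the result is given explicitly, which keeps the stores readable. -/
lemma arith (hm : m.ValuesIn G) {o : Arith} {a x b y c d : ℕ} (z : ℝ)
    (hz : o.eval (m.get b y) (m.get c d) = z) (hG : z ∈ G) (h : Q (m.set a x z)) :
    Triple G (.arith o a x b y c d) m 1 Q := by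
  subst hz
  refine ⟨_, h, hm.set _ _ hG, fun ω B hB => ⟨_, ?_, .arith m o a x b y c d⟩⟩
  have hb := hB (m.get b y) (hm b (m.idx y))
  have hc := hB (m.get c d) (hm c (m.idx d))
  have hres := hB _ hG
  omega

lemma seq (h : Triple G p m t R) (h' : ∀ m', m'.ValuesIn G → R m' → Triple G q m' t' Q) :
    Triple G (.seq p q) m (t + t') Q := by
  obtain ⟨m', hR, hm', hp⟩ := h
  obtain ⟨m'', hQ, hm'', hq⟩ := h' m' hm' hR
  refine ⟨m'', hQ, hm'', fun ω B hB => ?_⟩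
  obtain ⟨s, hs, hep⟩ := hp ω B hB
  obtain ⟨s', hs', heq⟩ := hq ω B hB
  exact ⟨s + s', by rw [Nat.mul_add]; exact Nat.add_le_add hs hs', .seq hep heq⟩

lemma cond (hm : m.ValuesIn G) {b : Test} (hp : b.Holds m → Triple G p m t Q)
    (hq : ¬ b.Holds m → Triple G q m t Q) : Triple G (.cond b p q) m (t + 1) Q := by
  have hcost {ω : ℝ → ℕ} {B s : ℕ} (hB : ∀ z ∈ G, ω z ≤ B) (hs : s ≤ (1 + 3 * B) * t) :
      b.cost ω m + s ≤ (1 + 3 * B) * (t + 1) := by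
    have := Test.cost_le hm hB b
    rw [Nat.mul_add, Nat.mul_one]
    omega
  by_cases hb : b.Holds m
  · obtain ⟨m', hQ, hm', hexec⟩ := hp hb
    refine ⟨m', hQ, hm', fun ω B hB => ?_⟩
    obtain ⟨s, hs, he⟩ := hexec ω B hB
    exact ⟨_, hcost hB hs, .cond_true hb he⟩
  · obtain ⟨m', hQ, hm', hexec⟩ := hq hb
    refine ⟨m', hQ, hm', fun ω B hB => ?_⟩
    obtain ⟨s, hs, he⟩ := hexec ω B hB
    exact ⟨_, hcost hB hs, .cond_false hb he⟩

/-- A loop with the invariant `J N`, where `N` bounds the number of remaining iterations. -/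
lemma loop {b : Test} (J : ℕ → Store → Prop)
    (hstep : ∀ N m, m.ValuesIn G → J N m → b.Holds m → ∃ N', N = N' + 1 ∧ Triple G p m t (J N'))
    (hend : ∀ N m, m.ValuesIn G → J N m → ¬ b.Holds m → Q m)
    (N : ℕ) (hm : m.ValuesIn G) (h : J N m) : Triple G (.loop b p) m (N * (t + 1) + 1) Q := by
  induction N using Nat.strong_induction_on generalizing m with
  | _ N ih =>
    by_cases hb : b.Holds m
    · obtain ⟨N', rfl, m', hJ, hm', hp⟩ := hstep N m hm h hb
      obtain ⟨m'', hQ, hm'', hloop⟩ := ih N' (Nat.lt_succ_self _) hm' hJ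
      refine ⟨m'', hQ, hm'', fun ω B hB => ?_⟩
      obtain ⟨s, hs, hep⟩ := hp ω B hB
      obtain ⟨s', hs', heloop⟩ := hloop ω B hB
      refine ⟨_, ?_, .loop_true hb hep heloop⟩
      have := Test.cost_le hm hB b
      calc b.cost ω m + s + s' ≤ (1 + 3 * B) + (1 + 3 * B) * t +
            (1 + 3 * B) * (N' * (t + 1) + 1) := by omega
        _ = (1 + 3 * B) * ((N' + 1) * (t + 1) + 1) := by ring
    · refine ⟨m, hend N m hm h hb, hm, fun ω B hB => ⟨_, ?_, .loop_false hb⟩⟩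
      calc b.cost ω m ≤ (1 + 3 * B) * 1 := by simpa using Test.cost_le hm hB b
        _ ≤ _ := Nat.mul_le_mul_left _ (Nat.le_add_left _ _)

/-- A loop that counts `x` up to `n`. The invariant `J i`, where `i` is the value of `x`, need not
mention what the loop does not change. -/
lemma countUp {b : Test} {x i n : ℕ} (J : ℕ → Store → Prop) (hx : x ∉ p.idxWrites)
    (htest : ∀ i m', i ≤ n → m'.idx x = i → (Cmd.seq p (.inc x)).Frame m m' → J i m' →
      (b.Holds m' ↔ i < n))
    (hstep : ∀ i m', i < n → m'.ValuesIn G → m'.idx x = i →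
      (Cmd.seq p (.inc x)).Frame m m' → J i m' →
      Triple G p m' t fun m'' => J (i + 1) (m''.setIdx x (i + 1)))
    (hm : m.ValuesIn G) (hi : m.idx x = i) (hin : i ≤ n) (h : J i m) :
    Triple G (.loop b (.seq p (.inc x))) m ((n - i) * (t + 2) + 1) fun m' =>
      m'.idx x = n ∧ J n m' ∧ (Cmd.seq p (.inc x)).Frame m m' := by
  refine loop (t := t + 1) (fun N m' => m'.idx x ≤ n ∧ N = n - m'.idx x ∧ J (m'.idx x) m' ∧
    (Cmd.seq p (.inc x)).Frame m m') ?_ ?_ (n - i) hm ⟨hi ▸ hin, by rw [hi], hi ▸ h, .refl _ _⟩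
  · rintro _ m' hm' ⟨hle, rfl, hJ, hframe⟩ hb
    have hlt := (htest _ m' hle rfl hframe hJ).1 hb
    refine ⟨n - (m'.idx x + 1), by omega, ?_⟩
    have hbody : Triple G (.seq p (.inc x)) m' (t + 1) fun m'' =>
        m''.idx x = m'.idx x + 1 ∧ J (m'.idx x + 1) m'' := by
      refine (hstep _ m' hlt hm' rfl hframe hJ).frame.seq fun m'' hm'' ⟨hJ', hframe'⟩ => inc hm'' ?_
      rw [hframe'.1 x hx]
      exact ⟨by simp [Store.setIdx], hJ'⟩
    refine hbody.frame.mono le_rfl fun m'' _ ⟨⟨hx', hJ'⟩, hframe'⟩ => ?_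
    rw [hx']
    exact ⟨hlt, rfl, hJ', hframe.trans hframe'⟩
  · rintro _ m' _ ⟨hle, rfl, hJ, hframe⟩ hb
    have hn : m'.idx x = n := by
      have := (htest _ m' hle rfl hframe hJ).not.1 hb
      omega
    exact ⟨hn, hn ▸ hJ, hframe⟩

lemma forLoop {x y i n : ℕ} (J : ℕ → Store → Prop) (hx : x ∉ p.idxWrites)
    (hy : y ∉ (Cmd.seq p (.inc x)).idxWrites)
    (hstep : ∀ i m', i < n → m'.ValuesIn G → m'.idx x = i →
      (Cmd.seq p (.inc x)).Frame m m' → J i m' →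
      Triple G p m' t fun m'' => J (i + 1) (m''.setIdx x (i + 1)))
    (hm : m.ValuesIn G) (hi : m.idx x = i) (hn : m.idx y = n) (hin : i ≤ n) (h : J i m) :
    Triple G (.forLoop x y p) m ((n - i) * (t + 2) + 1) fun m' =>
      m'.idx x = n ∧ J n m' ∧ (Cmd.seq p (.inc x)).Frame m m' :=
  countUp J hx (fun i m' _ hi' hframe _ => by rw [Test.Holds, hi', hframe.1 y hy, hn]) hstep hm hi
    hin h

lemma zero_seq (hm : m.ValuesIn G) {x : ℕ} (h : Triple G q (m.setIdx x 0) t Q) :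
    Triple G (.seq (.zero x) q) m (t + 1) Q :=
  ((zero (Q := (· = _)) hm rfl).seq fun _ _ e => e ▸ h).of_le (Nat.add_comm _ _).le

lemma copy_seq (hm : m.ValuesIn G) {x y : ℕ} (h : Triple G q (m.setIdx x (m.idx y)) t Q) :
    Triple G (.seq (.copy x y) q) m (t + 1) Q :=
  ((copy (Q := (· = _)) hm rfl).seq fun _ _ e => e ▸ h).of_le (Nat.add_comm _ _).le

lemma inc_seq (hm : m.ValuesIn G) {x : ℕ} (h : Triple G q (m.setIdx x (m.idx x + 1)) t Q) :
    Triple G (.seq (.inc x) q) m (t + 1) Q :=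
  ((inc (Q := (· = _)) hm rfl).seq fun _ _ e => e ▸ h).of_le (Nat.add_comm _ _).le

lemma const_seq (hm : m.ValuesIn G) {a x c : ℕ} (hc : (c : ℝ) ∈ G)
    (h : (m.set a x c).ValuesIn G → Triple G q (m.set a x c) t Q) :
    Triple G (.seq (.const a x c) q) m (t + 1) Q :=
  ((const (Q := (· = _)) hm hc rfl).seq fun _ hm' e => e ▸ h (e ▸ hm')).of_le (Nat.add_comm _ _).le

lemma arith_seq (hm : m.ValuesIn G) {o : Arith} {a x b y c d : ℕ} (z : ℝ)
    (hz : o.eval (m.get b y) (m.get c d) = z) (hG : z ∈ G)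
    (h : (m.set a x z).ValuesIn G → Triple G q (m.set a x z) t Q) :
    Triple G (.seq (.arith o a x b y c d) q) m (t + 1) Q :=
  ((arith (Q := (· = _)) hm z hz hG rfl).seq fun _ hm' e => e ▸ h (e ▸ hm')).of_le
    (Nat.add_comm _ _).le

end Triple

end Logic

namespace Inst

/-! ### The numbers that occur -/

/-- The integer combinations of release times and of processing times at the given speeds. All
times that occur in the computation belong to it. -/
def lattice (I : Inst) : AddSubgroup ℝ :=
  AddSubgroup.closure (Set.range I.r ∪ {z | ∃ i, 0 < i ∧ i ≤ I.k ∧ z = 1 / I.speedAt i})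

/-- A bound for all times that occur in the computation. -/
def horizon (I : Inst) : ℝ := ∑ j, I.r j + (I.n + 1) * (1 / I.speedAt 1)

/-- `G` contains all numbers that occur in the computation. -/
structure CoversNumbers (I : Inst) (G : Set ℝ) : Prop where
  input : ∀ a i, I.input.num a i ∈ G
  nat : ∀ c : ℕ, c ≤ I.n + 1 → (c : ℝ) ∈ G
  mul : ∀ i i', I.powerAt i * I.speedAt i' ∈ G
  mul_sub : ∀ i, I.powerAt (i + 1) * I.speedAt i - I.powerAt i * I.speedAt (i + 1) ∈ G
  sub : ∀ i, I.speedAt (i + 1) - I.speedAt i ∈ G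
  shrinkAt : ∀ i, I.shrinkAt i ∈ G
  gain : ∀ (i c : ℕ), c ≤ I.n → (c : ℝ) - I.shrinkAt i ∈ G
  time : ∀ z ∈ I.lattice, |z| ≤ I.horizon → z ∈ G
  inv : ∀ z ∈ I.lattice, 1 / I.speedAt I.k ≤ z → z ≤ 1 / I.speedAt 1 → 1 / z ∈ G

/-- All processing times belong to the lattice. -/
def InLattice (I : Inst) (v : Fin I.n → ℝ) : Prop := ∀ j, 1 / v j ∈ I.lattice

variable {I : Inst} {v : Fin I.n → ℝ} {j : Fin I.n} {G : Set ℝ}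

lemma inv_speedAt_mem_lattice {i : ℕ} (h0 : 0 < i) (hi : i ≤ I.k) :
    1 / I.speedAt i ∈ I.lattice :=
  AddSubgroup.subset_closure (Or.inr ⟨i, h0, hi, rfl⟩)

lemma r_mem_lattice (j : Fin I.n) : I.r j ∈ I.lattice :=
  AddSubgroup.subset_closure (Or.inl ⟨j, rfl⟩)

lemma releaseAt_mem_lattice (i : ℕ) : I.releaseAt i ∈ I.lattice := by
  unfold releaseAt
  split_ifs
  exacts [r_mem_lattice _, I.lattice.zero_mem]

lemma done_mem_lattice (hL : I.InLattice v) (m : ℕ) : I.done v m ∈ I.lattice := by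
  induction m with
  | zero => exact I.lattice.zero_mem
  | succ m ih =>
    unfold done
    split_ifs with h
    · refine I.lattice.add_mem ?_ (hL _)
      rcases max_choice (I.r ⟨m, h⟩) (I.done v m) with hmax | hmax <;> rw [hmax]
      exacts [r_mem_lattice _, ih]
    · exact ih

lemma IsEventBelow.mem_lattice {e : ℕ} {c : ℝ} (hc : I.IsEventBelow v j e c)
    (hL : I.InLattice v) (hk : I.floorIdx (v j) < I.k) : c ∈ I.lattice := by
  rcases hc.eq with rfl | ⟨i, -, -, rfl⟩
  · exact inv_speedAt_mem_lattice (Nat.succ_pos _) hk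
  · exact I.lattice.sub_mem (hL j)
      (I.lattice.sub_mem (done_mem_lattice hL i) (releaseAt_mem_lattice i))

lemma inv_speedAt_one_pos : 0 < 1 / I.speedAt 1 := one_div_pos.2 speedAt_one_pos

lemma InRange.inv_le (hv : I.InRange v) (j : Fin I.n) : 1 / v j ≤ 1 / I.speedAt 1 :=
  one_div_le_one_div_of_le speedAt_one_pos (hv j).1

lemma InRange.le_inv (hv : I.InRange v) (j : Fin I.n) : 1 / I.speedAt I.k ≤ 1 / v j :=
  one_div_le_one_div_of_le (hv.pos j) (hv j).2

lemma releaseAt_le_sum (i : ℕ) : I.releaseAt i ≤ ∑ j, I.r j := by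
  unfold releaseAt
  split_ifs
  · exact Finset.single_le_sum (f := I.r) (fun j _ => I.r_nonneg j) (Finset.mem_univ _)
  · exact Finset.sum_nonneg fun j _ => I.r_nonneg j

lemma InRange.done_le_sum (hv : I.InRange v) (m : ℕ) :
    I.done v m ≤ ∑ j, I.r j + m * (1 / I.speedAt 1) := by
  have hpos := inv_speedAt_one_pos (I := I)
  induction m with
  | zero => simpa [done] using Finset.sum_nonneg fun j _ => I.r_nonneg j
  | succ m ih =>
    unfold done
    push_cast
    split_ifs with h
    · have hstart : max (I.r ⟨m, h⟩) (I.done v m) ≤ ∑ j, I.r j + m * (1 / I.speedAt 1) := by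
        refine max_le ?_ ih
        rw [← releaseAt_val]
        exact (releaseAt_le_sum m).trans (le_add_of_nonneg_right (by positivity))
      linarith [hv.inv_le ⟨m, h⟩]
    · linarith

lemma InRange.done_le_horizon (hv : I.InRange v) {m : ℕ} (hm : m ≤ I.n) :
    I.done v m ≤ I.horizon := by
  have hpos := inv_speedAt_one_pos (I := I)
  have hm' : (m : ℝ) ≤ I.n + 1 := by exact_mod_cast hm.trans I.n.le_succ
  refine (hv.done_le_sum m).trans ?_
  unfold horizon
  gcongr

lemma inv_speedAt_one_add_releaseAt_le_horizon (i : ℕ) :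
    1 / I.speedAt 1 + I.releaseAt i ≤ I.horizon := by
  have hn : (0 : ℝ) ≤ I.n * (1 / I.speedAt 1) :=
    mul_nonneg (Nat.cast_nonneg _) inv_speedAt_one_pos.le
  unfold horizon
  linarith [releaseAt_le_sum (I := I) i]

lemma releaseAt_le_horizon (i : ℕ) : I.releaseAt i ≤ I.horizon := by
  linarith [inv_speedAt_one_add_releaseAt_le_horizon (I := I) i, inv_speedAt_one_pos (I := I)]

lemma inv_speedAt_one_le_horizon : 1 / I.speedAt 1 ≤ I.horizon := by
  linarith [inv_speedAt_one_add_releaseAt_le_horizon (I := I) 0, releaseAt_nonneg (I := I) 0]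

namespace CoversNumbers

lemma done_mem (hG : I.CoversNumbers G) (hv : I.InRange v) (hL : I.InLattice v) {i : ℕ}
    (hi : i ≤ I.n) : I.done v i ∈ G := by
  refine hG.time _ (done_mem_lattice hL i) ?_
  rw [abs_of_nonneg (done_nonneg hv.pos i)]
  exact hv.done_le_horizon hi

lemma done_sub_mem (hG : I.CoversNumbers G) (hv : I.InRange v) (hL : I.InLattice v) {i : ℕ}
    (hi : i ≤ I.n) : I.done v i - I.releaseAt i ∈ G :=
  hG.time _ (I.lattice.sub_mem (done_mem_lattice hL i) (releaseAt_mem_lattice i))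
    (abs_sub_le_of_nonneg_of_le (done_nonneg hv.pos i) (hv.done_le_horizon hi)
      (releaseAt_nonneg i) (releaseAt_le_horizon i))

lemma inv_sub_mem (hG : I.CoversNumbers G) (hv : I.InRange v) (hL : I.InLattice v) (j : Fin I.n)
    {i : ℕ} (hi : i ≤ I.n) : 1 / v j - (I.done v i - I.releaseAt i) ∈ G := by
  refine hG.time _ (I.lattice.sub_mem (hL j) (I.lattice.sub_mem (done_mem_lattice hL i)
    (releaseAt_mem_lattice i))) ?_
  rw [← sub_add, sub_add_eq_add_sub]
  exact abs_sub_le_of_nonneg_of_le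
    (add_nonneg (one_div_pos.2 (hv.pos j)).le (releaseAt_nonneg i))
    ((add_le_add_left (hv.inv_le j) _).trans (inv_speedAt_one_add_releaseAt_le_horizon i))
    (done_nonneg hv.pos i) (hv.done_le_horizon hi)

lemma inv_speedAt_mem (hG : I.CoversNumbers G) {i : ℕ} (h0 : 0 < i) (hi : i ≤ I.k) :
    1 / I.speedAt i ∈ G := by
  have hpos := one_div_pos.2 (speedAt_pos h0 hi)
  refine hG.time _ (inv_speedAt_mem_lattice h0 hi) ?_
  rw [abs_of_pos hpos]
  exact (one_div_le_one_div_of_le speedAt_one_pos (speedAt_le h0 hi)).trans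
    inv_speedAt_one_le_horizon

end CoversNumbers

end Inst

/-! ### The program

The counters and arrays in use, named by what they hold. An array that holds a single number holds
it at address `0`, the value of the counter `cZero`. -/

abbrev cN : ℕ := 0
abbrev cK : ℕ := 1
abbrev cZero : ℕ := 2
abbrev cLevel : ℕ := 3
abbrev cNext : ℕ := 4
abbrev cJob : ℕ := 5
abbrev cBest : ℕ := 6
abbrev cVisit : ℕ := 7
abbrev cActive : ℕ := 8
abbrev cOne : ℕ := 9

abbrev aRelease : ℕ := 0
abbrev aSpeed : ℕ := 1
abbrev aPower : ℕ := 2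
abbrev aTime : ℕ := 3
abbrev aDone : ℕ := 4
abbrev aInv : ℕ := 5
abbrev aShrink : ℕ := 6
abbrev aZero : ℕ := 7
abbrev aOne : ℕ := 8
abbrev aGain : ℕ := 9
abbrev aEvent : ℕ := 10
abbrev aTmp : ℕ := 11
abbrev aBestGain : ℕ := 12
abbrev aBestEvent : ℕ := 13
abbrev aAux : ℕ := 14

/-- Copies a number, by adding zero. -/
abbrev Cmd.move (a x b y : ℕ) : Cmd := .arith .add a x b y aZero cZero

namespace Inst

/-- Finds the level of the job `cJob`. -/
def findLevel : Cmd :=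
  .seq (.copy cLevel cK) <| .loop (.numLt aInv cLevel aTime cJob) (.dec cLevel)

/-- Gain and next event of the job `cJob`, as if no other job were affected by it. -/
def startJob : Cmd :=
  .seq findLevel <| .seq (.copy cNext cLevel) <| .seq (.inc cNext) <|
  .seq (.arith .sub aGain cZero aOne cZero aShrink cLevel) <|
  .seq (.move aEvent cZero aInv cNext) <| .seq (.copy cVisit cJob) (.inc cVisit)

/-- Updates gain and next event of the job `cJob` by the affected job `cVisit`. -/
def visitJob : Cmd :=
  .seq (.arith .add aGain cZero aGain cZero aOne cZero) <|
  .seq (.arith .sub aTmp cZero aDone cVisit aRelease cVisit) <|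
  .seq (.arith .sub aTmp cZero aTime cJob aTmp cZero) <|
  .cond (.numLt aEvent cZero aTmp cZero) (.move aEvent cZero aTmp cZero) .skip

/-- Computes gain and next event of the job `cJob`. -/
def evalJob : Cmd :=
  .seq startJob <|
  .loop (.numLt aRelease cVisit aDone cVisit) (.seq visitJob (.inc cVisit))

/-- Computes the completion time of the job `cJob` from the one of its predecessor. -/
def doneJob : Cmd :=
  .seq (.copy cNext cJob) <| .seq (.inc cNext) <|
  .cond (.numLt aDone cJob aRelease cJob) (.arith .add aDone cNext aRelease cJob aTime cJob)
    (.arith .add aDone cNext aDone cJob aTime cJob)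

/-- Computes the completion times. The last one is put behind the release times, as a sentinel that
ends every visit of affected jobs. -/
def computeDone : Cmd :=
  .seq (.zero cJob) <| .seq (.forLoop cJob cN doneJob) (.move aRelease cJob aDone cJob)

/-- Selects the job `cJob`. -/
def selectJob : Cmd :=
  .seq (.copy cBest cJob) <| .seq (.move aBestGain cZero aGain cZero)
    (.move aBestEvent cZero aEvent cZero)

/-- Selects the job `cJob` if its gain is larger than the one of the selected job. -/
def compareJob : Cmd :=
  .seq evalJob <| .cond (.numLt aBestGain cZero aGain cZero) selectJob .skip

/-- Selects a job of maximum gain; another one than before only if it has a larger gain. -/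
def select : Cmd :=
  .seq computeDone <| .seq (.copy cJob cBest) <| .seq evalJob <| .seq selectJob <|
  .seq (.zero cJob) (.forLoop cJob cN compareJob)

/-- Speeds up the selected job. -/
def raiseBest : Cmd := .move aTime cBest aBestEvent cZero

/-- Speeds up the selected job if its gain is active, and otherwise halts. -/
def decideStep : Rule → Cmd
  | .positive => .cond (.numLt aZero cZero aBestGain cZero) raiseBest (.zero cActive)
  | .nonneg => .cond (.numLt aBestGain cZero aZero cZero) (.zero cActive) raiseBest

/-- Computes inverse speed and shrinking energy of the level `cLevel`. -/
def setupLevel : Cmd :=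
  .seq (.copy cNext cLevel) <| .seq (.inc cNext) <|
  .seq (.arith .div aInv cLevel aOne cZero aSpeed cLevel) <|
  .seq (.arith .mul aTmp cZero aPower cNext aSpeed cLevel) <|
  .seq (.arith .mul aAux cZero aPower cLevel aSpeed cNext) <|
  .seq (.arith .sub aTmp cZero aTmp cZero aAux cZero) <|
  .seq (.arith .sub aAux cZero aSpeed cNext aSpeed cLevel) <|
  .arith .div aShrink cLevel aTmp cZero aAux cZero

/-- Computes the inverse of the highest speed, which is the speed of the level `cLevel`, and the
number `n + 1` that stands for the infinite shrinking energy of this level. -/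
def setupTop : Cmd :=
  .seq (.arith .div aInv cLevel aOne cZero aSpeed cLevel) <| .seq (.const aShrink cLevel 1) <|
  .seq (.zero cJob) <|
  .forLoop cJob cN (.arith .add aShrink cLevel aShrink cLevel aOne cZero)

/-- Gives all jobs the lowest speed. -/
def setupTimes : Cmd :=
  .seq (.zero cOne) <| .seq (.inc cOne) <| .seq (.zero cJob) <|
  .forLoop cJob cN (.move aTime cJob aInv cOne)

/-- Computes the constants that do not depend on the speeds, and initializes the speeds. -/
def setup : Cmd :=
  .seq (.const aOne cZero 1) <| .seq (.zero cLevel) <| .seq (.inc cLevel) <|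
  .seq (.forLoop cLevel cK setupLevel) <| .seq setupTop setupTimes

/-- Replaces the processing times by the speeds. -/
def output : Cmd :=
  .seq (.zero cJob) <| .forLoop cJob cN (.arith .div aTime cJob aOne cZero aTime cJob)

/-- The whole program. -/
def program (ρ : Rule) : Cmd :=
  .cond (.idxLt cZero cN)
    (.seq setup <| .seq (.zero cActive) <| .seq (.inc cActive) <| .seq (.zero cBest) <|
      .seq (.loop (.idxLt cZero cActive) (.seq select (decideStep ρ))) output)
    .skip

/-! ### Stores during the computation -/

/-- The store holds the instance, the derived constants and the processing times for `v`. -/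
structure BaseStore (I : Inst) (v : Fin I.n → ℝ) (m : Store) : Prop where
  idx_n : m.idx cN = I.n
  idx_k : m.idx cK = I.k
  idx_zero : m.idx cZero = 0
  release : ∀ i < I.n, m.num aRelease i = I.releaseAt i
  time : ∀ j : Fin I.n, m.num aTime j = 1 / v j
  done_zero : m.num aDone 0 = 0
  /-- At `i = k + 1` this is `1 / 0 = 0`, which is below all processing times. -/
  inv : ∀ i ≤ I.k + 1, m.num aInv i = 1 / I.speedAt i
  shrink : ∀ i, 0 < i → i ≤ I.k → m.num aShrink i = I.shrinkAt i
  zero : m.num aZero 0 = 0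
  one : m.num aOne 0 = 1

/-- The store also holds the completion times and the sentinel. -/
structure LoadedStore (I : Inst) (v : Fin I.n → ℝ) (m : Store) : Prop extends I.BaseStore v m where
  done : ∀ i ≤ I.n, m.num aDone i = I.done v i
  sentinel : m.num aRelease I.n = I.done v I.n

section Spec

variable {I : Inst} {v : Fin I.n → ℝ} {j : Fin I.n} {G : Set ℝ} {p : Cmd} {m m' : Store}

lemma BaseStore.congr (h : I.BaseStore v m) (hidx : ∀ x < 3, m'.idx x = m.idx x)
    (hnum : ∀ a < 9, m'.num a = m.num a) : I.BaseStore v m' where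
  idx_n := (hidx cN (by decide)).trans h.idx_n
  idx_k := (hidx cK (by decide)).trans h.idx_k
  idx_zero := (hidx cZero (by decide)).trans h.idx_zero
  release := hnum aRelease (by decide) ▸ h.release
  time := hnum aTime (by decide) ▸ h.time
  done_zero := hnum aDone (by decide) ▸ h.done_zero
  inv := hnum aInv (by decide) ▸ h.inv
  shrink := hnum aShrink (by decide) ▸ h.shrink
  zero := hnum aZero (by decide) ▸ h.zero
  one := hnum aOne (by decide) ▸ h.one

lemma BaseStore.setIdx (h : I.BaseStore v m) {x : ℕ} (hx : 3 ≤ x) (i : ℕ) :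
    I.BaseStore v (m.setIdx x i) :=
  h.congr (fun _ hy => Function.update_of_ne (hy.trans_le hx).ne _ _) fun _ _ => rfl

namespace LoadedStore

lemma congr (h : I.LoadedStore v m) (hidx : ∀ x < 3, m'.idx x = m.idx x)
    (hnum : ∀ a < 9, m'.num a = m.num a) : I.LoadedStore v m' where
  toBaseStore := h.toBaseStore.congr hidx hnum
  done := hnum aDone (by decide) ▸ h.done
  sentinel := hnum aRelease (by decide) ▸ h.sentinel

lemma of_frame (h : I.LoadedStore v m) (hframe : p.Frame m m')
    (hidx : ∀ x < 3, x ∉ p.idxWrites := by decide)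
    (hnum : ∀ a < 9, a ∉ p.numWrites := by decide) : I.LoadedStore v m' :=
  h.congr (fun x hx => hframe.1 x (hidx x hx)) fun a ha => hframe.2 a (hnum a ha)

lemma setIdx (h : I.LoadedStore v m) {x : ℕ} (hx : 3 ≤ x) (i : ℕ) :
    I.LoadedStore v (m.setIdx x i) :=
  h.congr (fun _ hy => Function.update_of_ne (hy.trans_le hx).ne _ _) fun _ _ => rfl

lemma linked_iff (h : I.LoadedStore v m) {e : ℕ} (he : e ≤ I.n) :
    m.num aRelease e < m.num aDone e ↔ I.Linked v e := by
  rw [h.done e he]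
  rcases he.eq_or_lt with rfl | he'
  · rw [h.sentinel]
    exact iff_of_false (lt_irrefl _) not_linked_n
  · rw [h.release e he']
    exact ⟨fun hlt => ⟨he', hlt⟩, fun hl => hl.2⟩

end LoadedStore

lemma findLevel_triple (hm : m.ValuesIn G) (hb : I.BaseStore v m) (hv : I.InRange v)
    (hj : m.idx cJob = j) :
    Triple G findLevel m (2 * I.k + 2) (· = m.setIdx cLevel (I.floorIdx (v j))) := by
  have hfloor : 0 < I.floorIdx (v j) := floorIdx_pos (hv j).1
  have htest : ∀ i ≤ I.k, (Test.numLt aInv cLevel aTime cJob).Holds (m.setIdx cLevel i) ↔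
      1 / I.speedAt i < 1 / v j := fun i hi => by
    simp [Test.Holds, Store.get, Store.setIdx, hj, hb.inv i (by omega), hb.time]
  refine Triple.of_le (Triple.copy_seq hm ?_) (show I.k * (1 + 1) + 1 + 1 ≤ _ by omega)
  refine Triple.loop (fun N m' => m' = m.setIdx cLevel N ∧ I.floorIdx (v j) ≤ N ∧ N ≤ I.k) ?_ ?_
    I.k (hm.setIdx _ _) ⟨by rw [hb.idx_k], floorIdx_le _, le_rfl⟩
  · rintro N _ hm' ⟨rfl, hle, hN⟩ hlt
    have hne : I.floorIdx (v j) ≠ N := by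
      rintro rfl
      exact (one_div_le_one_div_of_le (speedAt_pos hfloor (floorIdx_le _))
        (speedAt_floorIdx_le (hv.pos j).le)).not_gt ((htest _ hN).1 hlt)
    obtain ⟨N, rfl⟩ : ∃ N', N = N' + 1 := ⟨N - 1, by omega⟩
    exact ⟨N, rfl, Triple.dec hm' ⟨by simp [Store.setIdx], by omega, by omega⟩⟩
  · rintro N _ hm' ⟨rfl, hle, hN⟩ hlt
    rw [htest _ hN, not_lt, one_div_le_one_div (hv.pos j) (speedAt_pos (by omega) hN),
      ← le_floorIdx_iff (hv.pos j).le hN] at hlt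
    rw [hlt.antisymm hle]

end Spec

end Inst

namespace Inst

section Spec

variable {I : Inst} {v : Fin I.n → ℝ} {j : Fin I.n} {G : Set ℝ} {m : Store} {e : ℕ}

/-! ### Evaluating a job -/

/-- The store holds gain and next event of job `j` in so far as they depend on the jobs
below `e`. -/
structure Evaluated (I : Inst) (v : Fin I.n → ℝ) (j : Fin I.n) (e : ℕ) (m : Store) : Prop where
  gain : m.num aGain 0 = e - j - I.shrinkAt (I.floorIdx (v j))
  event : I.IsEventBelow v j e (m.num aEvent 0)

lemma startJob_triple (hG : I.CoversNumbers G) (hm : m.ValuesIn G) (hl : I.LoadedStore v m)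
    (hv : I.InRange v) (hj : m.idx cJob = j) :
    Triple G startJob m (2 * I.k + 8) fun m' =>
      m'.idx cVisit = j + 1 ∧ I.Evaluated v j (j + 1) m' := by
  have hfloor : 0 < I.floorIdx (v j) := floorIdx_pos (hv j).1
  have hle := floorIdx_le (I := I) (v j)
  have hinv := hl.inv (I.floorIdx (v j) + 1) (by omega)
  refine Triple.of_le ((findLevel_triple hm hl.toBaseStore hv hj).seq ?_)
    (show 2 * I.k + 2 + 6 ≤ _ by omega)
  rintro _ hm' rfl
  refine Triple.copy_seq hm' (Triple.inc_seq (hm'.setIdx _ _) ?_)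
  refine Triple.arith_seq ((hm'.setIdx _ _).setIdx _ _) (1 - I.shrinkAt (I.floorIdx (v j))) ?_ ?_
    fun hm1 => ?_
  · simp [Arith.eval, Store.get, Store.setIdx, hl.idx_zero, hl.one, hl.shrink _ hfloor hle]
  · exact_mod_cast hG.gain (I.floorIdx (v j)) 1 j.pos
  refine Triple.arith_seq hm1 (1 / I.speedAt (I.floorIdx (v j) + 1)) ?_ (hinv ▸ hm _ _)
    fun hm2 => ?_
  · simp [Arith.eval, Store.get, Store.setIdx, Store.set, hl.idx_zero, hl.zero, hinv]
  refine Triple.copy_seq hm2 (Triple.inc (hm2.setIdx _ _) ⟨?_, ?_, ?_⟩)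
  · simp [Store.setIdx, Store.set, hj]
  · simp [Store.setIdx, Store.set, hl.idx_zero]
  · simpa [Store.setIdx, Store.set, hl.idx_zero] using IsEventBelow.init v j

lemma visitJob_triple (hG : I.CoversNumbers G) (hm : m.ValuesIn G) (hl : I.LoadedStore v m)
    (hv : I.InRange v) (hL : I.InLattice v) (hj : m.idx cJob = j) (he : m.idx cVisit = e)
    (hje : j.val < e) (hen : e < I.n) (h : I.Evaluated v j e m) :
    Triple G visitJob m 5 (I.Evaluated v j (e + 1)) := by
  have hidx := hl.idx_zero
  have hlink := hG.inv_sub_mem hv hL j hen.le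
  refine Triple.arith_seq hm ((e : ℝ) + 1 - j - I.shrinkAt (I.floorIdx (v j))) ?_ ?_ fun hm1 => ?_
  · simp only [Arith.eval, Store.get, hidx, hl.one, h.gain]
    ring
  · have hgain := hG.gain (I.floorIdx (v j)) (e + 1 - j) (by omega)
    rwa [Nat.cast_sub (by omega), Nat.cast_succ] at hgain
  refine Triple.arith_seq hm1 (I.done v e - I.releaseAt e) ?_ (hG.done_sub_mem hv hL hen.le)
    fun hm2 => ?_
  · simp [Arith.eval, Store.get, Store.set, he, hl.done _ hen.le, hl.release _ hen]
  refine Triple.arith_seq hm2 (1 / v j - (I.done v e - I.releaseAt e)) ?_ hlink fun hm3 => ?_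
  · simp [Arith.eval, Store.get, Store.set, hidx, hj, hl.time]
  have hevent := h.event.succ hje
  refine Triple.cond (t := 1) hm3 (fun hlt => ?_) fun hlt => ?_
  · have hmax : m.num aEvent 0 < 1 / v j - (I.done v e - I.releaseAt e) := by
      simpa [Test.Holds, Store.get, Store.set, hidx] using hlt
    rw [max_eq_right hmax.le] at hevent
    refine Triple.arith hm3 (1 / v j - (I.done v e - I.releaseAt e)) ?_ hlink ⟨?_, ?_⟩
    · simp [Arith.eval, Store.get, Store.set, hidx, hl.zero]
    · simp [Store.set, hidx]
    · simpa [Store.set, hidx] using hevent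
  · have hmax : 1 / v j - (I.done v e - I.releaseAt e) ≤ m.num aEvent 0 := by
      simpa [Test.Holds, Store.get, Store.set, hidx] using hlt
    rw [max_eq_left hmax] at hevent
    refine Triple.skip hm3 ⟨?_, ?_⟩
    · simp [Store.set, hidx]
    · simpa [Store.set, hidx] using hevent

lemma Evaluated.realGain (h : I.Evaluated v j (I.chainEnd v j) m) :
    m.num aGain 0 = I.realGain v j := h.gain

lemma evalJob_triple (hG : I.CoversNumbers G) (hm : m.ValuesIn G) (hl : I.LoadedStore v m)
    (hv : I.InRange v) (hL : I.InLattice v) (hj : m.idx cJob = j) :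
    Triple G evalJob m (7 * I.n + 2 * I.k + 9) (I.Evaluated v j (I.chainEnd v j)) := by
  have hend := chainEnd_le (v := v) j.isLt
  refine Triple.of_le ((startJob_triple hG hm hl hv hj).frame.seq ?_)
    (show 2 * I.k + 8 + ((I.chainEnd v j - (j + 1)) * (5 + 2) + 1) ≤ _ by omega)
  rintro m₁ hm₁ ⟨⟨hvisit, heval⟩, hframe₁⟩
  have hl₁ : I.LoadedStore v m₁ := hl.of_frame hframe₁
  have hj₁ : m₁.idx cJob = j := (hframe₁.1 cJob (by decide)).trans hj
  refine (Triple.countUp (fun e m' => j.val < e ∧ I.Evaluated v j e m') (by decide) ?_ ?_ hm₁ hvisit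
    (lt_chainEnd j.isLt) ⟨j.val.lt_succ_self, by exact_mod_cast heval⟩).mono le_rfl
    fun m' _ h => h.2.1.2
  · rintro e m' he rfl hframe ⟨hje, -⟩
    have hl' : I.LoadedStore v m' := hl₁.of_frame hframe
    exact (hl'.linked_iff (he.trans hend)).trans ⟨fun hlinked => he.lt_of_ne fun heq =>
      not_linked_chainEnd j.isLt (heq ▸ hlinked), of_lt_firstFail hje⟩
  · rintro e m' he hm' hvisit' hframe ⟨hje, heval'⟩
    have hl' : I.LoadedStore v m' := hl₁.of_frame hframe
    exact (visitJob_triple hG hm' hl' hv hL ((hframe.1 cJob (by decide)).trans hj₁) hvisit' hje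
      (he.trans_le hend) heval').mono le_rfl fun m'' _ h => ⟨by omega, h.gain, h.event⟩

/-! ### Computing the completion times -/

lemma BaseStore.of_frame {p : Cmd} {m' : Store} (h : I.BaseStore v m) (hframe : p.Frame m m')
    (hrelease : ∀ i < I.n, m'.num aRelease i = I.releaseAt i) (hdone : m'.num aDone 0 = 0)
    (hidx : ∀ x < 3, x ∉ p.idxWrites := by decide)
    (hnum : ∀ a ∈ [aTime, aInv, aShrink, aZero, aOne], a ∉ p.numWrites := by decide) :
    I.BaseStore v m' where
  idx_n := (hframe.1 cN (hidx _ (by decide))).trans h.idx_n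
  idx_k := (hframe.1 cK (hidx _ (by decide))).trans h.idx_k
  idx_zero := (hframe.1 cZero (hidx _ (by decide))).trans h.idx_zero
  release := hrelease
  time := hframe.2 aTime (hnum _ (by decide)) ▸ h.time
  done_zero := hdone
  inv := hframe.2 aInv (hnum _ (by decide)) ▸ h.inv
  shrink := hframe.2 aShrink (hnum _ (by decide)) ▸ h.shrink
  zero := hframe.2 aZero (hnum _ (by decide)) ▸ h.zero
  one := hframe.2 aOne (hnum _ (by decide)) ▸ h.one

lemma doneJob_triple (hG : I.CoversNumbers G) (hm : m.ValuesIn G) (hb : I.BaseStore v m)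
    (hv : I.InRange v) (hL : I.InLattice v) (hj : m.idx cJob = j)
    (hdone : ∀ i ≤ j.val, m.num aDone i = I.done v i) :
    Triple G doneJob m 4 fun m' => ∀ i ≤ j.val + 1, m'.num aDone i = I.done v i := by
  have hmem := hG.done_mem hv hL j.isLt
  have hm' := (hm.setIdx cNext (m.idx cJob)).setIdx cNext (m.idx cJob + 1)
  have hwrite : ∀ i ≤ j.val + 1, (((m.setIdx cNext (m.idx cJob)).setIdx cNext
      (m.idx cJob + 1)).set aDone cNext (I.done v (j + 1))).num aDone i = I.done v i := by
    intro i hi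
    rcases hi.eq_or_lt with rfl | hi
    · simp [Store.set, Store.setIdx, hj]
    · simp [Store.set, Store.setIdx, hj, hi.ne, hdone i (by omega)]
  refine Triple.copy_seq hm (Triple.inc_seq (hm.setIdx _ _) (Triple.cond (t := 1) hm' ?_ ?_))
  · intro hlt
    refine Triple.arith hm' (I.done v (j + 1)) ?_ hmem hwrite
    have hlt' : I.done v j < I.releaseAt j := by
      simpa [Test.Holds, Store.get, Store.setIdx, hj, hdone, hb.release] using hlt
    rw [done_succ, ← releaseAt_val, max_eq_left hlt'.le]
    simp [Arith.eval, Store.get, Store.setIdx, hj, hb.time, hb.release]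
  · intro hlt
    refine Triple.arith hm' (I.done v (j + 1)) ?_ hmem hwrite
    have hle : I.releaseAt j ≤ I.done v j := by
      simpa [Test.Holds, Store.get, Store.setIdx, hj, hdone, hb.release] using hlt
    rw [done_succ, ← releaseAt_val, max_eq_right hle]
    simp [Arith.eval, Store.get, Store.setIdx, hj, hb.time, hdone]

lemma computeDone_triple (hG : I.CoversNumbers G) (hm : m.ValuesIn G) (hb : I.BaseStore v m)
    (hv : I.InRange v) (hL : I.InLattice v) :
    Triple G computeDone m (6 * I.n + 3) (I.LoadedStore v) := by
  have hb₀ : I.BaseStore v (m.setIdx cJob 0) := hb.setIdx (by decide) 0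
  have hloop : Triple G (.forLoop cJob cN doneJob) (m.setIdx cJob 0) ((I.n - 0) * (4 + 2) + 1)
      fun m' => m'.idx cJob = I.n ∧ (∀ i ≤ I.n, m'.num aDone i = I.done v i) ∧
        (Cmd.seq doneJob (.inc cJob)).Frame (m.setIdx cJob 0) m' := by
    refine Triple.forLoop (fun i m' => ∀ e ≤ i, m'.num aDone e = I.done v e) (by decide) (by decide)
      ?_ (hm.setIdx _ _) (by simp [Store.setIdx]) (by simp [Store.setIdx, hb.idx_n]) (Nat.zero_le _)
      ?_
    · intro i m' hi hm' hj hframe hdone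
      have hb' : I.BaseStore v m' := hb₀.of_frame hframe
        (hframe.2 aRelease (by decide) ▸ hb.release) (hdone 0 (Nat.zero_le _))
      exact doneJob_triple hG hm' hb' hv hL (j := ⟨i, hi⟩) hj hdone
    · rintro e he
      rw [Nat.le_zero.1 he]
      exact hb.done_zero
  refine Triple.of_le (Triple.zero_seq hm (hloop.seq (t' := 1) ?_)) (by omega)
  rintro m' hm' ⟨hj, hdone, hframe⟩
  have hrelease : ∀ i < I.n, m'.num aRelease i = I.releaseAt i :=
    hframe.2 aRelease (by decide) ▸ hb.release
  have hb' : I.BaseStore v m' := hb₀.of_frame hframe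
    hrelease (hdone 0 (Nat.zero_le _))
  refine Triple.arith hm' (I.done v I.n) ?_ (hG.done_mem hv hL le_rfl) ?_
  · simp [Arith.eval, Store.get, hj, hdone, hb'.idx_zero, hb'.zero]
  · refine ⟨⟨hb'.idx_n, hb'.idx_k, hb'.idx_zero, fun i hi => ?_, hb'.time, hb'.done_zero, hb'.inv,
      hb'.shrink, hb'.zero, hb'.one⟩, hdone, ?_⟩
    · simp [Store.set, hj, hi.ne, hrelease i hi]
    · simp [Store.set, hj]

end Spec

end Inst

namespace Inst

section Spec

variable {I : Inst} {ρ : Rule} {v : Fin I.n → ℝ} {j b b' b'' : Fin I.n} {G : Set ℝ} {m : Store}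

/-! ### Selecting a job -/

/-- The store holds the job `b` as the selected one, with its gain and its next event. -/
structure Selected (I : Inst) (v : Fin I.n → ℝ) (b : Fin I.n) (m : Store) : Prop where
  best : m.idx cBest = b
  gain : m.num aBestGain 0 = I.realGain v b
  event : I.IsNextEvent v b (m.num aBestEvent 0)

lemma Selected.of_frame {p : Cmd} {m' : Store} (h : I.Selected v b m) (hframe : p.Frame m m')
    (hidx : cBest ∉ p.idxWrites := by decide)
    (hnum : ∀ a ∈ [aBestGain, aBestEvent], a ∉ p.numWrites := by decide) : I.Selected v b m' where
  best := (hframe.1 cBest hidx).trans h.best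
  gain := hframe.2 aBestGain (hnum _ (by decide)) ▸ h.gain
  event := hframe.2 aBestEvent (hnum _ (by decide)) ▸ h.event

/-- The job `b'` may be selected after the job `b`: it is the same one or has a larger gain. -/
def Supersedes (I : Inst) (v : Fin I.n → ℝ) (b' b : Fin I.n) : Prop :=
  b' = b ∨ I.realGain v b < I.realGain v b'

lemma Supersedes.trans (h' : I.Supersedes v b'' b') (h : I.Supersedes v b' b) :
    I.Supersedes v b'' b := by
  rcases h' with rfl | h'
  · exact h
  · rcases h with rfl | h
    exacts [.inr h', .inr (h.trans h')]

lemma Supersedes.le (h : I.Supersedes v b' b) : I.realGain v b ≤ I.realGain v b' := by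
  rcases h with rfl | h
  exacts [le_rfl, h.le]

lemma selectJob_triple (hm : m.ValuesIn G) (hb : I.BaseStore v m) (hj : m.idx cJob = j)
    (h : I.Evaluated v j (I.chainEnd v j) m) : Triple G selectJob m 3 (I.Selected v j) := by
  refine Triple.copy_seq hm (Triple.arith_seq (hm.setIdx _ _) (I.realGain v j) ?_
    (h.realGain ▸ hm _ _) fun hm' => Triple.arith hm' (m.num aEvent 0) ?_ (hm _ _) ⟨?_, ?_, ?_⟩)
  · simp [Arith.eval, Store.get, Store.setIdx, hb.idx_zero, hb.zero, h.realGain]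
  · simp [Arith.eval, Store.get, Store.setIdx, Store.set, hb.idx_zero, hb.zero]
  · simp [Store.setIdx, Store.set, hj]
  · simp [Store.setIdx, Store.set, hb.idx_zero]
  · simpa [Store.setIdx, Store.set, hb.idx_zero] using h.event

/-- The steps of `evalJob`. -/
def evalCost (I : Inst) : ℕ := 7 * I.n + 2 * I.k + 9

lemma compareJob_triple (hG : I.CoversNumbers G) (hm : m.ValuesIn G) (hl : I.LoadedStore v m)
    (hv : I.InRange v) (hL : I.InLattice v) (hj : m.idx cJob = j) (hb : I.Selected v b m) :
    Triple G compareJob m (I.evalCost + 4) fun m' =>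
      ∃ b', I.Selected v b' m' ∧ I.Supersedes v b' b ∧ I.realGain v j ≤ I.realGain v b' := by
  refine (evalJob_triple hG hm hl hv hL hj).frame.seq (t' := 3 + 1) ?_
  rintro m' hm' ⟨heval, hframe⟩
  have hl' : I.LoadedStore v m' := hl.of_frame hframe
  have hb' : I.Selected v b m' := hb.of_frame hframe
  have hj' : m'.idx cJob = j := (hframe.1 cJob (by decide)).trans hj
  have htest : (Test.numLt aBestGain cZero aGain cZero).Holds m' ↔
      I.realGain v b < I.realGain v j := by
    simp [Test.Holds, Store.get, hl'.idx_zero, hb'.gain, heval.realGain]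
  refine Triple.cond hm' (fun hlt => ?_) fun hle => ?_
  · exact (selectJob_triple hm' hl'.toBaseStore hj' heval).mono le_rfl fun _ _ hsel =>
      ⟨j, hsel, .inr (htest.1 hlt), le_rfl⟩
  · exact (Triple.skip hm' ⟨b, hb', .inl rfl, not_lt.1 (htest.not.1 hle)⟩).of_le (by decide)

lemma compareJobs_triple (hG : I.CoversNumbers G) (hm : m.ValuesIn G) (hl : I.LoadedStore v m)
    (hv : I.InRange v) (hL : I.InLattice v) (hj : m.idx cJob = 0) (hb : I.Selected v b m) :
    Triple G (.forLoop cJob cN compareJob) m (I.n * (I.evalCost + 6) + 1) fun m' =>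
      ∃ b', I.Selected v b' m' ∧ I.Supersedes v b' b ∧ ∀ j, I.realGain v j ≤ I.realGain v b' := by
  refine (Triple.forLoop (fun i m' => ∃ b', I.Selected v b' m' ∧ I.Supersedes v b' b ∧
    ∀ j : Fin I.n, j.val < i → I.realGain v j ≤ I.realGain v b') (by decide) (by decide) ?_ hm hj
    hl.idx_n (Nat.zero_le _) ⟨b, hb, .inl rfl, fun _ h => absurd h (Nat.not_lt_zero _)⟩).mono le_rfl
    fun _ _ ⟨_, ⟨b', hsel, hsup, hmax⟩, _⟩ => ⟨b', hsel, hsup, fun j => hmax j j.isLt⟩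
  rintro i m' hi hm' hj' hframe ⟨b', hsel, hsup, hmax⟩
  have hl' : I.LoadedStore v m' := hl.of_frame hframe
  refine (compareJob_triple hG hm' hl' hv hL (j := ⟨i, hi⟩) hj' hsel).mono le_rfl ?_
  rintro m'' - ⟨b'', hsel', hsup', hle⟩
  refine ⟨b'', ⟨hsel'.best, hsel'.gain, hsel'.event⟩, hsup'.trans hsup, fun j hj => ?_⟩
  rcases (Nat.le_of_lt_succ hj).eq_or_lt with hji | hji
  · exact (Fin.ext hji : j = ⟨i, hi⟩) ▸ hle
  · exact (hmax j hji).trans hsup'.le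

/-- The steps of `select`. -/
def selectCost (I : Inst) : ℕ :=
  6 * I.n + 3 + (I.evalCost + (3 + (I.n * (I.evalCost + 6) + 1 + 1)) + 1)

lemma select_triple (hG : I.CoversNumbers G) (hm : m.ValuesIn G) (hb : I.BaseStore v m)
    (hv : I.InRange v) (hL : I.InLattice v) (hbest : m.idx cBest = b) :
    Triple G select m I.selectCost fun m' => I.BaseStore v m' ∧
      ∃ b', I.Selected v b' m' ∧ I.Supersedes v b' b ∧ ∀ j, I.realGain v j ≤ I.realGain v b' := by
  refine (computeDone_triple hG hm hb hv hL).frame.seq ?_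
  rintro m₁ hm₁ ⟨hl₁, hframe₁⟩
  have hj₁ : (m₁.setIdx cJob (m₁.idx cBest)).idx cJob = b := by
    rw [Store.setIdx_idx_self, hframe₁.1 cBest (by decide), hbest]
  have hl₁' : I.LoadedStore v (m₁.setIdx cJob (m₁.idx cBest)) := hl₁.setIdx (by decide) _
  refine Triple.copy_seq hm₁ ((evalJob_triple hG (hm₁.setIdx _ _) hl₁' hv hL hj₁).frame.seq ?_)
  rintro m₂ hm₂ ⟨heval, hframe₂⟩
  have hl₂ : I.LoadedStore v m₂ := hl₁'.of_frame hframe₂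
  have hj₂ : m₂.idx cJob = b := (hframe₂.1 cJob (by decide)).trans hj₁
  refine (selectJob_triple hm₂ hl₂.toBaseStore hj₂ heval).frame.seq ?_
  rintro m₃ hm₃ ⟨hsel, hframe₃⟩
  have hl₃ : I.LoadedStore v (m₃.setIdx cJob 0) := (hl₂.of_frame hframe₃).setIdx (by decide) _
  refine Triple.zero_seq hm₃ ((compareJobs_triple hG (hm₃.setIdx _ _) hl₃ hv hL
    (Store.setIdx_idx_self _ _ _) ⟨hsel.best, hsel.gain, hsel.event⟩).frame.mono le_rfl ?_)
  exact fun m' _ ⟨h, hframe₄⟩ => ⟨(hl₃.of_frame hframe₄).toBaseStore, h⟩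

/-! ### The main loop -/

/-- The computation is searching for a job to speed up, with the selected job `b`, and at most `N`
further events can occur. -/
structure Searching (I : Inst) (ρ : Rule) (v : Fin I.n → ℝ) (b : Fin I.n) (N : ℕ) (m : Store) :
    Prop where
  base : I.BaseStore v m
  inLattice : I.InLattice v
  active : m.idx cActive = 1
  best : m.idx cBest = b
  midway : I.Midway ρ v b
  bound : I.n * I.k + I.n + 1 ≤ N + I.events v

/-- The computation has found the final speeds `v`. -/
structure Finished (I : Inst) (ρ : Rule) (v : Fin I.n → ℝ) (m : Store) : Prop where
  base : I.BaseStore v m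
  inLattice : I.InLattice v
  active : m.idx cActive = 0
  run : ∃ M, I.Run ρ M v
  halted : I.Halted ρ v

/-- The invariant of the main loop. -/
def MainInv (I : Inst) (ρ : Rule) (N : ℕ) (m : Store) : Prop :=
  (∃ v b, I.Searching ρ v b N m) ∨ ∃ v, I.Finished ρ v m

lemma BaseStore.set_time (hb : I.BaseStore v m) (hbest : m.idx cBest = b) {c : ℝ} :
    I.BaseStore (Function.update v b (1 / c)) (m.set aTime cBest c) where
  idx_n := hb.idx_n
  idx_k := hb.idx_k
  idx_zero := hb.idx_zero
  release := hb.release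
  time j := by
    rcases eq_or_ne j b with rfl | hne
    · simp [Store.set, hbest]
    · simp [Store.set, hbest, hne, Fin.val_ne_of_ne hne, hb.time]
  done_zero := hb.done_zero
  inv := hb.inv
  shrink := hb.shrink
  zero := hb.zero
  one := hb.one

lemma InLattice.update (hL : I.InLattice v) {c : ℝ} (hc : c ∈ I.lattice) :
    I.InLattice (Function.update v b (1 / c)) := by
  intro j
  rcases eq_or_ne j b with rfl | hne
  · rwa [Function.update_self, one_div_one_div]
  · rw [Function.update_of_ne hne]
    exact hL j

lemma raiseBest_triple (hm : m.ValuesIn G) (hb : I.BaseStore v m) (hL : I.InLattice v)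
    (hs : I.Selected v b m) (hmid : I.Midway ρ v b) (hcan : I.CanRaise ρ v b)
    (hactive : m.idx cActive = 1) {N : ℕ} (hN : I.n * I.k + I.n + 1 ≤ N + 1 + I.events v) :
    Triple G raiseBest m 1 (I.MainInv ρ N) := by
  have hk := floorIdx_lt_of_realGain_nonneg hcan.1.nonneg
  have hevents := hs.event.events_lt hmid.1 hk
  refine Triple.arith hm (m.num aBestEvent 0) ?_ (hm _ _) (.inl ⟨_, b, hb.set_time hs.best,
    hL.update (hs.event.mem_lattice hL hk), hactive, hs.best, hmid.raise hcan hs.event, by omega⟩)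
  simp [Arith.eval, Store.get, hb.idx_zero, hb.zero]

lemma deactivate_triple (hm : m.ValuesIn G) (hb : I.BaseStore v m) (hL : I.InLattice v)
    (hmax : ∀ j, I.realGain v j ≤ I.realGain v b) (hmid : I.Midway ρ v b)
    (hinactive : ¬ ρ.RealActive (I.realGain v b)) {N : ℕ} :
    Triple G (.zero cActive) m 1 (I.MainInv ρ N) :=
  Triple.zero hm (.inr ⟨v, hb.setIdx (by decide) _, hL, Store.setIdx_idx_self _ _ _,
    hmid.run fun hcan => hinactive hcan.1,
    (halted_iff hmid.1).2 fun j hj => hinactive (hj.mono (hmax j))⟩)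

lemma decideStep_triple (hm : m.ValuesIn G) (hb : I.BaseStore v m) (hL : I.InLattice v)
    (hs : I.Selected v b m) (hmax : ∀ j, I.realGain v j ≤ I.realGain v b) (hmid : I.Midway ρ v b)
    (hactive : m.idx cActive = 1) {N : ℕ} (hN : I.n * I.k + I.n + 1 ≤ N + 1 + I.events v) :
    Triple G (decideStep ρ) m 2 (I.MainInv ρ N) := by
  have hraise (h : ρ.RealActive (I.realGain v b)) : Triple G raiseBest m 1 (I.MainInv ρ N) :=
    raiseBest_triple hm hb hL hs hmid ⟨h, hmax⟩ hactive hN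
  have hhalt (h : ¬ ρ.RealActive (I.realGain v b)) :
      Triple G (.zero cActive) m 1 (I.MainInv ρ N) := deactivate_triple hm hb hL hmax hmid h
  cases ρ with
  | positive =>
    have htest : (Test.numLt aZero cZero aBestGain cZero).Holds m ↔ 0 < I.realGain v b := by
      simp [Test.Holds, Store.get, hb.idx_zero, hb.zero, hs.gain]
    exact Triple.cond hm (fun h => hraise (htest.1 h)) fun h => hhalt (htest.not.1 h)
  | nonneg =>
    have htest : (Test.numLt aBestGain cZero aZero cZero).Holds m ↔ I.realGain v b < 0 := by
      simp [Test.Holds, Store.get, hb.idx_zero, hb.zero, hs.gain]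
    exact Triple.cond hm (fun h => hhalt (not_le.2 (htest.1 h))) fun h =>
      hraise (not_lt.1 (htest.not.1 h))

lemma mainLoop_triple (hG : I.CoversNumbers G) (hm : m.ValuesIn G) {N : ℕ} (h : I.MainInv ρ N m) :
    Triple G (.loop (.idxLt cZero cActive) (.seq select (decideStep ρ))) m
      (N * (I.selectCost + 2 + 1) + 1) fun m' => ∃ v, I.Finished ρ v m' := by
  refine Triple.loop (I.MainInv ρ) ?_ ?_ N hm h
  · rintro N m' hm' (⟨v, b, h⟩ | ⟨v, h⟩) htest
    · have := h.bound.trans (Nat.add_le_add_left (events_le v) N)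
      obtain ⟨N, rfl⟩ : ∃ N', N = N' + 1 := ⟨N - 1, by omega⟩
      refine ⟨N, rfl, (select_triple hG hm' h.base h.midway.1 h.inLattice h.best).frame.seq ?_⟩
      rintro m'' hm'' ⟨⟨hb, b', hs, hsup, hmax⟩, hframe⟩
      exact decideStep_triple hm'' hb h.inLattice hs hmax (h.midway.select hsup)
        ((hframe.1 cActive (by decide)).trans h.active) h.bound
    · rw [Test.Holds, h.base.idx_zero, h.active] at htest
      exact absurd htest (lt_irrefl 0)
  · rintro N m' - (⟨v, b, h⟩ | h) htest
    · rw [Test.Holds, h.base.idx_zero, h.active] at htest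
      exact absurd one_pos htest
    · exact h

end Spec

end Inst

namespace Inst

section Spec

variable {I : Inst} {ρ : Rule} {v : Fin I.n → ℝ} {G : Set ℝ} {m m' : Store} {i : ℕ}

/-! ### Input and output -/

lemma output_triple (hG : I.CoversNumbers G) (hm : m.ValuesIn G) (hb : I.BaseStore v m)
    (hv : I.InRange v) (hL : I.InLattice v) :
    Triple G output m (I.n * 3 + 2) fun m' => ∀ j : Fin I.n, m'.num aTime j = v j := by
  refine Triple.zero_seq hm ((Triple.forLoop (fun i m' => ∀ j : Fin I.n, m'.num aTime j =
    if j.val < i then v j else 1 / v j) (by decide) (by decide) ?_ (hm.setIdx _ _)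
    (Store.setIdx_idx_self _ _ _) (hb.setIdx (by decide) _).idx_n (Nat.zero_le _)
    fun j => hb.time j).mono le_rfl fun m' _ ⟨_, h, _⟩ j => (h j).trans (if_pos j.isLt))
  intro i m' hi hm' hj hframe htime
  have hidx : m'.idx cZero = 0 :=
    (hframe.1 cZero (by decide)).trans (hb.setIdx (by decide) _).idx_zero
  have hone : m'.num aOne 0 = 1 := hframe.2 aOne (by decide) ▸ hb.one
  have hspeed := hG.inv _ (hL ⟨i, hi⟩) (hv.le_inv _) (hv.inv_le _)
  rw [one_div_one_div] at hspeed
  have hi' : m'.num aTime i = 1 / v ⟨i, hi⟩ := by simpa using htime ⟨i, hi⟩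
  refine Triple.arith hm' (v ⟨i, hi⟩) ?_ hspeed fun j => ?_
  · simp [Arith.eval, Store.get, hidx, hone, hj, hi']
  · rcases eq_or_ne j ⟨i, hi⟩ with rfl | hne
    · simp [Store.set, Store.setIdx, hj]
    · have hne' : j.val ≠ i := fun h => hne (Fin.ext h)
      have hlt : j.val < i + 1 ↔ j.val < i := by omega
      simp [Store.set, Store.setIdx, hj, hne', hlt, htime j]

/-- The store holds the instance and the number one. -/
structure InputStore (I : Inst) (m : Store) : Prop where
  idx_n : m.idx cN = I.n
  idx_k : m.idx cK = I.k
  idx_zero : m.idx cZero = 0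
  release : ∀ i, m.num aRelease i = I.releaseAt i
  speed : ∀ i, m.num aSpeed i = I.speedAt i
  power : ∀ i, m.num aPower i = I.powerAt i
  done_zero : m.num aDone 0 = 0
  zero : m.num aZero 0 = 0
  one : m.num aOne 0 = 1

namespace InputStore

lemma congr (h : I.InputStore m) (hidx : ∀ x < 3, m'.idx x = m.idx x)
    (hnum : ∀ a ∈ [aRelease, aSpeed, aPower, aDone, aZero, aOne], m'.num a = m.num a) :
    I.InputStore m' where
  idx_n := (hidx cN (by decide)).trans h.idx_n
  idx_k := (hidx cK (by decide)).trans h.idx_k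
  idx_zero := (hidx cZero (by decide)).trans h.idx_zero
  release := hnum aRelease (by decide) ▸ h.release
  speed := hnum aSpeed (by decide) ▸ h.speed
  power := hnum aPower (by decide) ▸ h.power
  done_zero := hnum aDone (by decide) ▸ h.done_zero
  zero := hnum aZero (by decide) ▸ h.zero
  one := hnum aOne (by decide) ▸ h.one

lemma of_frame {p : Cmd} (h : I.InputStore m) (hframe : p.Frame m m')
    (hidx : ∀ x < 3, x ∉ p.idxWrites := by decide)
    (hnum : ∀ a ∈ [aRelease, aSpeed, aPower, aDone, aZero, aOne], a ∉ p.numWrites := by decide) :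
    I.InputStore m' :=
  h.congr (fun x hx => hframe.1 x (hidx x hx)) fun a ha => hframe.2 a (hnum a ha)

lemma setIdx (h : I.InputStore m) {x : ℕ} (hx : 3 ≤ x) (i : ℕ) : I.InputStore (m.setIdx x i) :=
  h.congr (fun _ hy => Function.update_of_ne (hy.trans_le hx).ne _ _) fun _ _ => rfl

end InputStore

/-- The constants of the levels below `i` are computed. -/
structure LevelsReady (I : Inst) (i : ℕ) (m : Store) : Prop where
  inv : ∀ e < i, m.num aInv e = 1 / I.speedAt e
  inv_zero : ∀ e, i ≤ e → m.num aInv e = 0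
  shrink : ∀ e, 0 < e → e < i → m.num aShrink e = I.shrinkAt e

lemma LevelsReady.succ (h : I.LevelsReady i m)
    (hinv : m'.num aInv = (m.set aInv cLevel (1 / I.speedAt i)).num aInv)
    (hshrink : ∀ e ≠ i, m'.num aShrink e = m.num aShrink e)
    (hi : m'.num aShrink i = I.shrinkAt i) (hlevel : m.idx cLevel = i) :
    I.LevelsReady (i + 1) m' where
  inv e he := by
    rw [hinv]
    rcases (Nat.le_of_lt_succ he).eq_or_lt with rfl | he
    · simp [Store.set, hlevel]
    · simpa [Store.set, hlevel, he.ne] using h.inv e he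
  inv_zero e he := by
    rw [hinv]
    simpa [Store.set, hlevel, (Nat.lt_of_succ_le he).ne'] using h.inv_zero e (by omega)
  shrink e h0 he := by
    rcases (Nat.le_of_lt_succ he).eq_or_lt with rfl | he
    · exact hi
    · rw [hshrink e he.ne, h.shrink e h0 he]

lemma setupLevel_triple (hG : I.CoversNumbers G) (hm : m.ValuesIn G) (h : I.InputStore m)
    (hlevel : m.idx cLevel = i) (h0 : 0 < i) (hi : i < I.k) (hr : I.LevelsReady i m) :
    Triple G setupLevel m 8 (I.LevelsReady (i + 1)) := by
  have hidx := h.idx_zero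
  refine Triple.copy_seq hm (Triple.inc_seq (hm.setIdx _ _) ?_)
  refine Triple.arith_seq ((hm.setIdx _ _).setIdx _ _) (1 / I.speedAt i) ?_
    (hG.inv_speedAt_mem h0 hi.le) fun hm1 => ?_
  · simp [Arith.eval, Store.get, Store.setIdx, hidx, hlevel, h.one, h.speed]
  refine Triple.arith_seq hm1 (I.powerAt (i + 1) * I.speedAt i) ?_ (hG.mul _ _) fun hm2 => ?_
  · simp [Arith.eval, Store.get, Store.setIdx, Store.set, hlevel, h.speed, h.power]
  refine Triple.arith_seq hm2 (I.powerAt i * I.speedAt (i + 1)) ?_ (hG.mul _ _) fun hm3 => ?_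
  · simp [Arith.eval, Store.get, Store.setIdx, Store.set, hlevel, h.speed, h.power]
  refine Triple.arith_seq hm3 (I.powerAt (i + 1) * I.speedAt i - I.powerAt i * I.speedAt (i + 1))
    ?_ (hG.mul_sub _) fun hm4 => ?_
  · simp [Arith.eval, Store.get, Store.setIdx, Store.set, hidx]
  refine Triple.arith_seq hm4 (I.speedAt (i + 1) - I.speedAt i) ?_ (hG.sub _) fun hm5 => ?_
  · simp [Arith.eval, Store.get, Store.setIdx, Store.set, hlevel, h.speed]
  refine Triple.arith hm5 (I.shrinkAt i) ?_ (hG.shrinkAt _) (hr.succ ?_ (fun e he => ?_) ?_ hlevel)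
  · simp [Arith.eval, Store.get, Store.setIdx, Store.set, hidx, shrinkAt_of_lt hi]
  · simp [Store.setIdx, Store.set]
  · simp [Store.setIdx, Store.set, hlevel, he]
  · simp [Store.setIdx, Store.set, hlevel]

lemma setupLevels_triple (hG : I.CoversNumbers G) (hm : m.ValuesIn G) (h : I.InputStore m)
    (hlevel : m.idx cLevel = 1) (hr : I.LevelsReady 1 m) :
    Triple G (.forLoop cLevel cK setupLevel) m ((I.k - 1) * 10 + 1) fun m' =>
      m'.idx cLevel = I.k ∧ I.LevelsReady I.k m' := by
  refine (Triple.forLoop (fun i m' => 0 < i ∧ I.LevelsReady i m') (by decide) (by decide) ?_ hm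
    hlevel h.idx_k I.k_pos ⟨one_pos, hr⟩).mono le_rfl fun m' _ h => ⟨h.1, h.2.1.2⟩
  rintro i m' hi hm' hlevel' hframe ⟨h0, hr'⟩
  exact (setupLevel_triple hG hm' (h.of_frame hframe) hlevel' h0 hi hr').mono le_rfl
    fun m'' _ hr'' => ⟨i.succ_pos, hr''.inv, hr''.inv_zero, hr''.shrink⟩

lemma setupTop_triple (hG : I.CoversNumbers G) (hm : m.ValuesIn G) (h : I.InputStore m)
    (hlevel : m.idx cLevel = I.k) (hr : I.LevelsReady I.k m) :
    Triple G setupTop m (I.n * 3 + 4) (I.LevelsReady (I.k + 1)) := by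
  refine Triple.arith_seq hm (1 / I.speedAt I.k) ?_ (hG.inv_speedAt_mem I.k_pos le_rfl)
    fun hm1 => ?_
  · simp [Arith.eval, Store.get, h.idx_zero, hlevel, h.one, h.speed]
  refine Triple.const_seq hm1 (hG.nat 1 (by omega)) fun hm2 => Triple.zero_seq hm2 ?_
  refine (Triple.forLoop (n := I.n) (fun i m' => m'.num aShrink I.k = (i + 1 : ℕ) ∧
    ∀ e ≠ I.k, m'.num aShrink e = m.num aShrink e) (by decide) (by decide) ?_ (hm2.setIdx _ _)
    (Store.setIdx_idx_self _ _ _) ?_ (Nat.zero_le _) ?_).mono le_rfl ?_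
  · rintro i m' hi hm' hj hframe ⟨htop, hrest⟩
    have hlevel' : m'.idx cLevel = I.k := (hframe.1 cLevel (by decide)).trans <| by
      simpa [Store.setIdx, Store.set] using hlevel
    have hidx' : m'.idx cZero = 0 := (hframe.1 cZero (by decide)).trans <| by
      simpa [Store.setIdx, Store.set] using h.idx_zero
    have hone' : m'.num aOne 0 = 1 := hframe.2 aOne (by decide) ▸ h.one
    refine Triple.arith hm' ((i + 1 + 1 : ℕ) : ℝ) ?_ (hG.nat _ (by omega)) ⟨?_, fun e he => ?_⟩
    · simp [Arith.eval, Store.get, hlevel', htop, hidx', hone']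
    · simp [Store.set, Store.setIdx, hlevel']
    · simpa [Store.set, Store.setIdx, hlevel', he] using hrest e he
  · simpa [Store.setIdx, Store.set] using h.idx_n
  · exact ⟨by simp [Store.setIdx, Store.set, hlevel], fun e he => by
      simp [Store.setIdx, Store.set, hlevel, he]⟩
  · rintro m' - ⟨-, ⟨htop, hrest⟩, hframe⟩
    exact hr.succ ((hframe.2 aInv (by decide)).trans (by simp [Store.setIdx, Store.set])) hrest
      (by rw [htop, shrinkAt_of_le le_rfl]; push_cast; rfl) hlevel

lemma InputStore.baseStore_lowest (h : I.InputStore m) (hr : I.LevelsReady (I.k + 1) m)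
    (htime : ∀ i < I.n, m.num aTime i = 1 / I.speedAt 1) : I.BaseStore I.lowest m where
  idx_n := h.idx_n
  idx_k := h.idx_k
  idx_zero := h.idx_zero
  release i _ := h.release i
  time j := by rw [htime j j.isLt, lowest_apply]
  done_zero := h.done_zero
  inv i hi := by
    rcases hi.eq_or_lt with rfl | hi
    · rw [hr.inv_zero _ le_rfl, speedAt, dif_neg (lt_irrefl _), div_zero]
    · exact hr.inv i hi
  shrink i h0 hi := hr.shrink i h0 (Nat.lt_succ_of_le hi)
  zero := h.zero
  one := h.one

lemma setupTimes_triple (hG : I.CoversNumbers G) (hm : m.ValuesIn G) (h : I.InputStore m)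
    (hr : I.LevelsReady (I.k + 1) m) :
    Triple G setupTimes m (I.n * 3 + 4) (I.BaseStore I.lowest) := by
  have hk := I.k_pos
  refine Triple.zero_seq hm (Triple.inc_seq (hm.setIdx _ _) (Triple.zero_seq
    ((hm.setIdx _ _).setIdx _ _) ?_))
  rw [Store.setIdx_idx_self]
  have h' : I.InputStore (((m.setIdx cOne 0).setIdx cOne (0 + 1)).setIdx cJob 0) :=
    ((h.setIdx (by decide) _).setIdx (by decide) _).setIdx (by decide) _
  refine (Triple.forLoop (fun i m' => ∀ e < i, m'.num aTime e = 1 / I.speedAt 1) (by decide)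
    (by decide) ?_ (((hm.setIdx _ _).setIdx _ _).setIdx _ _) (Store.setIdx_idx_self _ _ _) h'.idx_n
    (Nat.zero_le _) fun e he => absurd he (Nat.not_lt_zero e)).mono le_rfl ?_
  · intro i m' hi hm' hj hframe htime
    have hin := h'.of_frame hframe
    have hone : m'.idx cOne = 1 := (hframe.1 cOne (by decide)).trans (by simp [Store.setIdx])
    have hinv : m'.num aInv 1 = 1 / I.speedAt 1 :=
      hframe.2 aInv (by decide) ▸ hr.inv 1 (by omega)
    refine Triple.arith hm' (1 / I.speedAt 1) ?_ (hG.inv_speedAt_mem one_pos hk) fun e he => ?_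
    · simp [Arith.eval, Store.get, hone, hinv, hin.idx_zero, hin.zero]
    · rcases (Nat.le_of_lt_succ he).eq_or_lt with rfl | he
      · simp [Store.set, Store.setIdx, hj]
      · simpa [Store.set, Store.setIdx, hj, he.ne] using htime e he
  · rintro m' - ⟨-, htime, hframe⟩
    have hinv := hframe.2 aInv (by decide)
    have hshrink := hframe.2 aShrink (by decide)
    exact (h'.of_frame hframe).baseStore_lowest
      ⟨hinv ▸ hr.inv, hinv ▸ hr.inv_zero, hshrink ▸ hr.shrink⟩ htime

/-- The steps of `setup`. -/
def setupCost (I : Inst) : ℕ := (I.k - 1) * 10 + 1 + ((I.n * 3 + 4) + (I.n * 3 + 4)) + 3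

lemma setup_triple (hG : I.CoversNumbers G) :
    Triple G setup I.input I.setupCost (I.BaseStore I.lowest) := by
  have hm : I.input.ValuesIn G := hG.input
  refine Triple.const_seq hm (hG.nat 1 (by omega)) fun hm1 => Triple.zero_seq hm1
    (Triple.inc_seq (hm1.setIdx _ _) ?_)
  rw [Store.setIdx_idx_self]
  have hin : I.InputStore (((I.input.set aOne cZero (1 : ℕ)).setIdx cLevel 0).setIdx cLevel
      (0 + 1)) := by
    constructor <;> simp [Store.setIdx, Store.set, input, releaseAt, speedAt, powerAt]
  have hready : I.LevelsReady 1 (((I.input.set aOne cZero (1 : ℕ)).setIdx cLevel 0).setIdx cLevel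
      (0 + 1)) := by
    refine ⟨fun e he => ?_, fun e _ => by simp [Store.setIdx, Store.set, input], by omega⟩
    rw [Nat.lt_one_iff.1 he, speedAt_zero, div_zero]
    simp [Store.setIdx, Store.set, input]
  refine (setupLevels_triple hG ((hm1.setIdx _ _).setIdx _ _) hin (Store.setIdx_idx_self _ _ _)
    hready).frame.seq ?_
  rintro m₁ hm₁ ⟨⟨hlevel₁, hr₁⟩, hframe₁⟩
  have hin₁ : I.InputStore m₁ := hin.of_frame hframe₁
  refine (setupTop_triple hG hm₁ hin₁ hlevel₁ hr₁).frame.seq ?_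
  rintro m₂ hm₂ ⟨hr₂, hframe₂⟩
  exact setupTimes_triple hG hm₂ (hin₁.of_frame hframe₂) hr₂

/-- The steps of the whole program. -/
def programCost (I : Inst) : ℕ :=
  I.setupCost + ((I.n * I.k + I.n + 1) * (I.selectCost + 2 + 1) + 1 + (I.n * 3 + 2) + 3) + 1

lemma program_triple (hG : I.CoversNumbers G) : Triple G (program ρ) I.input I.programCost
    fun m' => ∃ M v, I.Run ρ M v ∧ I.Halted ρ v ∧ ∀ j : Fin I.n, m'.num aTime j = v j := by
  refine Triple.cond hG.input (fun hn => ?_) fun hn => ?_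
  · have hn' : 0 < I.n := by simpa [Test.Holds, input] using hn
    refine (setup_triple hG).seq fun m₁ hm₁ hb => Triple.zero_seq hm₁
      (Triple.inc_seq (hm₁.setIdx _ _) (Triple.zero_seq ((hm₁.setIdx _ _).setIdx _ _) ?_))
    have hsearch : I.Searching ρ I.lowest ⟨0, hn'⟩ (I.n * I.k + I.n + 1)
        (((m₁.setIdx cActive 0).setIdx cActive ((m₁.setIdx cActive 0).idx cActive + 1)).setIdx
          cBest 0) :=
      { base := ((hb.setIdx (by decide) _).setIdx (by decide) _).setIdx (by decide) _
        inLattice := fun j => lowest_apply (j := j) ▸ inv_speedAt_mem_lattice one_pos I.k_pos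
        active := by simp [Store.setIdx]
        best := Store.setIdx_idx_self _ _ _
        midway := Run.init.midway _
        bound := Nat.le_add_right _ _ }
    refine (mainLoop_triple hG (((hm₁.setIdx _ _).setIdx _ _).setIdx _ _)
      (.inl ⟨_, _, hsearch⟩)).seq fun m₂ hm₂ ⟨v, hfin⟩ => ?_
    obtain ⟨M, hM⟩ := hfin.run
    exact (output_triple hG hm₂ hfin.base hM.inRange hfin.inLattice).mono le_rfl
      fun m' _ hout => ⟨M, v, hM, hfin.halted, hout⟩
  · have hn' : I.n = 0 := by simpa [Test.Holds, input] using hn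
    have : IsEmpty (Fin I.n) := hn' ▸ Fin.isEmpty
    exact (Triple.skip hG.input ⟨0, I.lowest, Run.init, isEmptyElim, isEmptyElim⟩).of_le
      (by omega)

end Spec

end Inst

/-! ### The length of the numbers -/

/-- `z` is a fraction whose numerator and denominator have at most `p` binary digits. The fraction
need not be reduced. -/
def FracBits (p : ℕ) (z : ℝ) : Prop :=
  ∃ (a : ℤ) (d : ℕ), 0 < d ∧ z = a / d ∧ a.natAbs < 2 ^ p ∧ d < 2 ^ p

lemma bitSize_coe (q : ℚ) : bitSize q = 1 + Nat.size q.num.natAbs + Nat.size q.den := by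
  have h : ∃ q' : ℚ, (q' : ℝ) = (q : ℝ) := ⟨q, rfl⟩
  rw [bitSize, dif_pos h, Rat.cast_injective (α := ℝ) h.choose_spec]

lemma zmultiples_one_div_le {d D : ℕ} (hD : D ≠ 0) (h : d ∣ D) :
    AddSubgroup.zmultiples (1 / d : ℝ) ≤ AddSubgroup.zmultiples (1 / D : ℝ) := by
  obtain ⟨e, rfl⟩ := h
  have he : (e : ℝ) ≠ 0 := Nat.cast_ne_zero.2 (right_ne_zero_of_mul hD)
  refine AddSubgroup.zmultiples_le_of_mem (AddSubgroup.mem_zmultiples_iff.2 ⟨e, ?_⟩)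
  rw [zsmul_eq_mul, Int.cast_natCast, Nat.cast_mul, mul_one_div, div_mul_cancel_right₀ he, one_div]

lemma natAbs_lt_two_pow_iff {a : ℤ} {p : ℕ} : a.natAbs < 2 ^ p ↔ |(a : ℝ)| < 2 ^ p := by
  rw [← Int.cast_abs, Int.abs_eq_natAbs, Int.cast_natCast]
  exact_mod_cast Iff.rfl

namespace FracBits

variable {p q : ℕ} {x y z : ℝ}

lemma mono (h : FracBits p z) (hpq : p ≤ q) : FracBits q z := by
  obtain ⟨a, d, hd, hz, ha, hd'⟩ := h
  have := Nat.pow_le_pow_right two_pos hpq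
  exact ⟨a, d, hd, hz, ha.trans_le this, hd'.trans_le this⟩

/-- Reducing the fraction does not make its terms longer. -/
lemma bitSize_le (h : FracBits p z) : bitSize z ≤ 1 + 2 * p := by
  obtain ⟨a, d, hd, rfl, ha, hd'⟩ := h
  have hcast : ((a : ℝ) / d) = ((a / d : ℚ) : ℝ) := by push_cast; rfl
  have hdiv : (a / d : ℚ) = Rat.divInt a (d : ℤ) := by rw [Rat.divInt_eq_div]; push_cast; rfl
  have hnum : (a / d : ℚ).num.natAbs < 2 ^ p := by
    rcases eq_or_ne a 0 with rfl | h0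
    · simp
    · refine (Nat.le_of_dvd (Int.natAbs_pos.2 h0) (Int.natAbs_dvd_natAbs.2 ?_)).trans_lt ha
      exact hdiv ▸ Rat.num_dvd a (by exact_mod_cast hd.ne')
  have hden : (a / d : ℚ).den < 2 ^ p :=
    (Nat.le_of_dvd hd (by exact_mod_cast hdiv ▸ Rat.den_dvd a (d : ℤ))).trans_lt hd'
  rw [hcast, bitSize_coe]
  linarith [Nat.size_le.2 hnum, Nat.size_le.2 hden]

lemma of_bitSize (hz : ∃ q : ℚ, (q : ℝ) = z) (h : bitSize z ≤ p) : FracBits p z := by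
  obtain ⟨q, rfl⟩ := hz
  rw [bitSize_coe] at h
  refine ⟨q.num, q.den, q.pos, ?_, Nat.size_le.1 (by omega), Nat.size_le.1 (by omega)⟩
  exact_mod_cast (Rat.num_div_den q).symm

lemma natCast {c : ℕ} (hp : 0 < p) (h : c < 2 ^ p) : FracBits p c :=
  ⟨c, 1, one_pos, by simp, by simpa using h, Nat.one_lt_two_pow hp.ne'⟩

lemma mul (hx : FracBits p x) (hy : FracBits q y) : FracBits (p + q) (x * y) := by
  obtain ⟨a, d, hd, rfl, ha, hd'⟩ := hx
  obtain ⟨b, e, he, rfl, hb, he'⟩ := hy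
  refine ⟨a * b, d * e, Nat.mul_pos hd he, ?_, ?_, ?_⟩
  · push_cast
    rw [div_mul_div_comm]
  · rw [Int.natAbs_mul, pow_add]
    exact Nat.mul_lt_mul'' ha hb
  · rw [pow_add]
    exact Nat.mul_lt_mul'' hd' he'

lemma neg (hx : FracBits p x) : FracBits p (-x) := by
  obtain ⟨a, d, hd, rfl, ha, hd'⟩ := hx
  exact ⟨-a, d, hd, by push_cast; ring, by simpa using ha, hd'⟩

lemma add (hx : FracBits p x) (hy : FracBits q y) : FracBits (p + q + 1) (x + y) := by
  obtain ⟨a, d, hd, rfl, ha, hd'⟩ := hx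
  obtain ⟨b, e, he, rfl, hb, he'⟩ := hy
  have hae : (a * e).natAbs < 2 ^ (p + q) := by
    rw [Int.natAbs_mul, pow_add]
    exact Nat.mul_lt_mul'' ha (by simpa using he')
  have hdb : (d * b).natAbs < 2 ^ (p + q) := by
    rw [Int.natAbs_mul, pow_add]
    exact Nat.mul_lt_mul'' (by simpa using hd') hb
  have hde : d * e < 2 ^ (p + q) := pow_add 2 p q ▸ Nat.mul_lt_mul'' hd' he'
  have hadd := Int.natAbs_add_le (a * e) (d * b)
  refine ⟨a * e + d * b, d * e, Nat.mul_pos hd he, ?_, ?_, ?_⟩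
  · push_cast
    exact div_add_div _ _ (Nat.cast_ne_zero.2 hd.ne') (Nat.cast_ne_zero.2 he.ne')
  · rw [pow_succ]
    omega
  · rw [pow_succ]
    omega

lemma sub (hx : FracBits p x) (hy : FracBits q y) : FracBits (p + q + 1) (x - y) :=
  sub_eq_add_neg x y ▸ hx.add hy.neg

lemma one_div (hx : FracBits p x) : FracBits p (1 / x) := by
  obtain ⟨a, d, hd, rfl, ha, hd'⟩ := hx
  rcases eq_or_ne a 0 with rfl | h0
  · exact ⟨0, 1, one_pos, by simp, by simp, lt_of_le_of_lt hd hd'⟩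
  · have hpos := Int.natAbs_pos.2 h0
    obtain ⟨c, rfl | rfl⟩ := a.eq_nat_or_neg
    · exact ⟨d, c, by simpa using hpos, by simp, by simpa using hd', by simpa using ha⟩
    · exact ⟨-d, c, by simpa using hpos, by simp [div_neg, neg_div], by simpa using hd',
        by simpa using ha⟩

lemma div (hx : FracBits p x) (hy : FracBits q y) : FracBits (p + q) (x / y) :=
  div_eq_mul_one_div x y ▸ hx.mul hy.one_div

lemma abs_lt (hx : FracBits p x) : |x| < 2 ^ p := by
  obtain ⟨a, d, hd, rfl, ha, -⟩ := hx
  have hd1 : (1 : ℝ) ≤ d := by exact_mod_cast hd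
  rw [abs_div, abs_of_pos (one_pos.trans_le hd1)]
  exact (div_le_self (abs_nonneg _) hd1).trans_lt (natAbs_lt_two_pow_iff.1 ha)

lemma exists_mem_zmultiples (hz : FracBits p z) :
    ∃ d : ℕ, 0 < d ∧ d ≤ 2 ^ p ∧ z ∈ AddSubgroup.zmultiples (1 / d : ℝ) := by
  obtain ⟨a, d, hd, rfl, -, hd'⟩ := hz
  exact ⟨d, hd, hd'.le, AddSubgroup.mem_zmultiples_iff.2 ⟨a, by rw [zsmul_eq_mul, mul_one_div]⟩⟩

end FracBits

namespace Inst

variable {I : Inst}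

lemma bitSize_r_le (j : Fin I.n) : bitSize (I.r j) ≤ I.size := by
  have := Finset.single_le_sum (f := fun j => bitSize (I.r j)) (fun _ _ => Nat.zero_le _)
    (Finset.mem_univ j)
  unfold size
  omega

lemma bitSize_s_le (i : Fin (I.k + 1)) : bitSize (I.s i) ≤ I.size := by
  have := Finset.single_le_sum (f := fun i => bitSize (I.s i)) (fun _ _ => Nat.zero_le _)
    (Finset.mem_univ i)
  unfold size
  omega

lemma bitSize_P_le (i : Fin (I.k + 1)) : bitSize (I.P i) ≤ I.size := by
  have := Finset.single_le_sum (f := fun i => bitSize (I.P i)) (fun _ _ => Nat.zero_le _)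
    (Finset.mem_univ i)
  unfold size
  omega

lemma n_add_k_le_size : I.n + I.k ≤ I.size := by
  unfold size
  omega

lemma size_pos : 0 < I.size :=
  I.k_pos.trans_le ((Nat.le_add_left _ _).trans n_add_k_le_size)

lemma n_lt_two_pow : I.n < 2 ^ I.size :=
  ((Nat.le_add_right _ _).trans n_add_k_le_size).trans_lt Nat.lt_two_pow_self

lemma fracBits_zero : FracBits I.size 0 := by
  exact_mod_cast FracBits.natCast (c := 0) size_pos (Nat.two_pow_pos _)

lemma fracBits_natCast {c : ℕ} (hc : c ≤ I.n + 1) : FracBits (I.size + 1) c := by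
  have := n_lt_two_pow (I := I)
  exact FracBits.natCast (Nat.succ_pos _) (by rw [pow_succ]; omega)

lemma fracBits_releaseAt (hI : I.IsRational) (i : ℕ) : FracBits I.size (I.releaseAt i) := by
  unfold releaseAt
  split_ifs
  · exact .of_bitSize (hI.1 _) (bitSize_r_le _)
  · exact fracBits_zero

lemma fracBits_speedAt (hI : I.IsRational) (i : ℕ) : FracBits I.size (I.speedAt i) := by
  unfold speedAt
  split_ifs
  · exact .of_bitSize (hI.2.1 _) (bitSize_s_le _)
  · exact fracBits_zero

lemma fracBits_powerAt (hI : I.IsRational) (i : ℕ) : FracBits I.size (I.powerAt i) := by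
  unfold powerAt
  split_ifs
  · exact .of_bitSize (hI.2.2 _) (bitSize_P_le _)
  · exact fracBits_zero

lemma fracBits_powerAt_mul_speedAt (hI : I.IsRational) (i i' : ℕ) :
    FracBits (2 * I.size) (I.powerAt i * I.speedAt i') :=
  ((fracBits_powerAt hI i).mul (fracBits_speedAt hI i')).mono (by omega)

lemma fracBits_shrinkAt (hI : I.IsRational) (i : ℕ) :
    FracBits (6 * I.size + 2) (I.shrinkAt i) := by
  unfold shrinkAt
  split_ifs
  · exact (((fracBits_powerAt_mul_speedAt hI _ _).sub (fracBits_powerAt_mul_speedAt hI _ _)).div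
      ((fracBits_speedAt hI _).sub (fracBits_speedAt hI _))).mono (by omega)
  · exact_mod_cast (fracBits_natCast (I := I) le_rfl).mono (by omega)

/-- The lattice is generated by `n + k` numbers, so that the product of their denominators is a
common denominator that is no longer than the input. -/
lemma exists_lattice_le_zmultiples (hI : I.IsRational) :
    ∃ D : ℕ, 0 < D ∧ D ≤ 2 ^ I.size ∧ I.lattice ≤ AddSubgroup.zmultiples (1 / D : ℝ) := by
  choose f hf_pos hf_le hf using fun j =>
    (FracBits.of_bitSize (hI.1 j) le_rfl).exists_mem_zmultiples
  choose g hg_pos hg_le hg using fun i =>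
    (FracBits.of_bitSize (hI.2.1 i) le_rfl).one_div.exists_mem_zmultiples
  have hD : 0 < (∏ j, f j) * ∏ i, g i :=
    Nat.mul_pos (Finset.prod_pos fun j _ => hf_pos j) (Finset.prod_pos fun i _ => hg_pos i)
  refine ⟨(∏ j, f j) * ∏ i, g i, hD, ?_, ?_⟩
  · calc (∏ j, f j) * ∏ i, g i
        ≤ (∏ j, 2 ^ bitSize (I.r j)) * ∏ i, 2 ^ bitSize (I.s i) :=
          Nat.mul_le_mul (Finset.prod_le_prod' fun j _ => hf_le j)
            (Finset.prod_le_prod' fun i _ => hg_le i)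
      _ = 2 ^ (∑ j, bitSize (I.r j) + ∑ i, bitSize (I.s i)) := by
          rw [Finset.prod_pow_eq_pow_sum, Finset.prod_pow_eq_pow_sum, pow_add]
      _ ≤ 2 ^ I.size := Nat.pow_le_pow_right two_pos (by unfold size; omega)
  · refine (AddSubgroup.closure_le _).2 ?_
    rintro _ (⟨j, rfl⟩ | ⟨i, -, hi, rfl⟩)
    · exact zmultiples_one_div_le hD.ne'
        ((Finset.dvd_prod_of_mem f (Finset.mem_univ j)).mul_right _) (hf j)
    · have hlevel := hg ⟨i, Nat.lt_succ_of_le hi⟩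
      rw [← speedAt_val] at hlevel
      exact zmultiples_one_div_le hD.ne'
        ((Finset.dvd_prod_of_mem g (Finset.mem_univ _)).mul_left _) hlevel

lemma horizon_lt (hI : I.IsRational) : I.horizon < 2 ^ (2 * I.size + 1) := by
  have hr : ∑ j, I.r j ≤ I.n * 2 ^ I.size := by
    calc ∑ j, I.r j ≤ ∑ _j : Fin I.n, (2 : ℝ) ^ I.size := Finset.sum_le_sum fun j _ =>
          (le_abs_self _).trans (releaseAt_val j ▸ (fracBits_releaseAt hI j).abs_lt).le
      _ = I.n * 2 ^ I.size := by simp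
  have hs : 1 / I.speedAt 1 < 2 ^ I.size :=
    (le_abs_self _).trans_lt (fracBits_speedAt hI 1).one_div.abs_lt
  have hn : (I.n : ℝ) + 1 ≤ 2 ^ I.size := by exact_mod_cast n_lt_two_pow (I := I)
  calc I.horizon = ∑ j, I.r j + (I.n + 1) * (1 / I.speedAt 1) := rfl
    _ < I.n * 2 ^ I.size + (I.n + 1) * 2 ^ I.size :=
        add_lt_add_of_le_of_lt hr (mul_lt_mul_of_pos_left hs (by positivity))
    _ ≤ 2 ^ I.size * 2 ^ I.size + 2 ^ I.size * 2 ^ I.size := by gcongr; linarith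
    _ = 2 ^ (2 * I.size + 1) := by ring

lemma fracBits_of_mem_lattice (hI : I.IsRational) {z : ℝ} (hz : z ∈ I.lattice)
    (h : |z| ≤ I.horizon) : FracBits (3 * I.size + 1) z := by
  obtain ⟨D, hD, hD_le, hlattice⟩ := exists_lattice_le_zmultiples hI
  obtain ⟨a, rfl⟩ := AddSubgroup.mem_zmultiples_iff.1 (hlattice hz)
  have hD0 : (0 : ℝ) < D := by exact_mod_cast hD
  rw [zsmul_eq_mul, mul_one_div] at h ⊢
  refine ⟨a, D, hD, rfl, natAbs_lt_two_pow_iff.2 ?_,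
    hD_le.trans_lt (Nat.pow_lt_pow_right one_lt_two (by omega))⟩
  rw [abs_div, abs_of_pos hD0, div_le_iff₀ hD0] at h
  calc |(a : ℝ)| ≤ I.horizon * D := h
    _ < 2 ^ (2 * I.size + 1) * D := mul_lt_mul_of_pos_right (horizon_lt hI) hD0
    _ ≤ 2 ^ (2 * I.size + 1) * 2 ^ I.size := by gcongr; exact_mod_cast hD_le
    _ = 2 ^ (3 * I.size + 1) := by ring

lemma coversNumbers_fracBits (hI : I.IsRational) :
    I.CoversNumbers {z | FracBits (7 * I.size + 4) z} where
  input a i := by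
    match a with
    | 0 => exact (fracBits_releaseAt hI i).mono (by omega)
    | 1 => exact (fracBits_speedAt hI i).mono (by omega)
    | 2 => exact (fracBits_powerAt hI i).mono (by omega)
    | _ + 3 => exact (fracBits_zero (I := I)).mono (by omega)
  nat c hc := (fracBits_natCast hc).mono (by omega)
  mul i i' := (fracBits_powerAt_mul_speedAt hI i i').mono (by omega)
  mul_sub i :=
    ((fracBits_powerAt_mul_speedAt hI _ _).sub (fracBits_powerAt_mul_speedAt hI _ _)).mono
      (by omega)
  sub i := ((fracBits_speedAt hI _).sub (fracBits_speedAt hI _)).mono (by omega)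
  shrinkAt i := (fracBits_shrinkAt hI i).mono (by omega)
  gain i c hc := ((FracBits.natCast size_pos (hc.trans_lt n_lt_two_pow)).sub
    (fracBits_shrinkAt hI i)).mono (by omega)
  time z hz h := (fracBits_of_mem_lattice hI hz h).mono (by omega)
  inv z hz h0 h1 := by
    have hpos : 0 < z := (one_div_pos.2 (speedAt_pos I.k_pos le_rfl)).trans_le h0
    have hz_le : |z| ≤ I.horizon := (abs_of_pos hpos).trans_le (h1.trans inv_speedAt_one_le_horizon)
    exact (fracBits_of_mem_lattice hI hz hz_le).one_div.mono (by omega)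

lemma coversNumbers_univ : I.CoversNumbers Set.univ := by
  constructor <;> intros <;> exact Set.mem_univ _

open Polynomial in
/-- A polynomial that bounds the steps of the program at every number that is at least `n` and at
least `k`. -/
def costBound : ℕ[X] :=
  (X ^ 2 + X + 1) * (9 * X ^ 2 + 30 * X + 21) + 19 * X + 19

lemma setupCost_le {N : ℕ} (hn : I.n ≤ N) (hk : I.k ≤ N) : I.setupCost ≤ 16 * N + 12 := by
  unfold setupCost
  omega

lemma selectCost_le {N : ℕ} (hn : I.n ≤ N) (hk : I.k ≤ N) :
    I.selectCost ≤ 9 * N ^ 2 + 30 * N + 18 := by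
  have hmul : I.n * (I.evalCost + 6) ≤ N * (9 * N + 15) :=
    Nat.mul_le_mul hn (by unfold evalCost; omega)
  unfold selectCost evalCost at *
  nlinarith

lemma programCost_le {N : ℕ} (hn : I.n ≤ N) (hk : I.k ≤ N) : I.programCost ≤ costBound.eval N := by
  have hsetup := setupCost_le hn hk
  have hloop : (I.n * I.k + I.n + 1) * (I.selectCost + 2 + 1) ≤
      (N ^ 2 + N + 1) * (9 * N ^ 2 + 30 * N + 21) :=
    Nat.mul_le_mul (by nlinarith) (by have := selectCost_le hn hk; omega)
  simp only [costBound, Polynomial.eval_add, Polynomial.eval_mul, Polynomial.eval_pow,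
    Polynomial.eval_X, Polynomial.eval_one, Polynomial.eval_ofNat]
  unfold programCost
  omega

end Inst

end SpeedScaling

end

open SpeedScaling in
theorem mainTheorem10 (ρ : Rule) :
    -- every run, with ties broken arbitrarily, ends after at most `n² k` iterations, and it ends
    -- with an optimal schedule
    (∀ (I : Inst) (m : ℕ) (v : Fin I.n → ℝ), I.Run ρ m v →
      m ≤ I.n ^ 2 * I.k ∧
      (I.Halted ρ v ∨ ∃ v', I.Iteration ρ v v') ∧
      (I.Halted ρ v → (I.fifo v).Optimal)) ∧
    -- one program carries out the algorithm on all instances, in a number of steps that is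
    -- polynomial in `n + k`, and in polynomial bit cost if the instance is rational
    ∃ (prog : Cmd) (p q : Polynomial ℕ), ∀ I : Inst,
      (∃ (out : Store) (t m : ℕ) (v : Fin I.n → ℝ),
        Exec unitCost prog I.input out t ∧ t ≤ p.eval (I.n + I.k) ∧
        I.Run ρ m v ∧ I.Halted ρ v ∧ ∀ j : Fin I.n, out.num 3 j = v j) ∧
      (I.IsRational → ∃ (out : Store) (t : ℕ),
        Exec bitSize prog I.input out t ∧ t ≤ q.eval I.size) := by
  refine ⟨fun I m v h => ⟨h.le_mul.trans ?_, ?_, h.optimal⟩, Inst.program ρ, Inst.costBound,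
    (1 + 3 * (1 + 2 * (7 * Polynomial.X + 4))) * Inst.costBound, fun I => ⟨?_, fun hI => ?_⟩⟩
  · exact Nat.mul_le_mul_right _ (Nat.le_self_pow two_ne_zero _)
  · exact or_iff_not_imp_left.2 (Inst.exists_iteration h.inRange)
  · obtain ⟨out, ⟨m, v, hrun, hhalt, hout⟩, -, hexec⟩ :=
      Inst.program_triple (ρ := ρ) (I := I) Inst.coversNumbers_univ
    obtain ⟨t, ht, hexec⟩ := hexec unitCost 0 fun _ _ => le_rfl
    refine ⟨out, t, m, v, hexec, ?_, hrun, hhalt, hout⟩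
    rw [mul_zero, add_zero, one_mul] at ht
    exact ht.trans (Inst.programCost_le (Nat.le_add_right _ _) (Nat.le_add_left _ _))
  · obtain ⟨out, -, -, hexec⟩ := Inst.program_triple (ρ := ρ) (Inst.coversNumbers_fracBits hI)
    obtain ⟨t, ht, hexec⟩ := hexec bitSize (1 + 2 * (7 * I.size + 4)) fun z hz =>
      FracBits.bitSize_le hz
    refine ⟨out, t, hexec, ht.trans ?_⟩
    simp only [Polynomial.eval_mul, Polynomial.eval_add, Polynomial.eval_X, Polynomial.eval_one,
      Polynomial.eval_ofNat]
    exact Nat.mul_le_mul_left _ (Inst.programCost_le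
      ((Nat.le_add_right _ _).trans Inst.n_add_k_le_size)
      ((Nat.le_add_left _ _).trans Inst.n_add_k_le_size))
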